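/- Let $p\ge 3$, $\mu\in S^{p-1}\subset\mathbb R^p$, $\kappa\in[0,\infty)$, let $\nu$ be the uniform probability measure on $S^{p-1}$, and let $f_\kappa(x)=c(\kappa)e^{\kappa x^t\mu}$ be the von Mises–Fisher density on $S^{p-1}$, with normalizing constant $c(\kappa)=\big(\int_{S^{p-1}}e^{\kappa x^t\mu}\,d\nu(x)\big)^{-1}$. Let $\mathbb F$ be a field and let $C_*$ denote singular chains with coefficients in $\mathbb F$. **Definitions.** For $r\in[-\infty,\infty]$ the *Morse filtration* of $C_*(S^{p-1})$ is $\mathcal F^M_r=C_*(\{f_\kappa\le r\})$. The *Čech filtration* is $\mathcal F^{\check C}_r=0$ for $r<0$ and $\mathcal F^{\check C}_rC_k=\mathrm{Const}_k+C_k(\{f_\kappa\ge 1/r\})$ for $r\ge 0$, where $\mathrm{Const}_k$ is spanned by the constant singular $k$-simplices, $1/0=\infty$ and $1/\infty=0$. For a $k$-cycle $\alpha$ let $I_\alpha$ be the interval of all $r\in[-\infty,\infty]$ such that $\alpha\in\mathcal F_r$ and $0\ne[\alpha]\in H_k(\mathcal F_r)$. A *Betti–$k$ barcode* is a family of nonempty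 intervals $J_\alpha\subseteq I_\alpha$, indexed by a set $S$ of $k$-cycles, such that for every $r\in[-\infty,\infty]$ the classes $[\alpha]$ with $\alpha\in S$ and $r\in J_\alpha$ form an $\mathbb F$-basis of $H_k(\mathcal F_r)$. That *the* Betti–$k$ barcode is a given family of intervals means that there is a Betti–$k$ barcode with $J_\alpha=I_\alpha$ for all $\alpha\in S$, and that every such barcode consists, with multiplicity, of exactly these intervals. For $r\in[0,\infty]$ let $g_\kappa(r)=\int_{\{f_\kappa\ge 1/r\}}f_\kappa\,d\nu$, and for $x\in(0,1]$ let $\beta_0(x,\kappa)=\inf\{r\in[0,\infty]: g_\kappa(r)\ge x\}$ (the *Betti–$0$ function*). Put $s_n=2\pi^{(n+1)/2}/\Gamma(\tfrac{n+1}{2})$ and, for $\lambda>-\tfrac12$ and $\kappa>0$, $I_\lambda(\kappa)=\frac{(\kappa/2)^\lambda}{\Gamma(\lambda+\frac12)\Gamma(\frac12)}\int_{-1}^1e^{\kappa t}(1-t^2)^{\lambda-\frac12}\,dt$. **Statement.** (0) $c(\kappa)>0$ and $\int f_\kappa\,d\nu=1$; moreover $c(0)=1$, and $c(\kappa)=\left(\frac\kappa2\right)^{\frac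 p2-1}\frac{1}{\Gamma(\frac p2)\,I_{\frac p2-1}(\kappa)}$ for $\kappa>0$. (1) For the Morse filtration the Betti–$0$ barcode is the single interval $[c(\kappa)e^{-\kappa},\infty]$, the Betti–$(p-1)$ barcode is the single interval $[c(\kappa)e^{\kappa},\infty]$, and all other Betti–$k$ barcodes are empty. (2) For the Čech filtration the Betti–$(p-1)$ barcode is the single interval $[e^{\kappa}/c(\kappa),\infty]$, and the Betti–$k$ barcode is empty for all other $k\ge1$. (3) If $\kappa=0$, then $g_0(r)=0$ for $r<1/c(0)$ and $g_0(r)=1$ for $r\ge 1/c(0)$, so that $\beta_0(x,0)=1/c(0)$ for all $x\in(0,1]$. (4) If $\kappa>0$, then $g_\kappa(r)=0$ for $r<e^{-\kappa}/c(\kappa)$, $g_\kappa(r)=1$ for $r>e^{\kappa}/c(\kappa)$, and for $e^{-\kappa}/c(\kappa)\le r\le e^{\kappa}/c(\kappa)$ $$g_\kappa(r)=c(\kappa)\frac{s_{p-2}}{s_{p-1}}\int_0^{\arccos\left(-\frac{\ln(rc(\kappa))}{\kappa}\right)}e^{\kappa\cos\theta}\sin^{p-2}\theta\,d\theta .$$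 The function $g_\kappa$ is continuous on $[0,\infty]$, and it restricts to a strictly increasing bijection from $[e^{-\kappa}/c(\kappa),e^{\kappa}/c(\kappa)]$ onto $[0,1]$, for whose inverse $g_\kappa^{-1}$ we have $\beta_0(x,\kappa)=g_\kappa^{-1}(x)$ for all $x\in(0,1]$. The graph $\{(x,g_\kappa^{-1}(x)): x\in[0,1]\}$ is the curve $$\left\{\left(c(\kappa)\frac{s_{p-2}}{s_{p-1}}\int_0^te^{\kappa\cos\theta}\sin^{p-2}\theta\,d\theta,\ \frac{e^{-\kappa\cos t}}{c(\kappa)}\right): t\in[0,\pi]\right\}.$$ -/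

import Mathlib

open MeasureTheory Set
open scoped ENNReal

noncomputable section

namespace DensityPersistence

/-! ### Singular chains -/

/-- A singular `k`-simplex of `X`: a continuous map from the standard `k`-simplex to `X`. -/
abbrev SingularSimplex (X : Type*) [TopologicalSpace X] (k : ℕ) : Type _ :=
  C(stdSimplex ℝ (Fin (k + 1)), X)

/-- `C_k(X)`: the free `F`-module on the singular `k`-simplices of `X`. -/
abbrev Chain (F : Type*) (X : Type*) [Field F] [TopologicalSpace X] (k : ℕ) : Type _ :=
  SingularSimplex X k →₀ F

/-- The `i`-th face inclusion of the standard `k`-simplex into the standard `(k+1)`-simplex. -/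
def faceInclusion (k : ℕ) (i : Fin (k + 2)) :
    C(stdSimplex ℝ (Fin (k + 1)), stdSimplex ℝ (Fin (k + 2))) :=
  ⟨stdSimplex.map i.succAbove, stdSimplex.continuous_map _⟩

section Chains

variable (F : Type*) [Field F] (X : Type*) [TopologicalSpace X]

/-- The singular differential `C_{k+1}(X) → C_k(X)`, `φ ↦ ∑ i, (-1)^i φ ∘ δ_i`. -/
def boundary (k : ℕ) : Chain F X (k + 1) →ₗ[F] Chain F X k :=
  ∑ i : Fin (k + 2), ((-1 : F) ^ (i : ℕ)) •
    Finsupp.lmapDomain F F (fun φ : SingularSimplex X (k + 1) => φ.comp (faceInclusion k i))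

/-- `Z_k(X)`: the singular `k`-cycles (every `0`-chain is a cycle). -/
def cycles : (k : ℕ) → Submodule F (Chain F X k)
  | 0 => ⊤
  | k + 1 => LinearMap.ker (boundary F X k)

variable {X}

/-- `C_k(A)` for a subspace `A` of `X`, as a submodule of `C_k(X)`. -/
def chainsOn (A : Set X) (k : ℕ) : Submodule F (Chain F X k) :=
  Finsupp.supported F F {φ : SingularSimplex X k | ∀ t, φ t ∈ A}

variable (X)

/-- `Const_k`: the span of the constant singular `k`-simplices. -/
def constChains (k : ℕ) : Submodule F (Chain F X k) :=
  Finsupp.supported F F {φ : SingularSimplex X k | ∃ m : X, ∀ t, φ t = m}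

end Chains

theorem boundary_mem_supported {F : Type*} [Field F] {X : Type*} [TopologicalSpace X] {k : ℕ}
    {s : Set (SingularSimplex X (k + 1))} {t : Set (SingularSimplex X k)}
    (hst : ∀ φ ∈ s, ∀ i, φ.comp (faceInclusion k i) ∈ t)
    {α : Chain F X (k + 1)} (hα : α ∈ Finsupp.supported F F s) :
    boundary F X k α ∈ Finsupp.supported F F t := by
  rw [boundary, LinearMap.sum_apply]
  refine Submodule.sum_mem _ fun i _ => Submodule.smul_mem _ _ ?_
  have h := Submodule.mem_map_of_mem
    (f := Finsupp.lmapDomain F F (fun φ : SingularSimplex X (k + 1) =>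
      φ.comp (faceInclusion k i))) hα
  rw [Finsupp.lmapDomain_supported] at h
  refine Finsupp.supported_mono ?_ h
  rintro _ ⟨φ, hφ, rfl⟩
  exact hst φ hφ i

theorem boundary_chainsOn (F : Type*) [Field F] {X : Type*} [TopologicalSpace X] (A : Set X)
    (k : ℕ) {α : Chain F X (k + 1)} (hα : α ∈ chainsOn F A (k + 1)) :
    boundary F X k α ∈ chainsOn F A k := by
  refine boundary_mem_supported ?_ hα
  intro φ hφ i t
  exact hφ _

theorem boundary_constChains (F : Type*) [Field F] {X : Type*} [TopologicalSpace X]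
    (k : ℕ) {α : Chain F X (k + 1)} (hα : α ∈ constChains F X (k + 1)) :
    boundary F X k α ∈ constChains F X k := by
  refine boundary_mem_supported ?_ hα
  rintro φ ⟨m, hm⟩ i
  exact ⟨m, fun t => hm _⟩

theorem boundary_single (F : Type*) [Field F] {X : Type*} [TopologicalSpace X] (k : ℕ)
    (φ : SingularSimplex X (k + 1)) :
    boundary F X k (Finsupp.single φ 1) =
      ∑ i : Fin (k + 2), Finsupp.single (φ.comp (faceInclusion k i)) ((-1 : F) ^ (i : ℕ)) := by
  simp [boundary, LinearMap.sum_apply, Finsupp.mapDomain_single]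

theorem faceInclusion_comp (k : ℕ) (i j : Fin (k + 2)) (h : i ≤ j) :
    (faceInclusion (k + 1) j.succ).comp (faceInclusion k i) =
      (faceInclusion (k + 1) i.castSucc).comp (faceInclusion k j) := by
  ext1 t
  change stdSimplex.map _ (stdSimplex.map _ t) = stdSimplex.map _ (stdSimplex.map _ t)
  rw [stdSimplex.map_comp_apply, stdSimplex.map_comp_apply]
  congr 1
  funext l
  dsimp [Fin.succAbove]
  rcases i with ⟨i, _⟩
  rcases j with ⟨j, _⟩
  rcases l with ⟨l, _⟩
  simp only [Fin.le_def, Fin.lt_def, Fin.ext_iff] at *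
  split_ifs <;> · simp at * <;> lia

/-- The singular chains form a chain complex: `d ∘ d = 0`. -/
theorem boundary_boundary (F : Type*) [Field F] (X : Type*) [TopologicalSpace X] (k : ℕ)
    (α : Chain F X (k + 2)) : boundary F X k (boundary F X (k + 1) α) = 0 := by
  suffices h : (boundary F X k).comp (boundary F X (k + 1)) = 0 from LinearMap.congr_fun h α
  ext φ : 2
  simp only [LinearMap.comp_apply, Finsupp.lsingle_apply, LinearMap.zero_apply]
  rw [boundary_single, map_sum]
  have hs : ∀ (c : F) (ψ : SingularSimplex X (k + 1)), boundary F X k (Finsupp.single ψ c) =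
      ∑ i : Fin (k + 2), Finsupp.single (ψ.comp (faceInclusion k i)) (c * (-1 : F) ^ (i : ℕ)) := by
    intro c ψ
    rw [← mul_one c, ← smul_eq_mul, ← Finsupp.smul_single, map_smul, boundary_single,
      Finset.smul_sum]
    simp
  simp only [hs, ← Finset.sum_product']
  let P := Fin (k + 3) × Fin (k + 2)
  let S : Finset P := {ij : P | (ij.1 : ℕ) ≤ (ij.2 : ℕ)}
  rw [Finset.univ_product_univ, ← Finset.sum_add_sum_compl S, ← eq_neg_iff_add_eq_zero,
    ← Finset.sum_neg_distrib]
  let ψ : ∀ ij : P, ij ∈ S → P := fun ij hij =>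
    (ij.2.succ, Fin.castLT ij.1 (lt_of_le_of_lt (Finset.mem_filter.mp hij).right (Fin.is_lt ij.2)))
  apply Finset.sum_bij ψ
  · intro ij hij
    simp_rw [S, ψ, Finset.compl_filter, Finset.mem_filter_univ, Fin.val_succ,
      Fin.val_castLT] at hij ⊢
    lia
  · rintro ⟨i, j⟩ hij ⟨i', j'⟩ hij' h
    have h1 := congr_arg (fun q : P => (q.1 : ℕ)) h
    have h2 := congr_arg (fun q : P => (q.2 : ℕ)) h
    simp only [ψ, Fin.val_succ, Fin.val_castLT] at h1 h2
    exact Prod.ext (Fin.ext h2) (Fin.ext (by simpa using h1))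
  · rintro ⟨i', j'⟩ hij'
    simp_rw [S, Finset.compl_filter, Finset.mem_filter_univ, not_le] at hij'
    refine ⟨(Fin.castSucc j', i'.pred ?_), ?_, ?_⟩
    · rintro rfl
      simp only [Fin.val_zero, not_lt_zero] at hij'
    · simpa [S] using Nat.le_sub_one_of_lt hij'
    · simp only [ψ, Fin.castLT_castSucc, Fin.succ_pred]
  · rintro ⟨i, j⟩ hij
    have hij2 : (i : ℕ) ≤ (j : ℕ) := by simpa [S] using hij
    rw [← Finsupp.single_neg]
    dsimp only [ψ]
    rw [ContinuousMap.comp_assoc, ContinuousMap.comp_assoc,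
      faceInclusion_comp k (Fin.castLT i (lt_of_le_of_lt hij2 j.is_lt)) j
        (by rw [Fin.le_def]; simpa using hij2)]
    congr 1
    simp only [Fin.val_succ, Fin.val_castLT]
    ring

/-! ### Filtrations, persistent homology and barcodes -/

/-- An increasing filtration of the singular chain complex of `X`, indexed by the extended reals,
which is zero at `-∞` and everything at `∞`. -/
structure Filtration (F : Type*) [Field F] (X : Type*) [TopologicalSpace X] where
  /-- The `k`-chains of the `r`-th subcomplex. -/
  sub : EReal → (k : ℕ) → Submodule F (Chain F X k)
  mono' : ∀ {r s : EReal}, r ≤ s → ∀ k, sub r k ≤ sub s k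
  boundary_mem' : ∀ (r : EReal) (k : ℕ) {α : Chain F X (k + 1)},
    α ∈ sub r (k + 1) → boundary F X k α ∈ sub r k
  sub_bot' : ∀ k, sub ⊥ k = ⊥
  sub_top' : ∀ k, sub ⊤ k = ⊤

/-- The quotient `Z / B` of two submodules `B ⊆ Z` of a module. -/
abbrev SubmoduleQuotient {R M : Type*} [Ring R] [AddCommGroup M] [Module R M]
    (Z B : Submodule R M) : Type _ :=
  Z ⧸ B.submoduleOf Z

namespace Filtration

variable {F : Type*} [Field F] {X : Type*} [TopologicalSpace X]

/-- `Z_k` of the `r`-th subcomplex. -/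
def cyclesAt (𝓕 : Filtration F X) (k : ℕ) (r : EReal) : Submodule F (Chain F X k) :=
  𝓕.sub r k ⊓ cycles F X k

/-- `B_k` of the `r`-th subcomplex. -/
def boundariesAt (𝓕 : Filtration F X) (k : ℕ) (r : EReal) : Submodule F (Chain F X k) :=
  (𝓕.sub r (k + 1)).map (boundary F X k)

/-- `B_k ⊆ Z_k` in the `r`-th subcomplex. -/
theorem boundariesAt_le_cyclesAt (𝓕 : Filtration F X) (k : ℕ) (r : EReal) :
    𝓕.boundariesAt k r ≤ 𝓕.cyclesAt k r := by
  rintro _ ⟨β, hβ, rfl⟩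
  refine ⟨𝓕.boundary_mem' r k hβ, ?_⟩
  cases k with
  | zero => trivial
  | succ k => exact boundary_boundary F X k β

/-- `H_k = Z_k / B_k` of the `r`-th subcomplex. -/
abbrev Homology (𝓕 : Filtration F X) (k : ℕ) (r : EReal) : Type _ :=
  SubmoduleQuotient (𝓕.cyclesAt k r) (𝓕.boundariesAt k r)

/-- The class in `H_k` of the `r`-th subcomplex of a `k`-cycle of that subcomplex. -/
def homologyClass (𝓕 : Filtration F X) (k : ℕ) (r : EReal) (α : Chain F X k)
    (hα : α ∈ 𝓕.cyclesAt k r) : 𝓕.Homology k r :=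
  Submodule.Quotient.mk ⟨α, hα⟩

/-- The persistence `k`-homology interval `I_α` of a `k`-cycle `α`: all `r` such that `α`
represents a nonzero homology class of the `r`-th subcomplex. -/
def persistenceInterval (𝓕 : Filtration F X) (k : ℕ) (α : Chain F X k) : Set EReal :=
  {r | ∃ hα : α ∈ 𝓕.cyclesAt k r, 𝓕.homologyClass k r α hα ≠ 0}

/-- The family `J_α`, `α ∈ S ⊆ Z_k`, is a Betti-`k` barcode: each `J_α` is a (nonempty)
subinterval of `I_α`, and for every `r` the classes `[α]`, for `α ∈ S` with `r ∈ J_α`, form a basis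
of the `k`-th homology of the `r`-th subcomplex. (Only the values of `J` on `S` matter.) -/
structure IsBettiBarcode (𝓕 : Filtration F X) (k : ℕ) (S : Set (Chain F X k))
    (J : Chain F X k → Set EReal) : Prop where
  cycle : ∀ α ∈ S, α ∈ cycles F X k
  nonempty : ∀ α ∈ S, (J α).Nonempty
  interval : ∀ α ∈ S, (J α).OrdConnected
  subinterval : ∀ α ∈ S, J α ⊆ 𝓕.persistenceInterval k α
  basis : ∀ r : EReal, ∃ b : Module.Basis {α : Chain F X k // α ∈ S ∧ r ∈ J α} F (𝓕.Homology k r),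
    ∀ α, ∃ hα : α.1 ∈ 𝓕.cyclesAt k r, b α = 𝓕.homologyClass k r α.1 hα

/-- "The Betti-`k` barcode of `𝓕` is the family of intervals `B`".
The conditions on a Betti barcode do not exclude that a bar is cut into several consecutive
pieces, so "the" barcode is the one whose bars are uncut, `J_α = I_α`: there is such a Betti-`k`
barcode, with intervals `B`, and every such Betti-`k` barcode has intervals `B`
(with multiplicity). -/
def BettiBarcodeEq (𝓕 : Filtration F X) (k : ℕ) {ι : Type*} (B : ι → Set EReal) : Prop :=
  (∃ (S : Set (Chain F X k)) (J : Chain F X k → Set EReal), 𝓕.IsBettiBarcode k S J ∧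
    (∀ α ∈ S, J α = 𝓕.persistenceInterval k α) ∧ ∃ e : ι ≃ S, ∀ i, J (e i) = B i) ∧
  ∀ (S : Set (Chain F X k)) (J : Chain F X k → Set EReal), 𝓕.IsBettiBarcode k S J →
    (∀ α ∈ S, J α = 𝓕.persistenceInterval k α) → ∃ e : ι ≃ S, ∀ i, J (e i) = B i

end Filtration

/-! ### The filtrations and the Betti-0 function of a density -/

section Density

variable {X : Type*} (f : X → ℝ≥0∞)

/-- The sublevel set `{f ≤ r}`. -/
def sublevel (r : EReal) : Set X := {x | (f x : EReal) ≤ r}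

/-- The superlevel set `{f ≥ s}`. -/
def superlevel (s : ℝ≥0∞) : Set X := {x | s ≤ f x}

/-- The Morse filtration: `C_*({f ≤ r})`. -/
def morseFiltration (F : Type*) [Field F] [TopologicalSpace X] : Filtration F X where
  sub r k := chainsOn F (sublevel f r) k
  mono' h k := Finsupp.supported_mono fun _ hφ t => (hφ t).trans h
  boundary_mem' r k _ hα := boundary_chainsOn F _ k hα
  sub_bot' k := by
    have : {φ : SingularSimplex X k | ∀ t, φ t ∈ sublevel f ⊥} = ∅ := by
      ext φ
      simp [sublevel]
    rw [chainsOn, this, Finsupp.supported_empty]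
  sub_top' k := by simp [chainsOn, sublevel, Finsupp.supported_univ]

/-- The Čech filtration: zero for `r < 0`, and `Const_k + C_k({f ≥ 1/r})` in degree `k` for
`r ≥ 0`, where `1/0 = ∞` and `1/∞ = 0` in `[0,∞]`. In degree `0`, where every singular simplex is
constant, the latter is all of `C_0`. -/
def cechFiltration (F : Type*) [Field F] [TopologicalSpace X] : Filtration F X where
  sub r k := if r < 0 then ⊥ else
    constChains F X k ⊔ chainsOn F (superlevel f (r.toENNReal)⁻¹) k
  mono' {r s} h k := by
    split_ifs with h1 h2
    · exact le_rfl
    · exact bot_le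
    · exact absurd (h.trans_lt ‹_›) h1
    · refine sup_le_sup le_rfl (Finsupp.supported_mono fun φ hφ t => ?_)
      exact (ENNReal.inv_le_inv.2 (EReal.toENNReal_le_toENNReal h)).trans (hφ t)
  boundary_mem' r k α hα := by
    split_ifs at hα ⊢ with h
    · rw [Submodule.mem_bot] at hα ⊢
      rw [hα, map_zero]
    · obtain ⟨a, ha, b, hb, rfl⟩ := Submodule.mem_sup.1 hα
      rw [map_add]
      exact Submodule.add_mem_sup (boundary_constChains F k ha) (boundary_chainsOn F _ k hb)
  sub_bot' k := by simp
  sub_top' k := by simp [chainsOn, superlevel, Finsupp.supported_univ]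

variable [MeasurableSpace X] (ν : Measure X)

/-- `g(r) = ∫_{f ≥ 1/r} f dν` for `r ∈ [0,∞]`. -/
def excessMass (r : ℝ≥0∞) : ℝ≥0∞ := ∫⁻ x in superlevel f r⁻¹, f x ∂ν

/-- The Betti-0 function `β₀(x) = inf {r ∈ [0,∞] | g(r) ≥ x}`. -/
def bettiZeroFunction (x : ℝ≥0∞) : ℝ≥0∞ := sInf {r : ℝ≥0∞ | x ≤ excessMass f ν r}

end Density

/-! ### The von Mises-Fisher density -/

/-- The unit sphere `S^{p-1}` in `ℝ^p`. -/
abbrev Sphere (p : ℕ) : Type := Metric.sphere (0 : EuclideanSpace ℝ (Fin p)) 1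

/-- The uniform probability measure on `S^{p-1}`: the normalized surface measure. -/
def uniformMeasure (p : ℕ) : Measure (Sphere p) :=
  ((volume : Measure (EuclideanSpace ℝ (Fin p))).toSphere univ)⁻¹ •
    (volume : Measure (EuclideanSpace ℝ (Fin p))).toSphere

/-- The normalizing constant `c(κ)` of `exp (κ ⟨x, μ⟩)` with respect to the uniform measure. -/
def vmfConst {p : ℕ} (μ : Sphere p) (κ : ℝ) : ℝ :=
  (∫ x : Sphere p, Real.exp (κ * inner ℝ (x : EuclideanSpace ℝ (Fin p)) μ) ∂uniformMeasure p)⁻¹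

/-- The von Mises-Fisher density `x ↦ c(κ) exp (κ ⟨x, μ⟩)` on `S^{p-1}`. -/
def vmfDensity {p : ℕ} (μ : Sphere p) (κ : ℝ) (x : Sphere p) : ℝ≥0∞ :=
  ENNReal.ofReal (vmfConst μ κ * Real.exp (κ * inner ℝ (x : EuclideanSpace ℝ (Fin p)) μ))

/-- The modified Bessel function of the first kind, through Poisson's integral
(for order `ν > -1/2` and argument `κ > 0`). -/
def besselI (ν κ : ℝ) : ℝ :=
  (κ / 2) ^ ν / (Real.Gamma (ν + 1 / 2) * Real.Gamma (1 / 2)) *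
    ∫ t in (-1 : ℝ)..1, Real.exp (κ * t) * (1 - t ^ 2) ^ (ν - 1 / 2)

/-- The surface area `s_n = 2 π^{(n+1)/2} / Γ((n+1)/2)` of `S^n`. -/
def sphereArea (n : ℕ) : ℝ :=
  2 * Real.pi ^ (((n : ℝ) + 1) / 2) / Real.Gamma (((n : ℝ) + 1) / 2)

/-- `c(κ) (s_{p-2} / s_{p-1}) ∫_0^t e^{κ cos θ} sin^{p-2} θ dθ`. -/
def capMass {p : ℕ} (μ : Sphere p) (κ t : ℝ) : ℝ :=
  vmfConst μ κ * (sphereArea (p - 2) / sphereArea (p - 1)) *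
    ∫ θ in (0 : ℝ)..t, Real.exp (κ * Real.cos θ) * Real.sin θ ^ (p - 2)

/-- `g_κ` for the von Mises-Fisher density. -/
abbrev vmfG {p : ℕ} (μ : Sphere p) (κ : ℝ) : ℝ≥0∞ → ℝ≥0∞ :=
  excessMass (vmfDensity μ κ) (uniformMeasure p)

/-- The Betti-0 function of the von Mises-Fisher density. -/
abbrev vmfBettiZero {p : ℕ} (μ : Sphere p) (κ : ℝ) : ℝ≥0∞ → ℝ≥0∞ :=
  bettiZeroFunction (vmfDensity μ κ) (uniformMeasure p)

/-- The interval `[e^{-κ} / c(κ), e^κ / c(κ)]`. -/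
abbrev vmfRange {p : ℕ} (μ : Sphere p) (κ : ℝ) : Set ℝ≥0∞ :=
  Icc (ENNReal.ofReal (Real.exp (-κ) / vmfConst μ κ)) (ENNReal.ofReal (Real.exp κ / vmfConst μ κ))

end DensityPersistence

end

open DensityPersistence

noncomputable section

namespace DensityPersistence

/-! For `κ > 0` the density is an increasing function of the height ⟨x, μ⟩. Its sublevel sets are
therefore empty, then proper closed caps around −μ, then the whole sphere, and its superlevel sets
are likewise caps around μ; for `κ = 0` the intermediate range is absent. Proper caps are acyclic,
so in the degrees concerned the homology changes only at the extreme values of the density, and each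
barcode has at most one bar.

The homological input is built directly on singular chains. They are indexed by the number of
vertices, the empty simplex included, so that index j carries reduced homology of degree j − 1 and
the empty set plays the role of the sphere of dimension −1. Cones, subdivision and prisms are
defined on formal tuples of points, where the cone identity `tupleBoundary_cone_succ` yields all
homotopy formulas, and are carried to singular chains by naturality
(`naturalOp_augMap_affineChain`). Homotopy invariance (`augMap_sub_augMap_mem`) and small simplices
(`exists_subdiv_iterate_mem`) give Mayer-Vietoris for two acyclic open sets
(`AugAcyclic.union_succ`, `AugLine.union_succ`). With these `HasSphereHomology.prod_real` computes
the homology of punctured Euclidean spaces by induction on the dimension, and radial projection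
passes to spheres.

`bettiBarcodeEq_unit` turns one persistent class into a statement about all uncut barcodes. In the
Čech filtration constant simplices contribute nothing in positive degrees, because the differential
between them is alternately zero and bijective (`cech_exists_sub_mem_boundariesAt`).

The mass statements rest on `lintegral_uniformMeasure_inner`: the angle θ to μ has density
proportional to sin^{p−2} θ. The radius e^{−κ cos t}/c(κ) selects exactly the cap of angle t
(`vmfG_capRadius`), so on the relevant interval g_κ is `capMass` composed with the inverse of
`capRadius`, both strictly increasing on [0, π]. Monotonicity, continuity, the inverse and the curve
are all read off from this parametrization. -/

/-! ### Alternating sums of face maps -/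

section FaceBoundary

variable (F : Type*) [Field F]

/-- The alternating sum of a family of face maps, on free modules. -/
def faceBoundary {S T : Type*} {n : ℕ} (d : Fin n → S → T) : (S →₀ F) →ₗ[F] (T →₀ F) :=
  ∑ i : Fin n, ((-1 : F) ^ (i : ℕ)) • Finsupp.lmapDomain F F (d i)

variable {F}

theorem faceBoundary_apply {S T : Type*} {n : ℕ} (d : Fin n → S → T) (c : S →₀ F) :
    faceBoundary F d c = ∑ i : Fin n, ((-1 : F) ^ (i : ℕ)) • Finsupp.mapDomain (d i) c := by
  simp [faceBoundary, LinearMap.sum_apply]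

/-- Compatibility with each single face is enough for a chain map. The chain map property of induced
maps, affine chains and prism chains is an instance of this. -/
theorem mapDomain_faceBoundary {S T S' T' : Type*} {n : ℕ} {d : Fin n → S → T}
    {d' : Fin n → S' → T'} {f : S → S'} {g : T → T'} (h : ∀ i s, g (d i s) = d' i (f s))
    (c : S →₀ F) :
    Finsupp.mapDomain g (faceBoundary F d c) = faceBoundary F d' (Finsupp.mapDomain f c) := by
  rw [faceBoundary_apply, faceBoundary_apply, Finsupp.mapDomain_finsetSum]
  refine Finset.sum_congr rfl fun i _ => ?_
  rw [Finsupp.mapDomain_smul, ← Finsupp.mapDomain_comp, ← Finsupp.mapDomain_comp]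
  congr 2
  funext s
  exact h i s

theorem mapDomain_mem_supported {S T : Type*} {f : S → T} {s : Set S} {t : Set T}
    (h : ∀ x ∈ s, f x ∈ t) {c : S →₀ F} (hc : c ∈ Finsupp.supported F F s) :
    Finsupp.mapDomain f c ∈ Finsupp.supported F F t := by
  have h' := Submodule.mem_map_of_mem (f := Finsupp.lmapDomain F F f) hc
  rw [Finsupp.lmapDomain_supported] at h'
  exact Finsupp.supported_mono (by rintro _ ⟨x, hx, rfl⟩; exact h x hx) h'

theorem faceBoundary_mem_supported {S T : Type*} {n : ℕ} {d : Fin n → S → T} {s : Set S}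
    {t : Set T} (h : ∀ x ∈ s, ∀ i, d i x ∈ t) {c : S →₀ F} (hc : c ∈ Finsupp.supported F F s) :
    faceBoundary F d c ∈ Finsupp.supported F F t := by
  rw [faceBoundary_apply]
  exact Submodule.sum_mem _ fun i _ => Submodule.smul_mem _ _ <|
    mapDomain_mem_supported (fun x hx => h x hx i) hc

/-- A linear map out of a free module maps chains with support in `s` into `p` if it does so for
the elements of `s`. -/
theorem map_mem_of_mem_supported {S M : Type*} [AddCommGroup M] [Module F M]
    {L : (S →₀ F) →ₗ[F] M} {s : Set S} {p : Submodule F M}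
    (h : ∀ x ∈ s, L (Finsupp.single x 1) ∈ p) {c : S →₀ F} (hc : c ∈ Finsupp.supported F F s) :
    L c ∈ p := by
  rw [Finsupp.supported_eq_span_single] at hc
  have hle : Submodule.span F ((fun x => Finsupp.single x (1 : F)) '' s) ≤ p.comap L :=
    Submodule.span_le.2 ?_
  · exact hle hc
  rintro _ ⟨x, hx, rfl⟩
  exact h x hx

end FaceBoundary

/-! ### Complexes of tuples -/

section Tuples

variable {F : Type*} [Field F] {V W : Type*}

variable (F V) in
/-- The free module on the `j`-tuples of elements of `V`. -/
abbrev TupleChain (j : ℕ) : Type _ := (Fin j → V) →₀ F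

variable (F V) in
/-- The boundary of tuples, which omits one entry at a time; it is augmented in degree `0`. -/
def tupleBoundary (j : ℕ) : TupleChain F V (j + 1) →ₗ[F] TupleChain F V j :=
  faceBoundary F fun (i : Fin (j + 1)) (v : Fin (j + 1) → V) => v ∘ i.succAbove

/-- The map of tuples induced by a map. -/
def tupleMap (f : V → W) (j : ℕ) : TupleChain F V j →ₗ[F] TupleChain F W j :=
  Finsupp.lmapDomain F F (f ∘ ·)

@[simp]
theorem tupleMap_single (f : V → W) (j : ℕ) (v : Fin j → V) (a : F) :
    tupleMap f j (Finsupp.single v a) = Finsupp.single (f ∘ v) a := by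
  simp [tupleMap, Finsupp.mapDomain_single]

theorem tupleMap_comp {U : Type*} (g : W → U) (f : V → W) (j : ℕ) (c : TupleChain F V j) :
    tupleMap g j (tupleMap f j c) = tupleMap (g ∘ f) j c := by
  simp only [tupleMap, Finsupp.lmapDomain_apply, ← Finsupp.mapDomain_comp]
  rfl

/-- The cone with apex `b`. -/
def tupleCone (b : V) (j : ℕ) : TupleChain F V j →ₗ[F] TupleChain F V (j + 1) :=
  Finsupp.lmapDomain F F fun v => (Fin.cons b v : Fin (j + 1) → V)

@[simp]
theorem tupleCone_single (b : V) (j : ℕ) (v : Fin j → V) (a : F) :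
    tupleCone b j (Finsupp.single v a) = Finsupp.single (Fin.cons b v : Fin (j + 1) → V) a := by
  simp [tupleCone, Finsupp.mapDomain_single]

theorem tupleMap_boundary (f : V → W) (j : ℕ) (c : TupleChain F V (j + 1)) :
    tupleMap f j (tupleBoundary F V j c) = tupleBoundary F W j (tupleMap f (j + 1) c) :=
  mapDomain_faceBoundary (d := fun (i : Fin (j + 1)) (v : Fin (j + 1) → V) => v ∘ i.succAbove)
    (d' := fun (i : Fin (j + 1)) (v : Fin (j + 1) → W) => v ∘ i.succAbove) (fun _ _ => rfl) c

theorem tupleMap_cone (f : V → W) (b : V) (j : ℕ) (c : TupleChain F V j) :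
    tupleMap f (j + 1) (tupleCone b j c) = tupleCone (f b) j (tupleMap f j c) := by
  simp only [tupleMap, tupleCone, Finsupp.lmapDomain_apply, ← Finsupp.mapDomain_comp]
  congr 1
  funext v
  exact (Fin.comp_cons f b v)

theorem tupleBoundary_cone_zero (b : V) (c : TupleChain F V 0) :
    tupleBoundary F V 0 (tupleCone b 0 c) = c := by
  simp only [tupleBoundary, faceBoundary_apply, tupleCone, Finsupp.lmapDomain_apply,
    ← Finsupp.mapDomain_comp]
  rw [Fin.sum_univ_one]
  have : ((fun v : Fin 1 → V => v ∘ (0 : Fin 1).succAbove) ∘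
      fun v => (Fin.cons b v : Fin 1 → V)) = id := by
    funext v
    exact Subsingleton.elim _ _
  rw [this]
  simp

/-- Face 0 of a cone deletes the apex, and face i + 1 is the cone over face i with the opposite
sign. -/
theorem tupleBoundary_cone_succ (b : V) (j : ℕ) (c : TupleChain F V (j + 1)) :
    tupleBoundary F V (j + 1) (tupleCone b (j + 1) c) =
      c - tupleCone b j (tupleBoundary F V j c) := by
  rw [tupleBoundary, tupleBoundary, faceBoundary_apply, faceBoundary_apply, Fin.sum_univ_succ,
    map_sum, sub_eq_add_neg, ← Finset.sum_neg_distrib]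
  congr 1
  · simp only [tupleCone, Finsupp.lmapDomain_apply, ← Finsupp.mapDomain_comp]
    have : ((fun v : Fin (j + 2) → V => v ∘ (0 : Fin (j + 2)).succAbove) ∘
        fun v => (Fin.cons b v : Fin (j + 2) → V)) = id := by
      funext v i
      simp
    rw [this]
    simp
  · refine Finset.sum_congr rfl fun i _ => ?_
    simp only [tupleCone, Finsupp.lmapDomain_apply, ← Finsupp.mapDomain_comp,
      Finsupp.mapDomain_smul, Fin.val_succ, pow_succ, mul_neg, mul_one, neg_smul]
    congr 3
    funext v k
    refine Fin.cases ?_ (fun k => ?_) k <;> simp [Fin.succ_succAbove_succ]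

/-- Every nonempty tuple is the cone from its first entry over its tail, so the cone identity and
induction replace the usual cancellation in a double sum. -/
theorem tupleBoundary_boundary (j : ℕ) (c : TupleChain F V (j + 2)) :
    tupleBoundary F V j (tupleBoundary F V (j + 1) c) = 0 := by
  suffices h : (tupleBoundary F V j).comp (tupleBoundary F V (j + 1)) = 0 from
    LinearMap.congr_fun h c
  clear c
  induction j with
  | zero =>
    ext v : 2
    simp only [LinearMap.comp_apply, Finsupp.lsingle_apply, LinearMap.zero_apply]
    rw [← Fin.cons_self_tail v, ← tupleCone_single, tupleBoundary_cone_succ, map_sub,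
      tupleBoundary_cone_zero, sub_self]
  | succ j ih =>
    ext v : 2
    simp only [LinearMap.comp_apply, Finsupp.lsingle_apply, LinearMap.zero_apply]
    rw [← Fin.cons_self_tail v, ← tupleCone_single, tupleBoundary_cone_succ, map_sub,
      tupleBoundary_cone_succ, ← LinearMap.comp_apply (tupleBoundary F V j), ih]
    simp

/-- The homotopy obtained by coning off the failure of the homotopy identity. -/
def coneHomotopy (φ : ∀ j, TupleChain F V j →ₗ[F] TupleChain F W j)
    (b : ∀ j, (Fin (j + 1) → V) → W) : ∀ j, TupleChain F V j →ₗ[F] TupleChain F W (j + 1)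
  | 0 => 0
  | j + 1 => Finsupp.linearCombination F fun v => tupleCone (b j v) (j + 1)
      (φ (j + 1) (Finsupp.single v 1) -
        coneHomotopy φ b j (tupleBoundary F V j (Finsupp.single v 1)))

theorem coneHomotopy_single (φ : ∀ j, TupleChain F V j →ₗ[F] TupleChain F W j)
    (b : ∀ j, (Fin (j + 1) → V) → W) (j : ℕ) (v : Fin (j + 1) → V) :
    coneHomotopy φ b (j + 1) (Finsupp.single v 1) = tupleCone (b j v) (j + 1)
      (φ (j + 1) (Finsupp.single v 1) -
        coneHomotopy φ b j (tupleBoundary F V j (Finsupp.single v 1))) := by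
  rw [coneHomotopy, Finsupp.linearCombination_single, one_smul]

/-- The method of acyclic models: φ − h∂ takes cycles as values, by the identity one degree lower,
so coning it off produces the next h. The recursion can start with h = 0 because φ, a difference of
two chain maps in the applications, vanishes on the empty tuple. -/
theorem coneHomotopy_spec {φ : ∀ j, TupleChain F V j →ₗ[F] TupleChain F W j}
    (b : ∀ j, (Fin (j + 1) → V) → W) (h0 : φ 0 = 0)
    (hφ : ∀ j c, tupleBoundary F W j (φ (j + 1) c) = φ j (tupleBoundary F V j c)) (j : ℕ)
    (c : TupleChain F V (j + 1)) :
    tupleBoundary F W (j + 1) (coneHomotopy φ b (j + 1) c) =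
      φ (j + 1) c - coneHomotopy φ b j (tupleBoundary F V j c) := by
  suffices h : (tupleBoundary F W (j + 1)).comp (coneHomotopy φ b (j + 1)) =
      φ (j + 1) - (coneHomotopy φ b j).comp (tupleBoundary F V j) from LinearMap.congr_fun h c
  clear c
  induction j with
  | zero =>
    ext v : 2
    simp only [LinearMap.comp_apply, Finsupp.lsingle_apply, LinearMap.sub_apply]
    rw [coneHomotopy_single, tupleBoundary_cone_succ,
      map_sub, hφ, h0]
    simp [coneHomotopy]
  | succ j ih =>
    ext v : 2
    simp only [LinearMap.comp_apply, Finsupp.lsingle_apply, LinearMap.sub_apply]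
    rw [coneHomotopy_single, tupleBoundary_cone_succ,
      map_sub, hφ, ← LinearMap.comp_apply (tupleBoundary F W (j + 1)), ih]
    simp [tupleBoundary_boundary]

/-- The only choice made in the recursion is the apex, so the homotopy is natural as soon as φ and
the apices are. -/
theorem tupleMap_coneHomotopy {V' W' : Type*}
    {φ : ∀ j, TupleChain F V j →ₗ[F] TupleChain F W j} {b : ∀ j, (Fin (j + 1) → V) → W}
    {φ' : ∀ j, TupleChain F V' j →ₗ[F] TupleChain F W' j} {b' : ∀ j, (Fin (j + 1) → V') → W'}
    {f : V → V'} {g : W → W'}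
    (hφ : ∀ j c, tupleMap g j (φ j c) = φ' j (tupleMap f j c))
    (hb : ∀ j v, g (b j v) = b' j (f ∘ v)) (j : ℕ) (c : TupleChain F V j) :
    tupleMap g (j + 1) (coneHomotopy φ b j c) = coneHomotopy φ' b' j (tupleMap f j c) := by
  suffices h : (tupleMap g (j + 1)).comp (coneHomotopy φ b j) =
      (coneHomotopy φ' b' j).comp (tupleMap f j) from LinearMap.congr_fun h c
  clear c
  induction j with
  | zero => simp [coneHomotopy]
  | succ j ih =>
    ext v : 2
    simp only [LinearMap.comp_apply, Finsupp.lsingle_apply]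
    rw [tupleMap_single, coneHomotopy_single, coneHomotopy_single,
      tupleMap_cone, map_sub, hφ, hb, ← LinearMap.comp_apply (tupleMap g (j + 1)), ih,
      LinearMap.comp_apply, tupleMap_boundary]
    simp

/-- Iterated barycentric subdivision: the cone over the subdivided boundary, with the apex given
by `b`. -/
def tupleSubdiv (b : ∀ j, (Fin (j + 1) → V) → V) : ∀ j, TupleChain F V j →ₗ[F] TupleChain F V j
  | 0 => LinearMap.id
  | j + 1 => Finsupp.linearCombination F fun v => tupleCone (b j v) j
      (tupleSubdiv b j (tupleBoundary F V j (Finsupp.single v 1)))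

theorem tupleSubdiv_single (b : ∀ j, (Fin (j + 1) → V) → V) (j : ℕ) (v : Fin (j + 1) → V) :
    tupleSubdiv b (j + 1) (Finsupp.single v (1 : F)) = tupleCone (b j v) j
      (tupleSubdiv b j (tupleBoundary F V j (Finsupp.single v 1))) := by
  rw [tupleSubdiv, Finsupp.linearCombination_single, one_smul]

/-- The subdivided boundary is a cycle by the previous degree, hence it is the whole boundary of the
cone over it, whatever the apex. -/
theorem tupleBoundary_subdiv (b : ∀ j, (Fin (j + 1) → V) → V) (j : ℕ)
    (c : TupleChain F V (j + 1)) :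
    tupleBoundary F V j (tupleSubdiv b (j + 1) c) = tupleSubdiv b j (tupleBoundary F V j c) := by
  suffices h : (tupleBoundary F V j).comp (tupleSubdiv b (j + 1)) =
      (tupleSubdiv b j).comp (tupleBoundary F V j) from LinearMap.congr_fun h c
  clear c
  induction j with
  | zero =>
    ext v : 2
    simp only [LinearMap.comp_apply, Finsupp.lsingle_apply]
    rw [tupleSubdiv_single, tupleBoundary_cone_zero]
  | succ j ih =>
    ext v : 2
    simp only [LinearMap.comp_apply, Finsupp.lsingle_apply]
    rw [tupleSubdiv_single, tupleBoundary_cone_succ, ← LinearMap.comp_apply (tupleBoundary F V j),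
      ih, LinearMap.comp_apply, tupleBoundary_boundary]
    simp

theorem tupleMap_subdiv {b : ∀ j, (Fin (j + 1) → V) → V} {b' : ∀ j, (Fin (j + 1) → W) → W}
    {f : V → W} (hb : ∀ j v, f (b j v) = b' j (f ∘ v)) (j : ℕ) (c : TupleChain F V j) :
    tupleMap f j (tupleSubdiv b j c) = tupleSubdiv b' j (tupleMap f j c) := by
  suffices h : (tupleMap f j).comp (tupleSubdiv b j) =
      (tupleSubdiv b' j).comp (tupleMap (F := F) f j) from LinearMap.congr_fun h c
  clear c
  induction j with
  | zero => rfl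
  | succ j ih =>
    ext v : 2
    simp only [LinearMap.comp_apply, Finsupp.lsingle_apply]
    rw [tupleMap_single, tupleSubdiv_single,
      tupleSubdiv_single, tupleMap_cone, hb, ← LinearMap.comp_apply (tupleMap f j), ih,
      LinearMap.comp_apply, tupleMap_boundary]
    simp

/-- The homotopy from the identity to the subdivision. -/
def tupleSubdivHomotopy (b : ∀ j, (Fin (j + 1) → V) → V) (j : ℕ) :
    TupleChain F V j →ₗ[F] TupleChain F V (j + 1) :=
  coneHomotopy (fun j => LinearMap.id - tupleSubdiv b j) (fun _ v => v 0) j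

theorem tupleBoundary_subdivHomotopy (b : ∀ j, (Fin (j + 1) → V) → V) (j : ℕ)
    (c : TupleChain F V (j + 1)) :
    tupleBoundary F V (j + 1) (tupleSubdivHomotopy b (j + 1) c) =
      c - tupleSubdiv b (j + 1) c - tupleSubdivHomotopy b j (tupleBoundary F V j c) :=
  coneHomotopy_spec (φ := fun j => LinearMap.id - tupleSubdiv b j) _ (by ext; simp [tupleSubdiv])
    (fun j c => by simp [tupleBoundary_subdiv]) j c

theorem tupleMap_subdivHomotopy {b : ∀ j, (Fin (j + 1) → V) → V}
    {b' : ∀ j, (Fin (j + 1) → W) → W} {f : V → W} (hb : ∀ j v, f (b j v) = b' j (f ∘ v)) (j : ℕ)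
    (c : TupleChain F V j) :
    tupleMap f (j + 1) (tupleSubdivHomotopy b j c) = tupleSubdivHomotopy b' j (tupleMap f j c) :=
  tupleMap_coneHomotopy (fun j c => by
    have := tupleMap_subdiv hb j c
    simp only [LinearMap.sub_apply, LinearMap.id_apply, map_sub, this]) (fun _ _ => rfl) j c

variable (V) in
/-- The prism operator: the homotopy between the bottom and the top of `V × [0,1]`. -/
def tuplePrism (j : ℕ) : TupleChain F V j →ₗ[F] TupleChain F (V × unitInterval) (j + 1) :=
  coneHomotopy (fun j => tupleMap (fun v => (v, 1)) j - tupleMap (fun v => (v, 0)) j)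
    (fun _ v => (v 0, 0)) j

theorem tupleBoundary_prism (j : ℕ) (c : TupleChain F V (j + 1)) :
    tupleBoundary F (V × unitInterval) (j + 1) (tuplePrism V (j + 1) c) =
      tupleMap (fun v => (v, 1)) (j + 1) c - tupleMap (fun v => (v, 0)) (j + 1) c -
        tuplePrism V j (tupleBoundary F V j c) :=
  coneHomotopy_spec (φ := fun j => tupleMap (fun v => (v, 1)) j - tupleMap (fun v => (v, 0)) j) _
    (by
      ext v : 2
      simp only [LinearMap.comp_apply, Finsupp.lsingle_apply, LinearMap.sub_apply,
        tupleMap_single, LinearMap.zero_apply]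
      rw [sub_eq_zero]
      congr 1
      exact Subsingleton.elim _ _)
    (fun j c => by simp only [LinearMap.sub_apply, map_sub, tupleMap_boundary]) j c

theorem tupleMap_prism (f : V → W) (j : ℕ) (c : TupleChain F V j) :
    tupleMap (Prod.map f id) (j + 1) (tuplePrism V j c) = tuplePrism W j (tupleMap f j c) :=
  tupleMap_coneHomotopy (fun j c => by
    simp only [LinearMap.sub_apply, map_sub, tupleMap_comp]
    rfl) (fun _ _ => rfl) j c

end Tuples

/-! ### Augmented singular chains -/

section AugChains

variable (F : Type*) [Field F] {X Y Z : Type*} [TopologicalSpace X] [TopologicalSpace Y]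
  [TopologicalSpace Z]

variable (X) in
/-- Singular chains, indexed by the number of vertices of the simplices. In degree `0` there is
exactly one simplex, the empty one, so that this is the augmented chain complex. -/
abbrev AugChain (j : ℕ) : Type _ := C(stdSimplex ℝ (Fin j), X) →₀ F

/-- The face inclusions of standard simplices. -/
def augFace (j : ℕ) (i : Fin (j + 1)) :
    C(stdSimplex ℝ (Fin j), stdSimplex ℝ (Fin (j + 1))) :=
  ⟨stdSimplex.map i.succAbove, stdSimplex.continuous_map _⟩

variable (X) in
/-- The boundary of the augmented singular chain complex. -/
def augBoundary (j : ℕ) : AugChain F X (j + 1) →ₗ[F] AugChain F X j :=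
  faceBoundary F fun (i : Fin (j + 1)) (φ : C(stdSimplex ℝ (Fin (j + 1)), X)) =>
    φ.comp (augFace j i)

/-- The augmented singular chains of a subspace. -/
def augOn (A : Set X) (j : ℕ) : Submodule F (AugChain F X j) :=
  Finsupp.supported F F {φ : C(stdSimplex ℝ (Fin j), X) | ∀ t, φ t ∈ A}

/-- A k-simplex has k + 1 vertices, so degree k corresponds to index k + 1 throughout. -/
theorem boundary_eq_augBoundary (k : ℕ) : boundary F X k = augBoundary F X (k + 1) := rfl

theorem chainsOn_eq_augOn (A : Set X) (k : ℕ) : chainsOn F A k = augOn F A (k + 1) := rfl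

variable {F}

/-- The map of chains induced by a continuous map. -/
def augMap (f : C(X, Y)) (j : ℕ) : AugChain F X j →ₗ[F] AugChain F Y j :=
  Finsupp.lmapDomain F F (f.comp ·)

@[simp]
theorem augMap_single (f : C(X, Y)) (j : ℕ) (φ : C(stdSimplex ℝ (Fin j), X)) (a : F) :
    augMap f j (Finsupp.single φ a) = Finsupp.single (f.comp φ) a := by
  simp [augMap, Finsupp.mapDomain_single]

theorem augMap_comp (g : C(Y, Z)) (f : C(X, Y)) (j : ℕ) (c : AugChain F X j) :
    augMap g j (augMap f j c) = augMap (g.comp f) j c := by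
  simp only [augMap, Finsupp.lmapDomain_apply, ← Finsupp.mapDomain_comp]
  rfl

@[simp]
theorem augMap_id (j : ℕ) (c : AugChain F X j) : augMap (ContinuousMap.id X) j c = c := by
  simp only [augMap, Finsupp.lmapDomain_apply, ContinuousMap.id_comp]
  exact Finsupp.mapDomain_id

theorem augMap_boundary (f : C(X, Y)) (j : ℕ) (c : AugChain F X (j + 1)) :
    augMap f j (augBoundary F X j c) = augBoundary F Y j (augMap f (j + 1) c) :=
  mapDomain_faceBoundary
    (d := fun (i : Fin (j + 1)) (φ : C(stdSimplex ℝ (Fin (j + 1)), X)) => φ.comp (augFace j i))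
    (d' := fun (i : Fin (j + 1)) (φ : C(stdSimplex ℝ (Fin (j + 1)), Y)) => φ.comp (augFace j i))
    (fun _ _ => rfl) c

theorem augMap_mem_augOn {f : C(X, Y)} {A : Set X} {B : Set Y} (h : ∀ x ∈ A, f x ∈ B) {j : ℕ}
    {c : AugChain F X j} (hc : c ∈ augOn F A j) : augMap f j c ∈ augOn F B j :=
  mapDomain_mem_supported (s := {φ : C(stdSimplex ℝ (Fin j), X) | ∀ t, φ t ∈ A})
    (t := {φ : C(stdSimplex ℝ (Fin j), Y) | ∀ t, φ t ∈ B}) (fun _ hφ t => h _ (hφ t)) hc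

theorem augBoundary_mem_augOn {A : Set X} {j : ℕ} {c : AugChain F X (j + 1)}
    (hc : c ∈ augOn F A (j + 1)) : augBoundary F X j c ∈ augOn F A j :=
  faceBoundary_mem_supported (s := {φ : C(stdSimplex ℝ (Fin (j + 1)), X) | ∀ t, φ t ∈ A})
    (t := {φ : C(stdSimplex ℝ (Fin j), X) | ∀ t, φ t ∈ A}) (fun _ hφ _ _ => hφ _) hc

theorem augOn_mono {A B : Set X} (h : A ⊆ B) (j : ℕ) : augOn F A j ≤ augOn F B j :=
  Finsupp.supported_mono fun _ hφ t => h (hφ t)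

theorem mem_augOn_inter {A B : Set X} {j : ℕ} {c : AugChain F X j} (hA : c ∈ augOn F A j)
    (hB : c ∈ augOn F B j) : c ∈ augOn F (A ∩ B) j :=
  fun _ hφ t => ⟨hA hφ t, hB hφ t⟩

/-! ### Affine simplices -/

section Affine

variable {E : Type*} [NormedAddCommGroup E] [NormedSpace ℝ E] {K : Set E}

/-- The affine simplex with the given vertices. -/
def affineSimplex (hK : Convex ℝ K) {j : ℕ} (w : Fin j → K) : C(stdSimplex ℝ (Fin j), K) where
  toFun t := ⟨∑ i, t i • (w i : E),
    hK.sum_mem (fun i _ => t.2.1 i) t.2.2 fun i _ => (w i).2⟩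
  continuous_toFun := by
    refine Continuous.subtype_mk (continuous_finsetSum _ fun i _ => ?_) _
    exact ((continuous_apply i).comp continuous_subtype_val).smul continuous_const

theorem affineSimplex_coe (hK : Convex ℝ K) {j : ℕ} (w : Fin j → K)
    (t : stdSimplex ℝ (Fin j)) : (affineSimplex hK w t : E) = ∑ i, t i • (w i : E) := rfl

theorem affineSimplex_face (hK : Convex ℝ K) {j : ℕ} (w : Fin (j + 1) → K) (i : Fin (j + 1)) :
    (affineSimplex hK w).comp (augFace j i) = affineSimplex hK (w ∘ i.succAbove) := by
  ext1 t
  refine Subtype.ext ?_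
  rw [ContinuousMap.comp_apply, affineSimplex_coe, affineSimplex_coe, Fin.sum_univ_succAbove _ i]
  have h (l : Fin (j + 1)) : (augFace j i t) l =
      ∑ m with i.succAbove m = l, t m := by
    change stdSimplex.map i.succAbove t l = _
    rw [stdSimplex.map_coe, FunOnFinite.linearMap_apply_apply]
  have h1 : (augFace j i t) i = 0 := by
    rw [h, Finset.sum_eq_zero]
    intro m hm
    simp at hm
  have h2 (m : Fin j) : (augFace j i t) (i.succAbove m) = t m := by
    rw [h, Finset.sum_eq_single m] <;> simp
  simp [h1, h2]

/-- The barycenter of a tuple of points in a convex set. -/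
def tupleBarycenter (hK : Convex ℝ K) (j : ℕ) (w : Fin (j + 1) → K) : K :=
  affineSimplex hK w stdSimplex.barycenter

/-- The vertices of the standard simplex. -/
def simplexVertices (j : ℕ) : Fin j → stdSimplex ℝ (Fin j) := fun i => stdSimplex.vertex i

theorem affineSimplex_vertices (hK : Convex ℝ K) {j : ℕ} (w : Fin j → K) :
    affineSimplex hK w ∘ simplexVertices j = w := by
  funext i
  refine Subtype.ext ?_
  simp [affineSimplex_coe, simplexVertices, Pi.single_apply]

theorem affineSimplex_simplexVertices (j : ℕ) :
    affineSimplex (convex_stdSimplex ℝ (Fin j)) (simplexVertices j) = ContinuousMap.id _ := by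
  ext1 t
  refine Subtype.ext ?_
  funext i
  simp [affineSimplex_coe, simplexVertices, Pi.single_apply]
  rfl

theorem affineSimplex_comp (hK : Convex ℝ K) {j n : ℕ} (w : Fin n → K)
    (v : Fin j → stdSimplex ℝ (Fin n)) :
    (affineSimplex hK w).comp (affineSimplex (convex_stdSimplex ℝ (Fin n)) v) =
      affineSimplex hK (affineSimplex hK w ∘ v) := by
  ext1 t
  refine Subtype.ext ?_
  have h (l : Fin n) : (affineSimplex (convex_stdSimplex ℝ (Fin n)) v t) l =
      ∑ i, t i * v i l := by
    change (∑ i, t i • (v i : Fin n → ℝ)) l = _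
    rw [Finset.sum_apply]
    rfl
  simp only [ContinuousMap.comp_apply, affineSimplex_coe, Function.comp_apply, h, Finset.sum_smul,
    Finset.smul_sum, smul_smul]
  exact Finset.sum_comm

end Affine

variable (F) in
/-- The chain of affine simplices given by a chain of tuples. -/
def affineChain (n j : ℕ) :
    TupleChain F (stdSimplex ℝ (Fin n)) j →ₗ[F] AugChain F (stdSimplex ℝ (Fin n)) j :=
  Finsupp.lmapDomain F F (affineSimplex (convex_stdSimplex ℝ (Fin n)))

theorem affineChain_boundary (n j : ℕ) (c : TupleChain F (stdSimplex ℝ (Fin n)) (j + 1)) :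
    affineChain F n j (tupleBoundary F _ j c) = augBoundary F _ j (affineChain F n (j + 1) c) :=
  mapDomain_faceBoundary
    (d := fun (i : Fin (j + 1)) (v : Fin (j + 1) → stdSimplex ℝ (Fin n)) => v ∘ i.succAbove)
    (d' := fun (i : Fin (j + 1)) (φ : C(stdSimplex ℝ (Fin (j + 1)), stdSimplex ℝ (Fin n))) =>
      φ.comp (augFace j i)) (fun i w => (affineSimplex_face _ w i).symm) c

theorem affineChain_map {m n : ℕ} (w : Fin m → stdSimplex ℝ (Fin n)) (j : ℕ)
    (c : TupleChain F (stdSimplex ℝ (Fin m)) j) :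
    affineChain F n j (tupleMap (affineSimplex (convex_stdSimplex ℝ (Fin n)) w) j c) =
      augMap (affineSimplex (convex_stdSimplex ℝ (Fin n)) w) j (affineChain F m j c) := by
  simp only [affineChain, tupleMap, augMap, Finsupp.lmapDomain_apply, ← Finsupp.mapDomain_comp]
  congr 1
  funext v
  exact (affineSimplex_comp _ w v).symm

/-- A singular simplex is the image of the identity of its model simplex. This lets operator
identities be checked on tuples of vertices and then pushed forward. -/
theorem augMap_affineChain_vertices (j : ℕ) (φ : C(stdSimplex ℝ (Fin j), X)) (a : F) :
    augMap φ j (affineChain F j j (Finsupp.single (simplexVertices j) a)) =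
      Finsupp.single φ a := by
  simp [affineChain, Finsupp.mapDomain_single, affineSimplex_simplexVertices]

theorem augBoundary_single (j : ℕ) (φ : C(stdSimplex ℝ (Fin (j + 1)), X)) (a : F) :
    augBoundary F X j (Finsupp.single φ a) = augMap φ j (affineChain F (j + 1) j
      (tupleBoundary F _ j (Finsupp.single (simplexVertices (j + 1)) a))) := by
  rw [affineChain_boundary, augMap_boundary, augMap_affineChain_vertices]

theorem augBoundary_boundary (j : ℕ) (c : AugChain F X (j + 2)) :
    augBoundary F X j (augBoundary F X (j + 1) c) = 0 := by
  suffices h : (augBoundary F X j).comp (augBoundary F X (j + 1)) = 0 from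
    LinearMap.congr_fun h c
  ext φ : 2
  simp only [LinearMap.comp_apply, Finsupp.lsingle_apply, LinearMap.zero_apply]
  rw [augBoundary_single, ← augMap_boundary, ← affineChain_boundary, tupleBoundary_boundary,
    map_zero, map_zero]

/-! ### Natural operators -/

/-- The operator on singular chains given by an operator on tuples. -/
def naturalOp {j m : ℕ} (Θ : TupleChain F (stdSimplex ℝ (Fin j)) j →ₗ[F]
    TupleChain F (stdSimplex ℝ (Fin j)) m) (X : Type*) [TopologicalSpace X] :
    AugChain F X j →ₗ[F] AugChain F X m :=
  Finsupp.linearCombination F fun φ =>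
    augMap φ m (affineChain F j m (Θ (Finsupp.single (simplexVertices j) 1)))

theorem naturalOp_single {j m : ℕ} (Θ : TupleChain F (stdSimplex ℝ (Fin j)) j →ₗ[F]
    TupleChain F (stdSimplex ℝ (Fin j)) m) (φ : C(stdSimplex ℝ (Fin j), X)) :
    naturalOp Θ X (Finsupp.single φ 1) =
      augMap φ m (affineChain F j m (Θ (Finsupp.single (simplexVertices j) 1))) := by
  rw [naturalOp, Finsupp.linearCombination_single, one_smul]

/-- Needed to apply an operator to a boundary: the faces of φ are φ composed with affine simplices
of a model of larger dimension. Naturality of the tuple operator under affine maps allows the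
computation to take place in that larger model. -/
theorem naturalOp_augMap_affineChain {j m n : ℕ}
    {Θ : TupleChain F (stdSimplex ℝ (Fin j)) j →ₗ[F] TupleChain F (stdSimplex ℝ (Fin j)) m}
    {Θ' : TupleChain F (stdSimplex ℝ (Fin n)) j →ₗ[F] TupleChain F (stdSimplex ℝ (Fin n)) m}
    (h : ∀ (w : Fin j → stdSimplex ℝ (Fin n)) c,
      tupleMap (affineSimplex (convex_stdSimplex ℝ (Fin n)) w) m (Θ c) =
        Θ' (tupleMap (affineSimplex (convex_stdSimplex ℝ (Fin n)) w) j c))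
    (φ : C(stdSimplex ℝ (Fin n), X)) (c : TupleChain F (stdSimplex ℝ (Fin n)) j) :
    naturalOp Θ X (augMap φ j (affineChain F n j c)) = augMap φ m (affineChain F n m (Θ' c)) := by
  suffices H : (naturalOp Θ X).comp ((augMap φ j).comp (affineChain F n j)) =
      (augMap φ m).comp ((affineChain F n m).comp Θ') from LinearMap.congr_fun H c
  ext w : 2
  simp only [LinearMap.comp_apply, Finsupp.lsingle_apply]
  have : affineChain F n j (Finsupp.single w 1) =
      Finsupp.single (affineSimplex (convex_stdSimplex ℝ (Fin n)) w) 1 := by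
    simp [affineChain, Finsupp.mapDomain_single]
  rw [this, augMap_single, naturalOp_single, ← augMap_comp, ← affineChain_map, h,
    tupleMap_single, affineSimplex_vertices]

theorem naturalOp_mem_augOn {j m : ℕ} (Θ : TupleChain F (stdSimplex ℝ (Fin j)) j →ₗ[F]
    TupleChain F (stdSimplex ℝ (Fin j)) m) {A : Set X} {c : AugChain F X j}
    (hc : c ∈ augOn F A j) : naturalOp Θ X c ∈ augOn F A m := by
  refine map_mem_of_mem_supported (fun φ hφ => ?_) hc
  rw [naturalOp_single]
  refine augMap_mem_augOn (A := univ) (fun x _ => hφ x) ?_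
  simp [augOn, Finsupp.supported_univ]

theorem affineSimplex_tupleBarycenter {n j k : ℕ} (w : Fin j → stdSimplex ℝ (Fin n))
    (v : Fin (k + 1) → stdSimplex ℝ (Fin j)) :
    affineSimplex (convex_stdSimplex ℝ (Fin n)) w
      (tupleBarycenter (convex_stdSimplex ℝ (Fin j)) k v) =
    tupleBarycenter (convex_stdSimplex ℝ (Fin n)) k
      (affineSimplex (convex_stdSimplex ℝ (Fin n)) w ∘ v) := by
  rw [tupleBarycenter, tupleBarycenter, ← affineSimplex_comp]
  rfl

variable (F) in
/-- Barycentric subdivision of tuples of points of the standard simplex. -/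
abbrev simplexSubdiv (n j : ℕ) :
    TupleChain F (stdSimplex ℝ (Fin n)) j →ₗ[F] TupleChain F (stdSimplex ℝ (Fin n)) j :=
  tupleSubdiv (tupleBarycenter (convex_stdSimplex ℝ (Fin n))) j

variable (F) in
/-- The homotopy from the identity to the barycentric subdivision. -/
abbrev simplexSubdivHomotopy (n j : ℕ) :
    TupleChain F (stdSimplex ℝ (Fin n)) j →ₗ[F] TupleChain F (stdSimplex ℝ (Fin n)) (j + 1) :=
  tupleSubdivHomotopy (tupleBarycenter (convex_stdSimplex ℝ (Fin n))) j

variable (F X) in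
/-- Barycentric subdivision of singular chains. -/
def augSubdiv (j : ℕ) : AugChain F X j →ₗ[F] AugChain F X j := naturalOp (simplexSubdiv F j j) X

variable (F X) in
/-- The homotopy from the identity to the barycentric subdivision. -/
def augSubdivHomotopy (j : ℕ) : AugChain F X j →ₗ[F] AugChain F X (j + 1) :=
  naturalOp (simplexSubdivHomotopy F j j) X

theorem augSubdiv_augMap_affineChain {j n : ℕ} (φ : C(stdSimplex ℝ (Fin n), X))
    (c : TupleChain F (stdSimplex ℝ (Fin n)) j) :
    augSubdiv F X j (augMap φ j (affineChain F n j c)) =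
      augMap φ j (affineChain F n j (simplexSubdiv F n j c)) :=
  naturalOp_augMap_affineChain
    (fun w c => tupleMap_subdiv (fun _ v => affineSimplex_tupleBarycenter w v) j c) φ c

theorem augSubdivHomotopy_augMap_affineChain {j n : ℕ} (φ : C(stdSimplex ℝ (Fin n), X))
    (c : TupleChain F (stdSimplex ℝ (Fin n)) j) :
    augSubdivHomotopy F X j (augMap φ j (affineChain F n j c)) =
      augMap φ (j + 1) (affineChain F n (j + 1) (simplexSubdivHomotopy F n j c)) :=
  naturalOp_augMap_affineChain
    (fun w c => tupleMap_subdivHomotopy (fun _ v => affineSimplex_tupleBarycenter w v) j c) φ c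

theorem augBoundary_subdiv (j : ℕ) (c : AugChain F X (j + 1)) :
    augBoundary F X j (augSubdiv F X (j + 1) c) = augSubdiv F X j (augBoundary F X j c) := by
  suffices h : (augBoundary F X j).comp (augSubdiv F X (j + 1)) =
      (augSubdiv F X j).comp (augBoundary F X j) from LinearMap.congr_fun h c
  ext φ : 2
  simp only [LinearMap.comp_apply, Finsupp.lsingle_apply]
  rw [augBoundary_single, augSubdiv_augMap_affineChain, augSubdiv, naturalOp_single,
    ← augMap_boundary, ← affineChain_boundary, tupleBoundary_subdiv]

theorem augBoundary_subdivHomotopy (j : ℕ) (c : AugChain F X (j + 1)) :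
    augBoundary F X (j + 1) (augSubdivHomotopy F X (j + 1) c) =
      c - augSubdiv F X (j + 1) c - augSubdivHomotopy F X j (augBoundary F X j c) := by
  suffices h : (augBoundary F X (j + 1)).comp (augSubdivHomotopy F X (j + 1)) =
      LinearMap.id - augSubdiv F X (j + 1) - (augSubdivHomotopy F X j).comp (augBoundary F X j)
    from LinearMap.congr_fun h c
  ext φ : 2
  simp only [LinearMap.comp_apply, Finsupp.lsingle_apply, LinearMap.sub_apply, LinearMap.id_apply]
  rw [augBoundary_single, augSubdivHomotopy_augMap_affineChain, augSubdivHomotopy, augSubdiv,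
    naturalOp_single, naturalOp_single, ← augMap_boundary, ← affineChain_boundary,
    tupleBoundary_subdivHomotopy, map_sub, map_sub, map_sub, map_sub, augMap_affineChain_vertices]

theorem augSubdiv_mem_augOn {A : Set X} {j : ℕ} {c : AugChain F X j} (hc : c ∈ augOn F A j) :
    augSubdiv F X j c ∈ augOn F A j := naturalOp_mem_augOn _ hc

theorem augSubdivHomotopy_mem_augOn {A : Set X} {j : ℕ} {c : AugChain F X j}
    (hc : c ∈ augOn F A j) : augSubdivHomotopy F X j c ∈ augOn F A (j + 1) :=
  naturalOp_mem_augOn _ hc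

/-! ### Homotopy invariance -/

variable (F) in
/-- The chain of affine simplices in a prism given by a chain of tuples. -/
def prismChain (n j : ℕ) : TupleChain F (stdSimplex ℝ (Fin n) × unitInterval) j →ₗ[F]
    AugChain F (stdSimplex ℝ (Fin n) × unitInterval) j :=
  Finsupp.lmapDomain F F fun w =>
    (affineSimplex (convex_stdSimplex ℝ (Fin n)) (Prod.fst ∘ w)).prodMk
      (affineSimplex (convex_Icc (0 : ℝ) 1) (Prod.snd ∘ w))

theorem prismChain_boundary (n j : ℕ)
    (c : TupleChain F (stdSimplex ℝ (Fin n) × unitInterval) (j + 1)) :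
    prismChain F n j (tupleBoundary F _ j c) = augBoundary F _ j (prismChain F n (j + 1) c) :=
  mapDomain_faceBoundary
    (d := fun (i : Fin (j + 1)) (v : Fin (j + 1) → stdSimplex ℝ (Fin n) × unitInterval) =>
      v ∘ i.succAbove)
    (d' := fun (i : Fin (j + 1))
      (φ : C(stdSimplex ℝ (Fin (j + 1)), stdSimplex ℝ (Fin n) × unitInterval)) =>
      φ.comp (augFace j i))
    (fun i w => by
      have h1 := affineSimplex_face (convex_stdSimplex ℝ (Fin n)) (Prod.fst ∘ w) i
      have h2 := affineSimplex_face (convex_Icc (0 : ℝ) 1) (Prod.snd ∘ w) i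
      refine (congrArg₂ ContinuousMap.prodMk h1 h2).symm) c

theorem prismChain_map {m n : ℕ} (w : Fin m → stdSimplex ℝ (Fin n)) (j : ℕ)
    (c : TupleChain F (stdSimplex ℝ (Fin m) × unitInterval) j) :
    prismChain F n j
      (tupleMap (Prod.map (affineSimplex (convex_stdSimplex ℝ (Fin n)) w) id) j c) =
      augMap ((affineSimplex (convex_stdSimplex ℝ (Fin n)) w).prodMap (ContinuousMap.id _)) j
        (prismChain F m j c) := by
  simp only [prismChain, tupleMap, augMap, Finsupp.lmapDomain_apply, ← Finsupp.mapDomain_comp]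
  congr 1
  funext v
  exact (congrArg₂ ContinuousMap.prodMk
    (affineSimplex_comp (convex_stdSimplex ℝ (Fin n)) w (Prod.fst ∘ v)) rfl).symm

/-- The inclusion of `X` into `X × [0,1]` at height `s`. -/
def prismIncl (X : Type*) [TopologicalSpace X] (s : unitInterval) : C(X, X × unitInterval) :=
  (ContinuousMap.id X).prodMk (ContinuousMap.const X s)

theorem prismChain_incl (n j : ℕ) (s : unitInterval)
    (c : TupleChain F (stdSimplex ℝ (Fin n)) j) :
    prismChain F n j (tupleMap (fun v => (v, s)) j c) =
      augMap (prismIncl (stdSimplex ℝ (Fin n)) s) j (affineChain F n j c) := by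
  simp only [prismChain, affineChain, tupleMap, augMap, Finsupp.lmapDomain_apply,
    ← Finsupp.mapDomain_comp]
  congr 1
  funext v
  have h : affineSimplex (convex_Icc (0 : ℝ) 1) (fun _ : Fin j => s) =
      ContinuousMap.const _ s := by
    ext1 t
    refine Subtype.ext ?_
    have : ∑ i, t i = 1 := t.2.2
    simp [affineSimplex_coe, ← Finset.sum_mul, this]
  exact congrArg (ContinuousMap.prodMk (affineSimplex (convex_stdSimplex ℝ (Fin n)) v)) h

variable (F X) in
/-- The prism operator on singular chains. -/
def augPrism (j : ℕ) : AugChain F X j →ₗ[F] AugChain F (X × unitInterval) (j + 1) :=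
  Finsupp.linearCombination F fun φ => augMap (φ.prodMap (ContinuousMap.id _)) (j + 1)
    (prismChain F j (j + 1) (tuplePrism _ j (Finsupp.single (simplexVertices j) 1)))

theorem augPrism_single (j : ℕ) (φ : C(stdSimplex ℝ (Fin j), X)) :
    augPrism F X j (Finsupp.single φ 1) = augMap (φ.prodMap (ContinuousMap.id _)) (j + 1)
      (prismChain F j (j + 1) (tuplePrism _ j (Finsupp.single (simplexVertices j) 1))) := by
  rw [augPrism, Finsupp.linearCombination_single, one_smul]

theorem augPrism_augMap_affineChain {j n : ℕ} (φ : C(stdSimplex ℝ (Fin n), X))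
    (c : TupleChain F (stdSimplex ℝ (Fin n)) j) :
    augPrism F X j (augMap φ j (affineChain F n j c)) =
      augMap (φ.prodMap (ContinuousMap.id _)) (j + 1)
        (prismChain F n (j + 1) (tuplePrism _ j c)) := by
  suffices H : (augPrism F X j).comp ((augMap φ j).comp (affineChain F n j)) =
      (augMap (φ.prodMap (ContinuousMap.id _)) (j + 1)).comp
        ((prismChain F n (j + 1)).comp (tuplePrism _ j)) from LinearMap.congr_fun H c
  ext w : 2
  simp only [LinearMap.comp_apply, Finsupp.lsingle_apply]
  have : affineChain F n j (Finsupp.single w 1) =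
      Finsupp.single (affineSimplex (convex_stdSimplex ℝ (Fin n)) w) 1 := by
    simp [affineChain, Finsupp.mapDomain_single]
  have h2 : (φ.comp (affineSimplex (convex_stdSimplex ℝ (Fin n)) w)).prodMap
      (ContinuousMap.id unitInterval) = (φ.prodMap (ContinuousMap.id unitInterval)).comp
        ((affineSimplex (convex_stdSimplex ℝ (Fin n)) w).prodMap (ContinuousMap.id _)) := rfl
  rw [this, augMap_single, augPrism_single, h2, ← augMap_comp, ← prismChain_map,
    tupleMap_prism, tupleMap_single, affineSimplex_vertices]

theorem augBoundary_prism (j : ℕ) (c : AugChain F X (j + 1)) :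
    augBoundary F _ (j + 1) (augPrism F X (j + 1) c) =
      augMap (prismIncl X 1) (j + 1) c - augMap (prismIncl X 0) (j + 1) c -
        augPrism F X j (augBoundary F X j c) := by
  suffices h : (augBoundary F _ (j + 1)).comp (augPrism F X (j + 1)) =
      augMap (prismIncl X 1) (j + 1) - augMap (prismIncl X 0) (j + 1) -
        (augPrism F X j).comp (augBoundary F X j) from LinearMap.congr_fun h c
  ext φ : 2
  simp only [LinearMap.comp_apply, Finsupp.lsingle_apply, LinearMap.sub_apply]
  have h2 (s : unitInterval) : (prismIncl X s).comp φ =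
      (φ.prodMap (ContinuousMap.id unitInterval)).comp (prismIncl _ s) := rfl
  rw [augBoundary_single, augPrism_augMap_affineChain, augPrism_single, ← augMap_boundary,
    ← prismChain_boundary, tupleBoundary_prism, map_sub, map_sub, map_sub, map_sub,
    prismChain_incl, prismChain_incl, augMap_comp, augMap_comp, ← h2, ← h2, ← augMap_comp,
    ← augMap_comp, augMap_affineChain_vertices]

end AugChains

/-! ### Reduced cycles and boundaries -/

section Reduced

variable (F : Type*) [Field F] {X Y : Type*} [TopologicalSpace X] [TopologicalSpace Y]

/-- The augmented cycles of a subspace. -/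
def augCycles (A : Set X) : (j : ℕ) → Submodule F (AugChain F X j)
  | 0 => augOn F A 0
  | j + 1 => augOn F A (j + 1) ⊓ LinearMap.ker (augBoundary F X j)

/-- The augmented boundaries of a subspace. -/
def augBoundaries (A : Set X) (j : ℕ) : Submodule F (AugChain F X j) :=
  (augOn F A (j + 1)).map (augBoundary F X j)

/-- The reduced homology of `A` vanishes in degree `j - 1`. -/
def AugAcyclic (A : Set X) (j : ℕ) : Prop := augCycles F A j ≤ augBoundaries F A j

/-- The reduced homology of `A` is one-dimensional in degree `j - 1`. -/
def AugLine (A : Set X) (j : ℕ) : Prop :=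
  ∃ g ∈ augCycles F A j, g ∉ augBoundaries F A j ∧
    ∀ z ∈ augCycles F A j, ∃ a : F, z - a • g ∈ augBoundaries F A j

variable {F}

theorem augCycles_le_augOn (A : Set X) : ∀ j, augCycles F A j ≤ augOn F A j
  | 0 => le_rfl
  | _ + 1 => inf_le_left

theorem augBoundary_mem_augBoundaries {A : Set X} {j : ℕ} {b : AugChain F X (j + 1)}
    (hb : b ∈ augOn F A (j + 1)) : augBoundary F X j b ∈ augBoundaries F A j := ⟨b, hb, rfl⟩

theorem augBoundary_mem_augCycles {A : Set X} {j : ℕ} {b : AugChain F X (j + 1)}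
    (hb : augBoundary F X j b ∈ augOn F A j) : augBoundary F X j b ∈ augCycles F A j := by
  cases j with
  | zero => exact hb
  | succ j => exact ⟨hb, augBoundary_boundary j b⟩

theorem augBoundaries_le_augCycles (A : Set X) (j : ℕ) :
    augBoundaries F A j ≤ augCycles F A j := by
  rintro _ ⟨b, hb, rfl⟩
  exact augBoundary_mem_augCycles (augBoundary_mem_augOn hb)

theorem mem_augCycles_of_mem_augOn {A B : Set X} {j : ℕ} {c : AugChain F X j}
    (hc : c ∈ augCycles F A j) (h : c ∈ augOn F B j) : c ∈ augCycles F B j := by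
  cases j with
  | zero => exact h
  | succ j => exact ⟨h, hc.2⟩

theorem augBoundaries_mono {A B : Set X} (h : A ⊆ B) (j : ℕ) :
    augBoundaries F A j ≤ augBoundaries F B j := Submodule.map_mono (augOn_mono h _)

theorem augCycles_mono {A B : Set X} (h : A ⊆ B) (j : ℕ) :
    augCycles F A j ≤ augCycles F B j := fun _ hc =>
  mem_augCycles_of_mem_augOn hc (augOn_mono h _ (augCycles_le_augOn _ _ hc))

theorem augMap_mem_augCycles {f : C(X, Y)} {A : Set X} {B : Set Y} (h : ∀ x ∈ A, f x ∈ B) {j : ℕ}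
    {c : AugChain F X j} (hc : c ∈ augCycles F A j) : augMap f j c ∈ augCycles F B j := by
  cases j with
  | zero => exact augMap_mem_augOn h hc
  | succ j =>
    refine ⟨augMap_mem_augOn h hc.1, ?_⟩
    rw [SetLike.mem_coe, LinearMap.mem_ker, ← augMap_boundary, hc.2, map_zero]

theorem augMap_mem_augBoundaries {f : C(X, Y)} {A : Set X} {B : Set Y} (h : ∀ x ∈ A, f x ∈ B)
    {j : ℕ} {c : AugChain F X j} (hc : c ∈ augBoundaries F A j) :
    augMap f j c ∈ augBoundaries F B j := by
  obtain ⟨b, hb, rfl⟩ := hc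
  rw [augMap_boundary]
  exact augBoundary_mem_augBoundaries (augMap_mem_augOn h hb)

theorem augOn_univ (j : ℕ) : augOn F (univ : Set X) j = ⊤ := by
  simp [augOn, Finsupp.supported_univ]

/-- The standard simplex without vertices is empty, since an empty sum is not 1; the empty simplex
thus lies in every subspace. -/
theorem augOn_zero (A : Set X) : augOn F A 0 = ⊤ := by
  have : {φ : C(stdSimplex ℝ (Fin 0), X) | ∀ t, φ t ∈ A} = univ :=
    eq_univ_of_forall fun φ t => absurd t.2.2 (by simp)
  rw [augOn, this, Finsupp.supported_univ]

/-! ### Subspaces and homotopy equivalences -/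

/-- The inclusion of a subspace. -/
def subspaceIncl (A : Set X) : C(A, X) := ⟨Subtype.val, continuous_subtype_val⟩

theorem augMap_subspaceIncl_injective (A : Set X) (j : ℕ) :
    Function.Injective (augMap (F := F) (subspaceIncl A) j) := by
  refine Finsupp.mapDomain_injective fun φ ψ h => ?_
  ext1 t
  exact Subtype.ext (DFunLike.congr_fun h t)

theorem exists_augMap_subspaceIncl {A : Set X} {j : ℕ} {c : AugChain F X j}
    (hc : c ∈ augOn F A j) : ∃ c', augMap (subspaceIncl A) j c' = c := by
  have h : c ∈ LinearMap.range (augMap (F := F) (subspaceIncl A) j) := by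
    refine map_mem_of_mem_supported (L := LinearMap.id) (fun φ hφ => ?_) hc
    refine ⟨Finsupp.single ⟨fun t => ⟨φ t, hφ t⟩, by fun_prop⟩ 1, ?_⟩
    rw [augMap_single]
    rfl
  exact h

theorem augMap_subspaceIncl_mem_augBoundaries {A : Set X} {j : ℕ} {c : AugChain F A j} :
    augMap (subspaceIncl A) j c ∈ augBoundaries F A j ↔ c ∈ augBoundaries F univ j := by
  refine ⟨fun ⟨b, hb, h⟩ => ?_, augMap_mem_augBoundaries fun x _ => x.2⟩
  obtain ⟨b', rfl⟩ := exists_augMap_subspaceIncl hb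
  rw [← augMap_boundary] at h
  exact ⟨b', by simp [augOn_univ], augMap_subspaceIncl_injective A j h⟩

theorem augMap_subspaceIncl_mem_augCycles {A : Set X} {j : ℕ} {c : AugChain F A j} :
    augMap (subspaceIncl A) j c ∈ augCycles F A j ↔ c ∈ augCycles F univ j := by
  refine ⟨fun h => ?_, augMap_mem_augCycles fun x _ => x.2⟩
  cases j with
  | zero => simp [augCycles, augOn_univ]
  | succ j =>
    refine ⟨by simp [augOn_univ], augMap_subspaceIncl_injective A j ?_⟩
    rw [augMap_boundary, h.2, map_zero]

theorem exists_augMap_eq_of_mem_augCycles {A : Set X} {j : ℕ} {c : AugChain F X j}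
    (hc : c ∈ augCycles F A j) :
    ∃ c' ∈ augCycles F (univ : Set A) j, augMap (subspaceIncl A) j c' = c := by
  obtain ⟨c', rfl⟩ := exists_augMap_subspaceIncl (augCycles_le_augOn _ _ hc)
  exact ⟨c', augMap_subspaceIncl_mem_augCycles.1 hc, rfl⟩

/-- Mayer-Vietoris is phrased for subsets of an ambient space, homotopy invariance for spaces; this
passes between the two. -/
theorem augAcyclic_univ_iff {A : Set X} {j : ℕ} :
    AugAcyclic F (univ : Set A) j ↔ AugAcyclic F A j := by
  refine ⟨fun h c hc => ?_, fun h c hc => ?_⟩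
  · obtain ⟨c', hc', rfl⟩ := exists_augMap_eq_of_mem_augCycles hc
    exact augMap_subspaceIncl_mem_augBoundaries.2 (h hc')
  · exact augMap_subspaceIncl_mem_augBoundaries.1 (h (augMap_subspaceIncl_mem_augCycles.2 hc))

theorem augLine_univ_iff {A : Set X} {j : ℕ} :
    AugLine F (univ : Set A) j ↔ AugLine F A j := by
  constructor
  · rintro ⟨g, hg, hg', h⟩
    refine ⟨augMap (subspaceIncl A) j g, augMap_subspaceIncl_mem_augCycles.2 hg,
      fun h => hg' (augMap_subspaceIncl_mem_augBoundaries.1 h), fun z hz => ?_⟩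
    obtain ⟨z', hz', rfl⟩ := exists_augMap_eq_of_mem_augCycles hz
    obtain ⟨a, ha⟩ := h z' hz'
    refine ⟨a, ?_⟩
    rw [← map_smul, ← map_sub]
    exact augMap_subspaceIncl_mem_augBoundaries.2 ha
  · rintro ⟨g, hg, hg', h⟩
    obtain ⟨g', hg'', rfl⟩ := exists_augMap_eq_of_mem_augCycles hg
    refine ⟨g', hg'', fun h => hg' (augMap_subspaceIncl_mem_augBoundaries.2 h), fun z hz => ?_⟩
    obtain ⟨a, ha⟩ := h _ (augMap_subspaceIncl_mem_augCycles.2 hz)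
    refine ⟨a, ?_⟩
    rw [← map_smul, ← map_sub] at ha
    exact augMap_subspaceIncl_mem_augBoundaries.1 ha

theorem augMap_sub_augMap_mem {f g : C(X, Y)} (h : f.Homotopic g) {j : ℕ} {z : AugChain F X j}
    (hz : z ∈ augCycles F univ j) : augMap g j z - augMap f j z ∈ augBoundaries F univ j := by
  cases j with
  | zero =>
    have : augMap (F := F) g 0 = augMap f 0 := by
      ext φ : 2
      simp only [LinearMap.comp_apply, Finsupp.lsingle_apply, augMap_single]
      congr 1
      ext1 t
      exact absurd t.2.2 (by simp)
    rw [this, sub_self]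
    exact zero_mem _
  | succ j =>
    obtain ⟨H⟩ := h
    -- A homotopy has the interval as first factor, the prism operator as second.
    let H' : C(X × unitInterval, Y) := H.toContinuousMap.comp ⟨Prod.swap, continuous_swap⟩
    refine ⟨augMap H' (j + 2) (augPrism F X (j + 1) z), by simp [augOn_univ], ?_⟩
    rw [← augMap_boundary, augBoundary_prism, hz.2, map_zero, sub_zero, map_sub, augMap_comp,
      augMap_comp]
    congr 3 <;> ext x <;> simp [H', prismIncl]

/-- Only one of the two homotopies of an equivalence is needed: the image of a cycle bounds in `Y`,
and its image back in `X` is homologous to the cycle itself. -/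
theorem AugAcyclic.of_retract {j : ℕ} (h : AugAcyclic F (univ : Set Y) j) (f : C(X, Y))
    (g : C(Y, X)) (hgf : (g.comp f).Homotopic (ContinuousMap.id X)) :
    AugAcyclic F (univ : Set X) j := by
  intro z hz
  have h1 := augMap_sub_augMap_mem hgf hz
  have h2 := augMap_mem_augBoundaries (f := g) (B := univ) (fun _ _ => mem_univ _)
    (h (augMap_mem_augCycles (f := f) (fun _ _ => mem_univ _) hz))
  rw [augMap_comp] at h2
  simpa using add_mem h1 h2

theorem AugAcyclic.of_homotopyEquiv {j : ℕ} (h : AugAcyclic F (univ : Set Y) j)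
    (e : ContinuousMap.HomotopyEquiv X Y) : AugAcyclic F (univ : Set X) j :=
  h.of_retract e.toFun e.invFun e.left_inv

theorem AugLine.of_homotopyEquiv {j : ℕ} (h : AugLine F (univ : Set Y) j)
    (e : ContinuousMap.HomotopyEquiv X Y) : AugLine F (univ : Set X) j := by
  obtain ⟨g, hg, hg', h⟩ := h
  have hcyc := augMap_mem_augCycles (f := e.invFun) (B := univ) (fun _ _ => mem_univ _) hg
  refine ⟨_, hcyc, fun hb => hg' ?_, fun z hz => ?_⟩
  · have h1 := augMap_sub_augMap_mem e.right_inv hg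
    have h2 := augMap_mem_augBoundaries (f := e.toFun) (B := univ) (fun _ _ => mem_univ _) hb
    rw [augMap_comp] at h2
    simpa using add_mem h1 h2
  · obtain ⟨a, ha⟩ := h _ (augMap_mem_augCycles (f := e.toFun) (fun _ _ => mem_univ _) hz)
    refine ⟨a, ?_⟩
    have h1 := augMap_sub_augMap_mem e.left_inv hz
    have h2 := augMap_mem_augBoundaries (f := e.invFun) (B := univ) (fun _ _ => mem_univ _) ha
    rw [map_sub, augMap_comp, map_smul] at h2
    have := add_mem h1 h2
    rwa [augMap_id, sub_add_sub_cancel] at this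

theorem augBoundary_single_const (x : X) (j : ℕ) (a : F) :
    augBoundary F X j (Finsupp.single (ContinuousMap.const _ x) a) =
      if Even (j + 1) then 0 else Finsupp.single (ContinuousMap.const _ x) a := by
  have h (i : Fin (j + 1)) : Finsupp.mapDomain
      (fun φ : C(stdSimplex ℝ (Fin (j + 1)), X) => φ.comp (augFace j i))
      (Finsupp.single (ContinuousMap.const _ x) a) =
        Finsupp.single (ContinuousMap.const _ x) a := by
    rw [Finsupp.mapDomain_single]
    rfl
  rw [augBoundary, faceBoundary_apply]
  simp only [h]
  rw [← Finset.sum_smul, Fin.sum_neg_one_pow]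
  split_ifs <;> simp

/-- There is one simplex in each index, and the differential is alternately zero and the identity.
If the incoming differential has an odd number of faces, every chain bounds; otherwise the outgoing
one is injective and the cycle is zero. -/
theorem augAcyclic_of_subsingleton [Subsingleton X] [Nonempty X] (j : ℕ) :
    AugAcyclic F (univ : Set X) j := by
  intro z hz
  obtain ⟨x⟩ := ‹Nonempty X›
  have h (i : ℕ) (c : AugChain F X i) : ∃ a, c = Finsupp.single (ContinuousMap.const _ x) a := by
    refine ⟨c (ContinuousMap.const _ x), ?_⟩
    ext φ
    have : φ = ContinuousMap.const _ x := by
      ext1 t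
      exact Subsingleton.elim _ _
    rw [this, Finsupp.single_eq_same]
  obtain ⟨a, rfl⟩ := h j z
  by_cases hj : Even (j + 1)
  · cases j with
    | zero => simp at hj
    | succ j =>
      have h0 := hz.2
      rw [SetLike.mem_coe, LinearMap.mem_ker, augBoundary_single_const, if_neg (by simpa [parity_simps] using hj)]
        at h0
      rw [Finsupp.single_eq_zero] at h0
      rw [h0, Finsupp.single_zero]
      exact zero_mem _
  · refine ⟨Finsupp.single (ContinuousMap.const _ x) a, by simp [augOn_univ], ?_⟩
    rw [augBoundary_single_const, if_neg hj]

theorem augAcyclic_of_contractible [ContractibleSpace X] (j : ℕ) :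
    AugAcyclic F (univ : Set X) j := by
  obtain ⟨e⟩ := ContractibleSpace.hequiv_unit X
  exact (augAcyclic_of_subsingleton j).of_homotopyEquiv e

end Reduced

/-! ### Small simplices -/

section Small

variable {F : Type*} [Field F] {X : Type*} [TopologicalSpace X]

/-! ### The mesh of iterated barycentric subdivisions. -/

section Mesh

variable {E : Type*} [NormedAddCommGroup E] [NormedSpace ℝ E] {K : Set E}

/-- The difference of a vertex and the barycenter is the average of j + 1 differences of vertices,
one of which is zero. -/
theorem dist_tupleBarycenter_le (hK : Convex ℝ K) {j : ℕ} {v : Fin (j + 1) → K} {D : ℝ}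
    (hv : ∀ a b, dist (v a) (v b) ≤ D) (i : Fin (j + 1)) :
    dist (v i : E) (tupleBarycenter hK j v : E) ≤ (1 - 1 / ((j : ℝ) + 1)) * D := by
  have hj : (j : ℝ) + 1 ≠ 0 := by positivity
  have h1 : (v i : E) - (tupleBarycenter hK j v : E) =
      ((j : ℝ) + 1)⁻¹ • ∑ l, ((v i : E) - v l) := by
    have hb (l : Fin (j + 1)) : (stdSimplex.barycenter : stdSimplex ℝ (Fin (j + 1))) l =
        ((j : ℝ) + 1)⁻¹ := by
      change (stdSimplex.barycenter : stdSimplex ℝ (Fin (j + 1))).val l = _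
      simp
    rw [tupleBarycenter, affineSimplex_coe]
    simp only [hb]
    rw [← Finset.smul_sum, Finset.sum_sub_distrib, smul_sub, Finset.sum_const, Finset.card_univ,
      Fintype.card_fin, ← Nat.cast_smul_eq_nsmul ℝ, smul_smul]
    push_cast
    rw [inv_mul_cancel₀ hj, one_smul]
  rw [dist_eq_norm, h1, norm_smul, Fin.sum_univ_succAbove _ i, sub_self, zero_add,
    Real.norm_of_nonneg (by positivity)]
  have h2 : ‖∑ l, ((v i : E) - v (i.succAbove l))‖ ≤ j * D := by
    refine (norm_sum_le_of_le _ fun l _ => ?_).trans (b := ∑ _l : Fin j, D) (by simp)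
    rw [← dist_eq_norm]
    exact hv _ _
  calc ((j : ℝ) + 1)⁻¹ * _ ≤ ((j : ℝ) + 1)⁻¹ * (j * D) := by gcongr
    _ = _ := by field_simp; ring

/-- Two properties are carried through the induction: the new vertices stay in the hull of the old
ones, and they are close to each other. The first gives the second for pairs involving the new apex.
A fixed bound `N` on the number of vertices gives one contraction factor for all dimensions met by
the recursion. -/
theorem tupleSubdiv_mesh (hK : Convex ℝ K) {N : ℕ} {D : ℝ} (hD : 0 ≤ D) :
    ∀ j ≤ N, ∀ v : Fin j → K, (∀ a b, dist (v a) (v b) ≤ D) →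
      tupleSubdiv (F := F) (tupleBarycenter hK) j (Finsupp.single v 1) ∈
        Finsupp.supported F F {w : Fin j → K |
          (∀ a, (w a : E) ∈ convexHull ℝ (range fun i => (v i : E))) ∧
            ∀ a b, dist (w a) (w b) ≤ (1 - 1 / (N : ℝ)) * D} := by
  intro j
  induction j with
  | zero =>
    intro _ v _
    exact Finsupp.single_mem_supported F 1 ⟨fun a => a.elim0, fun a => a.elim0⟩
  | succ j ih =>
    intro hj v hv
    rw [tupleSubdiv_single]
    have h1 : tupleBoundary F K j (Finsupp.single v 1) ∈
        Finsupp.supported F F {w | ∃ i : Fin (j + 1), w = v ∘ i.succAbove} :=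
      faceBoundary_mem_supported (s := {v}) (by rintro _ rfl i; exact ⟨i, rfl⟩)
        (Finsupp.single_mem_supported F 1 rfl)
    have h2 : tupleSubdiv (tupleBarycenter hK) j (tupleBoundary F K j (Finsupp.single v 1)) ∈
        Finsupp.supported F F {w : Fin j → K |
          (∀ a, (w a : E) ∈ convexHull ℝ (range fun i => (v i : E))) ∧
            ∀ a b, dist (w a) (w b) ≤ (1 - 1 / (N : ℝ)) * D} := by
      refine map_mem_of_mem_supported ?_ h1
      rintro _ ⟨i, rfl⟩
      refine Finsupp.supported_mono ?_ (ih (by omega) (v ∘ i.succAbove) fun a b => hv _ _)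
      rintro w ⟨hw, hw'⟩
      refine ⟨fun a => convexHull_mono ?_ (hw a), hw'⟩
      rintro _ ⟨l, rfl⟩
      exact ⟨i.succAbove l, rfl⟩
    have hbary : (tupleBarycenter hK j v : E) ∈ convexHull ℝ (range fun i => (v i : E)) :=
      (convex_convexHull ℝ _).sum_mem (fun i _ => stdSimplex.zero_le _ i)
        (stdSimplex.sum_eq_one _) fun i _ =>
          subset_convexHull ℝ _ (mem_range_self (f := fun i => (v i : E)) i)
    have hN : (0 : ℝ) < N := by exact_mod_cast (by omega : 0 < N)
    have hdist : ∀ x ∈ convexHull ℝ (range fun i => (v i : E)),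
        dist x (tupleBarycenter hK j v : E) ≤ (1 - 1 / (N : ℝ)) * D := by
      intro x hx
      -- A ball around the barycenter is convex, so it contains the hull once it contains the
      -- vertices.
      refine convexHull_min (t := Metric.closedBall (tupleBarycenter hK j v : E)
        ((1 - 1 / (N : ℝ)) * D)) ?_ (convex_closedBall _ _) hx
      rintro _ ⟨i, rfl⟩
      refine (dist_tupleBarycenter_le hK hv i).trans ?_
      have : (j : ℝ) + 1 ≤ N := by exact_mod_cast hj
      gcongr
    refine mapDomain_mem_supported ?_ h2
    rintro w ⟨hw, hw'⟩
    refine ⟨fun a => ?_, fun a b => ?_⟩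
    · refine Fin.cases ?_ (fun a => ?_) a
      · exact hbary
      · exact hw a
    · refine Fin.cases ?_ (fun a => ?_) a <;> refine Fin.cases ?_ (fun b => ?_) b
      · have : (1 : ℝ) / N ≤ 1 := by
          rw [div_le_one hN]
          exact_mod_cast (by omega : 1 ≤ N)
        simpa using mul_nonneg (sub_nonneg.2 this) hD
      · simpa [dist_comm, Subtype.dist_eq] using hdist _ (hw b)
      · simpa [Subtype.dist_eq] using hdist _ (hw a)
      · simpa using hw' a b

theorem tupleSubdiv_iterate_mesh (hK : Convex ℝ K) {j : ℕ} {D : ℝ} (hD : 0 ≤ D)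
    {v : Fin j → K} (hv : ∀ a b, dist (v a) (v b) ≤ D) (m : ℕ) :
    (tupleSubdiv (F := F) (tupleBarycenter hK) j)^[m] (Finsupp.single v 1) ∈
      Finsupp.supported F F {w : Fin j → K |
        ∀ a b, dist (w a) (w b) ≤ (1 - 1 / ((j : ℝ) + 1)) ^ m * D} := by
  induction m with
  | zero => exact Finsupp.single_mem_supported F 1 (by simpa using hv)
  | succ m ih =>
    rw [Function.iterate_succ_apply']
    refine map_mem_of_mem_supported (fun w hw => ?_) ih
    have h0 : (0 : ℝ) ≤ 1 - 1 / ((j : ℝ) + 1) := by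
      rw [sub_nonneg, div_le_one (by positivity)]
      simp
    -- Taking `j + 1` instead of `j` keeps the factor strictly below 1 even for `j = 0`.
    have := tupleSubdiv_mesh (F := F) hK (N := j + 1) (mul_nonneg (pow_nonneg h0 m) hD) j
      (by omega) w hw
    refine Finsupp.supported_mono (fun w' hw' a b => (hw'.2 a b).trans_eq ?_) this
    push_cast
    ring

end Mesh

/-! ### Subdividing chains until they are small with respect to two open sets. -/

theorem augSubdiv_iterate_single (j m : ℕ) (φ : C(stdSimplex ℝ (Fin j), X)) :
    (augSubdiv F X j)^[m] (Finsupp.single φ 1) = augMap φ j (affineChain F j j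
      ((simplexSubdiv F j j)^[m] (Finsupp.single (simplexVertices j) 1))) := by
  induction m with
  | zero => simp [augMap_affineChain_vertices]
  | succ m ih =>
    rw [Function.iterate_succ_apply', Function.iterate_succ_apply', ih,
      augSubdiv_augMap_affineChain]

variable {U V : Set X}

/-- The cover pulled back along φ has a Lebesgue number δ, and the model simplex has diameter at
most 1, so it suffices that the m-th power of the mesh factor is below δ. -/
theorem exists_subdiv_iterate_single_mem (hU : IsOpen U) (hV : IsOpen V) {j : ℕ}
    (φ : C(stdSimplex ℝ (Fin j), X)) (hφ : ∀ t, φ t ∈ U ∪ V) :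
    ∃ m, (augSubdiv F X j)^[m] (Finsupp.single φ 1) ∈ augOn F U j ⊔ augOn F V j := by
  obtain ⟨δ, hδ, hball⟩ := lebesgue_number_lemma_of_metric
    (s := (univ : Set (stdSimplex ℝ (Fin j))))
    (c := fun b : Bool => φ ⁻¹' (cond b U V)) isCompact_univ
    (by rintro (_ | _); exacts [hV.preimage φ.continuous, hU.preimage φ.continuous])
    (fun t _ => by
      rw [mem_iUnion]
      rcases hφ t with h | h
      exacts [⟨true, h⟩, ⟨false, h⟩])
  have hdist : ∀ s t : stdSimplex ℝ (Fin j), dist s t ≤ 1 := fun s t =>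
    (Metric.dist_le_diam_of_mem (bounded_stdSimplex _) s.2 t.2).trans diam_stdSimplex_le
  have hr0 : (0 : ℝ) ≤ 1 - 1 / ((j : ℝ) + 1) := by
    rw [sub_nonneg, div_le_one (by positivity)]
    simp
  have hr1 : 1 - 1 / ((j : ℝ) + 1) < 1 := by
    rw [sub_lt_self_iff]
    positivity
  obtain ⟨m, hm⟩ := exists_pow_lt_of_lt_one hδ hr1
  refine ⟨m, ?_⟩
  rw [augSubdiv_iterate_single]
  have hmesh := tupleSubdiv_iterate_mesh (F := F) (convex_stdSimplex ℝ (Fin j)) zero_le_one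
    (v := simplexVertices j) (fun a b => hdist _ _) m
  rw [← LinearMap.comp_apply]
  refine map_mem_of_mem_supported (fun w hw => ?_) hmesh
  rw [LinearMap.comp_apply, affineChain, Finsupp.lmapDomain_apply, Finsupp.mapDomain_single,
    augMap_single]
  cases j with
  | zero => exact Submodule.mem_sup_left (by simp [augOn_zero])
  | succ j =>
    -- Balls are convex, so closeness of the vertices to the first one controls the whole affine
    -- simplex.
    have hsub : ∀ t, affineSimplex (convex_stdSimplex ℝ (Fin (j + 1))) w t ∈
        Metric.ball (w 0) δ := fun t =>
      (convex_ball (w 0 : Fin (j + 1) → ℝ) δ).sum_mem (fun i _ => t.2.1 i) t.2.2 fun i _ =>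
        ((hw i 0).trans_eq (mul_one _)).trans_lt hm
    obtain ⟨b, hb⟩ := hball (w 0) trivial
    have hmem : ∀ t, φ (affineSimplex (convex_stdSimplex ℝ (Fin (j + 1))) w t) ∈ cond b U V :=
      fun t => hb (hsub t)
    cases b with
    | true => exact Submodule.mem_sup_left (Finsupp.single_mem_supported F 1 hmem)
    | false => exact Submodule.mem_sup_right (Finsupp.single_mem_supported F 1 hmem)

theorem augSubdiv_mem_sup {j : ℕ} {c : AugChain F X j} (hc : c ∈ augOn F U j ⊔ augOn F V j) :
    augSubdiv F X j c ∈ augOn F U j ⊔ augOn F V j := by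
  obtain ⟨a, ha, b, hb, rfl⟩ := Submodule.mem_sup.1 hc
  rw [map_add]
  exact Submodule.add_mem_sup (augSubdiv_mem_augOn ha) (augSubdiv_mem_augOn hb)

theorem augSubdivHomotopy_mem_sup {j : ℕ} {c : AugChain F X j}
    (hc : c ∈ augOn F U j ⊔ augOn F V j) :
    augSubdivHomotopy F X j c ∈ augOn F U (j + 1) ⊔ augOn F V (j + 1) := by
  obtain ⟨a, ha, b, hb, rfl⟩ := Submodule.mem_sup.1 hc
  rw [map_add]
  exact Submodule.add_mem_sup (augSubdivHomotopy_mem_augOn ha) (augSubdivHomotopy_mem_augOn hb)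

theorem exists_subdiv_iterate_mem (hU : IsOpen U) (hV : IsOpen V) {j : ℕ} {c : AugChain F X j}
    (hc : c ∈ augOn F (U ∪ V) j) :
    ∃ m, ∀ n ≥ m, (augSubdiv F X j ^ n) c ∈ augOn F U j ⊔ augOn F V j := by
  -- Asking for all large `n` makes the property stable under sums, so it only has to be checked on
  -- single simplices.
  let p : Submodule F (AugChain F X j) :=
    { carrier := {c | ∃ m, ∀ n ≥ m, (augSubdiv F X j ^ n) c ∈ augOn F U j ⊔ augOn F V j}
      add_mem' := by
        rintro a b ⟨m, hm⟩ ⟨m', hm'⟩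
        refine ⟨max m m', fun n hn => ?_⟩
        rw [map_add]
        exact add_mem (hm n (le_of_max_le_left hn)) (hm' n (le_of_max_le_right hn))
      zero_mem' := ⟨0, fun n _ => by simp⟩
      smul_mem' := by
        rintro a b ⟨m, hm⟩
        refine ⟨m, fun n hn => ?_⟩
        rw [map_smul]
        exact Submodule.smul_mem _ _ (hm n hn) }
  refine map_mem_of_mem_supported (L := LinearMap.id) (p := p) (fun φ hφ => ?_) hc
  obtain ⟨m, hm⟩ := exists_subdiv_iterate_single_mem (F := F) hU hV φ hφ
  refine ⟨m, fun n hn => ?_⟩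
  induction n, hn using Nat.le_induction with
  | base => rwa [Module.End.pow_apply]
  | succ n _ ih =>
    rw [pow_succ', Module.End.mul_apply]
    exact augSubdiv_mem_sup ih

/-- In index 0 there is no boundary term to cancel: the homotopy is zero and subdivision fixes the
empty simplex. -/
theorem augBoundary_subdivHomotopy_of_mem_augCycles {j : ℕ} {z : AugChain F X j}
    (hz : z ∈ augCycles F univ j) :
    augBoundary F X j (augSubdivHomotopy F X j z) = z - augSubdiv F X j z := by
  cases j with
  | zero =>
    have h1 : augSubdivHomotopy F X 0 = 0 := by
      ext φ : 2
      simp [augSubdivHomotopy, naturalOp_single, tupleSubdivHomotopy, coneHomotopy]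
    have h2 : augSubdiv F X 0 = LinearMap.id := by
      ext φ : 2
      simp [augSubdiv, naturalOp_single, tupleSubdiv, augMap_affineChain_vertices]
    simp [h1, h2]
  | succ j => rw [augBoundary_subdivHomotopy, hz.2, map_zero, sub_zero]

theorem augSubdiv_mem_augCycles {A : Set X} {j : ℕ} {z : AugChain F X j}
    (hz : z ∈ augCycles F A j) : augSubdiv F X j z ∈ augCycles F A j := by
  cases j with
  | zero => exact augSubdiv_mem_augOn hz
  | succ j =>
    refine ⟨augSubdiv_mem_augOn hz.1, ?_⟩
    rw [SetLike.mem_coe, LinearMap.mem_ker, augBoundary_subdiv, hz.2, map_zero]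

/-- With subdivision S and its homotopy T, the chain is the sum of the T Sⁱ z for i < m, and its
boundary telescopes. Both operators preserve the support of a chain, hence the two extra clauses. -/
theorem exists_boundary_eq_sub_subdiv_iterate {j : ℕ} {z : AugChain F X j}
    (hz : z ∈ augCycles F univ j) (m : ℕ) :
    ∃ y, augBoundary F X j y = z - (augSubdiv F X j ^ m) z ∧
      (∀ A : Set X, z ∈ augOn F A j → y ∈ augOn F A (j + 1)) ∧
      (z ∈ augOn F U j ⊔ augOn F V j → y ∈ augOn F U (j + 1) ⊔ augOn F V (j + 1)) := by
  suffices H : (augSubdiv F X j ^ m) z ∈ augCycles F univ j ∧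
      (∀ A : Set X, z ∈ augOn F A j → (augSubdiv F X j ^ m) z ∈ augOn F A j) ∧
      (z ∈ augOn F U j ⊔ augOn F V j →
        (augSubdiv F X j ^ m) z ∈ augOn F U j ⊔ augOn F V j) ∧
      ∃ y, augBoundary F X j y = z - (augSubdiv F X j ^ m) z ∧
      (∀ A : Set X, z ∈ augOn F A j → y ∈ augOn F A (j + 1)) ∧
      (z ∈ augOn F U j ⊔ augOn F V j → y ∈ augOn F U (j + 1) ⊔ augOn F V (j + 1)) from H.2.2.2
  induction m with
  | zero => exact ⟨by simpa using hz, by simp, by simp, 0, by simp, by simp, by simp⟩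
  | succ m ih =>
    obtain ⟨h1, h2, h3, y, hy, hyA, hyU⟩ := ih
    rw [pow_succ', Module.End.mul_apply]
    refine ⟨augSubdiv_mem_augCycles h1, fun A hA => augSubdiv_mem_augOn (h2 A hA),
      fun h => augSubdiv_mem_sup (h3 h), y + augSubdivHomotopy F X j ((augSubdiv F X j ^ m) z),
      ?_, fun A hA => add_mem (hyA A hA) (augSubdivHomotopy_mem_augOn (h2 A hA)),
      fun h => add_mem (hyU h) (augSubdivHomotopy_mem_sup (h3 h))⟩
    rw [map_add, hy, augBoundary_subdivHomotopy_of_mem_augCycles h1]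
    abel

/-- Every cycle of `U ∪ V` is homologous to a sum of a chain of `U` and a chain of `V`. -/
theorem exists_add_sub_mem_augBoundaries (hU : IsOpen U) (hV : IsOpen V) {j : ℕ}
    {z : AugChain F X j} (hz : z ∈ augCycles F (U ∪ V) j) :
    ∃ u ∈ augOn F U j, ∃ v ∈ augOn F V j, z - (u + v) ∈ augBoundaries F (U ∪ V) j := by
  obtain ⟨m, hm⟩ := exists_subdiv_iterate_mem hU hV (augCycles_le_augOn _ _ hz)
  obtain ⟨u, hu, v, hv, h⟩ := Submodule.mem_sup.1 (hm m le_rfl)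
  obtain ⟨y, hy, hyA, -⟩ := exists_boundary_eq_sub_subdiv_iterate (U := U) (V := V)
    (augCycles_mono (subset_univ _) _ hz) m
  exact ⟨u, hu, v, hv, y, hyA _ (augCycles_le_augOn _ _ hz), by rw [hy, h]⟩

/-- A chain in the span of chains of `U` and of `V` that bounds in `U ∪ V` bounds in this span. -/
theorem exists_boundary_add_eq (hU : IsOpen U) (hV : IsOpen V) {j : ℕ} {z : AugChain F X j}
    (hz : z ∈ augOn F U j ⊔ augOn F V j) (hb : z ∈ augBoundaries F (U ∪ V) j) :
    ∃ u ∈ augOn F U (j + 1), ∃ v ∈ augOn F V (j + 1),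
      augBoundary F X j u + augBoundary F X j v = z := by
  have hcyc := augCycles_mono (subset_univ _) _ (augBoundaries_le_augCycles _ _ hb)
  obtain ⟨w, hw, rfl⟩ := hb
  obtain ⟨m, hm⟩ := exists_subdiv_iterate_mem hU hV hw
  obtain ⟨y, hy, -, hyU⟩ := exists_boundary_eq_sub_subdiv_iterate (U := U) (V := V) hcyc m
  -- If w fills z, the m-fold subdivision of w fills that of z, and y fills the difference; their
  -- sum is a small filling of z.
  obtain ⟨u, hu, v, hv, h⟩ := Submodule.mem_sup.1 (add_mem (hm m le_rfl) (hyU hz))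
  refine ⟨u, hu, v, hv, ?_⟩
  have hcomm (n : ℕ) : augBoundary F X j ((augSubdiv F X (j + 1) ^ n) w) =
      (augSubdiv F X j ^ n) (augBoundary F X j w) := by
    induction n with
    | zero => simp
    | succ n ih => rw [pow_succ', Module.End.mul_apply, augBoundary_subdiv, ih, pow_succ',
        Module.End.mul_apply]
  rw [← map_add, h, map_add, hy, hcomm]
  abel

/-! ### The Mayer-Vietoris argument for two acyclic open sets -/

theorem AugAcyclic.union_zero (hU : AugAcyclic F U 0) : AugAcyclic F (U ∪ V) 0 := fun _ _ =>
  augBoundaries_mono subset_union_left _ (hU (by simp [augCycles, augOn_zero]))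

/-- Write a cycle as u + v up to a boundary. Then ∂u = −∂v lies in the intersection and bounds some
w there, and the corrected cycles u − w and v + w bound in `U` and in `V`. -/
theorem AugAcyclic.union_succ (hUo : IsOpen U) (hVo : IsOpen V) (hU : ∀ j, AugAcyclic F U j)
    (hV : ∀ j, AugAcyclic F V j) {j : ℕ} (h : AugAcyclic F (U ∩ V) j) :
    AugAcyclic F (U ∪ V) (j + 1) := by
  intro z hz
  obtain ⟨u, hu, v, hv, hb⟩ := exists_add_sub_mem_augBoundaries hUo hVo hz
  have hz0 : augBoundary F X j (u + v) = 0 := by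
    have := (augBoundaries_le_augCycles _ _ hb).2
    rw [SetLike.mem_coe, LinearMap.mem_ker, map_sub, hz.2, zero_sub, neg_eq_zero] at this
    exact this
  rw [map_add, add_eq_zero_iff_eq_neg] at hz0
  have hmem : augBoundary F X j u ∈ augOn F (U ∩ V) j :=
    mem_augOn_inter (augBoundary_mem_augOn hu)
      (hz0 ▸ neg_mem (augBoundary_mem_augOn hv))
  obtain ⟨w, hw, hwu⟩ := h (augBoundary_mem_augCycles hmem)
  have h1 : u - w ∈ augBoundaries F (U ∪ V) (j + 1) :=
    augBoundaries_mono subset_union_left _ (hU _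
      ⟨sub_mem hu (augOn_mono inter_subset_left _ hw), by
        rw [SetLike.mem_coe, LinearMap.mem_ker, map_sub, hwu, sub_self]⟩)
  have h2 : v + w ∈ augBoundaries F (U ∪ V) (j + 1) :=
    augBoundaries_mono subset_union_right _ (hV _
      ⟨add_mem hv (augOn_mono inter_subset_right _ hw), by
        rw [SetLike.mem_coe, LinearMap.mem_ker, map_add, hwu, hz0, add_neg_cancel]⟩)
  convert add_mem hb (add_mem h1 h2) using 1
  abel

/-- The generator g of the intersection bounds u in `U` and v in `V`, and u − v generates the
homology of the union: this inverts the connecting homomorphism. -/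
theorem AugLine.union_succ (hUo : IsOpen U) (hVo : IsOpen V) (hU : ∀ j, AugAcyclic F U j)
    (hV : ∀ j, AugAcyclic F V j) {j : ℕ} (h : AugLine F (U ∩ V) j) :
    AugLine F (U ∪ V) (j + 1) := by
  obtain ⟨g, hg, hg', h⟩ := h
  obtain ⟨u, hu, hug⟩ := hU j (augCycles_mono inter_subset_left _ hg)
  obtain ⟨v, hv, hvg⟩ := hV j (augCycles_mono inter_subset_right _ hg)
  have huv : u - v ∈ augOn F U (j + 1) ⊔ augOn F V (j + 1) :=
    sub_mem (Submodule.mem_sup_left hu) (Submodule.mem_sup_right hv)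
  refine ⟨u - v, ⟨sub_mem (augOn_mono subset_union_left _ hu)
    (augOn_mono subset_union_right _ hv), by
      rw [SetLike.mem_coe, LinearMap.mem_ker, map_sub, hug, hvg, sub_self]⟩, fun hb => hg' ?_, fun z hz => ?_⟩
  · obtain ⟨a, ha, b, hb, hab⟩ := exists_boundary_add_eq hUo hVo huv hb
    -- This common chain lies in both sets and still has boundary g, contradicting the choice of g.
    have heq : u - augBoundary F X (j + 1) a = v + augBoundary F X (j + 1) b := by
      rw [sub_eq_iff_eq_add, add_assoc, add_comm (augBoundary F X (j + 1) b), hab]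
      abel
    refine ⟨u - augBoundary F X (j + 1) a, mem_augOn_inter
      (sub_mem hu (augBoundary_mem_augOn ha)) ?_, ?_⟩
    · rw [heq]
      exact add_mem hv (augBoundary_mem_augOn hb)
    · rw [map_sub, augBoundary_boundary, sub_zero, hug]
  · obtain ⟨u', hu', v', hv', hb⟩ := exists_add_sub_mem_augBoundaries hUo hVo hz
    have hz0 : augBoundary F X j (u' + v') = 0 := by
      have := (augBoundaries_le_augCycles _ _ hb).2
      rw [SetLike.mem_coe, LinearMap.mem_ker, map_sub, hz.2, zero_sub, neg_eq_zero] at this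
      exact this
    rw [map_add, add_eq_zero_iff_eq_neg] at hz0
    have hmem : augBoundary F X j u' ∈ augOn F (U ∩ V) j :=
      mem_augOn_inter (augBoundary_mem_augOn hu')
        (hz0 ▸ neg_mem (augBoundary_mem_augOn hv'))
    obtain ⟨c, w, hw, hwu⟩ := h _ (augBoundary_mem_augCycles hmem)
    refine ⟨c, ?_⟩
    have h1 : u' - c • u - w ∈ augBoundaries F (U ∪ V) (j + 1) :=
      augBoundaries_mono subset_union_left _ (hU _
        ⟨sub_mem (sub_mem hu' (Submodule.smul_mem _ _ hu)) (augOn_mono inter_subset_left _ hw), by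
          rw [SetLike.mem_coe, LinearMap.mem_ker, map_sub, map_sub, map_smul, hug, hwu, sub_self]⟩)
    have h2 : v' + c • v + w ∈ augBoundaries F (U ∪ V) (j + 1) :=
      augBoundaries_mono subset_union_right _ (hV _
        ⟨add_mem (add_mem hv' (Submodule.smul_mem _ _ hv))
          (augOn_mono inter_subset_right _ hw), by
          rw [SetLike.mem_coe, LinearMap.mem_ker, map_add, map_add, map_smul, hvg, hwu, hz0]
          abel⟩)
    convert add_mem hb (add_mem h1 h2) using 1
    rw [smul_sub]
    abel

end Small

/-! ### The homology of punctured spaces and spheres -/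

section Spheres

variable (F : Type*) [Field F]

/-- `A` has the reduced homology of a sphere of dimension `n - 1`. -/
def HasSphereHomology {X : Type*} [TopologicalSpace X] (A : Set X) (n : ℕ) : Prop :=
  (∀ j, j ≠ n → AugAcyclic F A j) ∧ AugLine F A n

variable {F} {X Y : Type*} [TopologicalSpace X] [TopologicalSpace Y]

theorem hasSphereHomology_univ_iff {A : Set X} {n : ℕ} :
    HasSphereHomology F (univ : Set A) n ↔ HasSphereHomology F A n := by
  simp only [HasSphereHomology, augAcyclic_univ_iff, augLine_univ_iff]

theorem HasSphereHomology.of_homotopyEquiv {n : ℕ} (h : HasSphereHomology F (univ : Set Y) n)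
    (e : ContinuousMap.HomotopyEquiv X Y) : HasSphereHomology F (univ : Set X) n :=
  ⟨fun j hj => (h.1 j hj).of_homotopyEquiv e, h.2.of_homotopyEquiv e⟩

theorem augOn_empty_succ (j : ℕ) : augOn F (∅ : Set X) (j + 1) = ⊥ := by
  have : {φ : C(stdSimplex ℝ (Fin (j + 1)), X) | ∀ t, φ t ∈ (∅ : Set X)} = ∅ := by
    ext φ
    simp
  rw [augOn, this, Finsupp.supported_empty]

theorem augAcyclic_empty {j : ℕ} (hj : j ≠ 0) : AugAcyclic F (∅ : Set X) j := by
  obtain ⟨j, rfl⟩ := Nat.exists_eq_succ_of_ne_zero hj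
  exact inf_le_left.trans ((augOn_empty_succ (F := F) j).le.trans bot_le)

theorem exists_eq_single_of_zero (φ : C(stdSimplex ℝ (Fin 0), X)) (c : AugChain F X 0) :
    ∃ a, c = Finsupp.single φ a := by
  refine ⟨c φ, ?_⟩
  ext ψ
  have : ψ = φ := by
    ext1 t
    exact absurd t.2.2 (by simp)
  rw [this, Finsupp.single_eq_same]

/-- The empty simplex is a cycle, and it does not bound because there is no vertex. -/
theorem hasSphereHomology_empty : HasSphereHomology F (∅ : Set X) 0 := by
  refine ⟨fun j hj => augAcyclic_empty hj, ?_⟩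
  let φ : C(stdSimplex ℝ (Fin 0), X) :=
    ⟨fun t => absurd t.2.2 (by simp), continuous_of_const fun t => absurd t.2.2 (by simp)⟩
  refine ⟨Finsupp.single φ 1, by simp [augCycles, augOn_zero], ?_, fun z _ => ?_⟩
  · rw [augBoundaries, augOn_empty_succ, Submodule.map_bot, Submodule.mem_bot]
    simp
  · obtain ⟨a, rfl⟩ := exists_eq_single_of_zero φ z
    exact ⟨a, by simp⟩

variable {E E' : Type*} [NormedAddCommGroup E] [NormedSpace ℝ E] [NormedAddCommGroup E']
  [NormedSpace ℝ E']

theorem HasSphereHomology.of_linearEquiv {n : ℕ} (h : HasSphereHomology F ({0}ᶜ : Set E) n)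
    (e : E' ≃L[ℝ] E) : HasSphereHomology F ({0}ᶜ : Set E') n := by
  rw [← hasSphereHomology_univ_iff] at h ⊢
  refine h.of_homotopyEquiv (Homeomorph.toHomotopyEquiv ?_)
  exact e.toHomeomorph.subtype fun x => by simp

theorem augAcyclic_of_starConvex {A : Set E} {x : E} (h : StarConvex ℝ x A) (hne : A.Nonempty)
    (j : ℕ) : AugAcyclic F A j := by
  have := h.contractibleSpace hne
  exact augAcyclic_univ_iff.1 (augAcyclic_of_contractible j)

/-- The complement of an axis in a product with `ℝ`. -/
def axisComplHomeomorph (E : Type*) [NormedAddCommGroup E] :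
    {q : E × ℝ | q.1 ≠ 0} ≃ₜ ({0}ᶜ : Set E) × ℝ where
  toFun q := (⟨q.1.1, q.2⟩, q.1.2)
  invFun q := ⟨(q.1.1, q.2), q.1.2⟩
  left_inv _ := rfl
  right_inv _ := rfl
  continuous_toFun := by fun_prop
  continuous_invFun := by fun_prop

/-- Suspension: removing from `E × ℝ` the closed upper or the closed lower half of the vertical axis
leaves a star-shaped open set. The two sets cover the punctured space and meet in the complement of
the axis, which is equivalent to punctured `E`. -/
theorem HasSphereHomology.prod_real {n : ℕ} (h : HasSphereHomology F ({0}ᶜ : Set E) n) :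
    HasSphereHomology F ({0}ᶜ : Set (E × ℝ)) (n + 1) := by
  let U : Set (E × ℝ) := {q | q.1 ≠ 0 ∨ q.2 < 0}
  let V : Set (E × ℝ) := {q | q.1 ≠ 0 ∨ 0 < q.2}
  have hUo : IsOpen U := (isOpen_ne_fun continuous_fst continuous_const).union
    (isOpen_lt continuous_snd continuous_const)
  have hVo : IsOpen V := (isOpen_ne_fun continuous_fst continuous_const).union
    (isOpen_lt continuous_const continuous_snd)
  have hUV : U ∪ V = {0}ᶜ := by
    ext q
    simp only [U, V, mem_union, mem_ofPred_eq, mem_compl_iff, mem_singleton_iff, Prod.ext_iff,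
      Prod.fst_zero, Prod.snd_zero]
    by_cases h : q.1 = 0 <;> simp [h]
  have hUV' : U ∩ V = {q | q.1 ≠ 0} := by
    ext q
    simp only [U, V, mem_inter_iff, mem_ofPred_eq]
    constructor
    · rintro ⟨h | h, h' | h'⟩
      exacts [h, h, h', absurd h (not_lt_of_gt h')]
    · exact fun h => ⟨Or.inl h, Or.inl h⟩
  have hU : ∀ j, AugAcyclic F U j := by
    refine augAcyclic_of_starConvex (x := (0, -1)) ?_ ⟨(0, -1), Or.inr (by simp)⟩
    intro q hq a b ha hb hab
    -- For `b = 0` the point is the apex; otherwise a nonzero first component stays nonzero, and a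
    -- negative height stays negative.
    by_cases hb0 : b = 0
    · right
      have : a = 1 := by linarith
      simp [hb0, this]
    · rcases hq with hq | hq
      · left
        simp [hb0, hq]
      · right
        have : 0 < b := lt_of_le_of_ne hb (Ne.symm hb0)
        have := mul_neg_of_pos_of_neg this hq
        simp only [Prod.smul_mk, smul_zero, smul_eq_mul, mul_neg, mul_one, Prod.snd_add,
          Prod.smul_snd]
        linarith
  have hV : ∀ j, AugAcyclic F V j := by
    refine augAcyclic_of_starConvex (x := (0, 1)) ?_ ⟨(0, 1), Or.inr (by simp)⟩
    intro q hq a b ha hb hab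
    by_cases hb0 : b = 0
    · right
      have : a = 1 := by linarith
      simp [hb0, this]
    · rcases hq with hq | hq
      · left
        simp [hb0, hq]
      · right
        have : 0 < b := lt_of_le_of_ne hb (Ne.symm hb0)
        have := mul_pos this hq
        simp only [Prod.smul_mk, smul_zero, smul_eq_mul, mul_one, Prod.snd_add, Prod.smul_snd]
        linarith
  have hinter : HasSphereHomology F (U ∩ V) n := by
    rw [hUV', ← hasSphereHomology_univ_iff]
    rw [← hasSphereHomology_univ_iff] at h
    obtain ⟨e⟩ := ContractibleSpace.hequiv_unit ℝ
    exact h.of_homotopyEquiv ((axisComplHomeomorph E).toHomotopyEquiv.trans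
      (((ContinuousMap.HomotopyEquiv.refl _).prodCongr e).trans
        (Homeomorph.prodPUnit _).toHomotopyEquiv))
  rw [← hUV]
  refine ⟨fun j hj => ?_, hinter.2.union_succ hUo hVo hU hV⟩
  cases j with
  | zero => exact (hU 0).union_zero
  | succ j => exact (hinter.1 j (by omega)).union_succ hUo hVo hU hV

theorem hasSphereHomology_punctured : ∀ n, HasSphereHomology F ({0}ᶜ : Set (Fin n → ℝ)) n
  | 0 => by
    have : ({0}ᶜ : Set (Fin 0 → ℝ)) = ∅ := by
      ext x
      simp [Subsingleton.elim x 0]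
    rw [this]
    exact hasSphereHomology_empty
  | n + 1 => (hasSphereHomology_punctured n).prod_real.of_linearEquiv
      (ContinuousLinearEquiv.ofFinrankEq (by simp))

theorem hasSphereHomology_sphere (p : ℕ) : HasSphereHomology F (univ : Set (Sphere p)) p := by
  have h : HasSphereHomology F ({0}ᶜ : Set (EuclideanSpace ℝ (Fin p))) p :=
    (hasSphereHomology_punctured p).of_linearEquiv (ContinuousLinearEquiv.ofFinrankEq (by simp))
  rw [← hasSphereHomology_univ_iff] at h
  have : ContractibleSpace (Ioi (0 : ℝ)) := (convex_Ioi 0).contractibleSpace ⟨1, by simp⟩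
  obtain ⟨e⟩ := ContractibleSpace.hequiv_unit (Ioi (0 : ℝ))
  exact h.of_homotopyEquiv ((homeomorphUnitSphereProd _).toHomotopyEquiv.trans
      (((ContinuousMap.HomotopyEquiv.refl _).prodCongr e).trans
        (Homeomorph.prodPUnit _).toHomotopyEquiv)).symm

/-- Proper spherical caps are acyclic. -/
theorem augAcyclic_cap {p : ℕ} (μ : Sphere p) {s : ℝ} (hs : -1 ≤ s) (hs' : s < 1) (j : ℕ) :
    AugAcyclic F {x : Sphere p | inner ℝ (x : EuclideanSpace ℝ (Fin p)) μ ≤ s} j := by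
  have hμ : ‖(μ : EuclideanSpace ℝ (Fin p))‖ = 1 := by simp
  have hμμ : inner ℝ (μ : EuclideanSpace ℝ (Fin p)) μ = 1 := by
    rw [real_inner_self_eq_norm_sq, hμ, one_pow]
  -- The punctured linear cone over the cap is star-shaped about −μ, and normalization retracts it
  -- onto the cap.
  let C : Set (EuclideanSpace ℝ (Fin p)) := {x | x ≠ 0 ∧ inner ℝ x μ ≤ s * ‖x‖}
  have hC : AugAcyclic F C j := by
    have hmem : -(μ : EuclideanSpace ℝ (Fin p)) ∈ C := by
      refine ⟨by rw [← norm_ne_zero_iff, norm_neg, hμ]; exact one_ne_zero, ?_⟩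
      rw [inner_neg_left, hμμ, norm_neg, hμ]
      linarith
    refine augAcyclic_of_starConvex (x := -(μ : EuclideanSpace ℝ (Fin p))) ?_ ⟨_, hmem⟩ j
    rintro x ⟨hx0, hx⟩ a b ha hb hab
    -- A segment from −μ can meet 0 only if its other endpoint is a positive multiple of μ, which `s
    -- < 1` excludes.
    refine ⟨fun h0 => ?_, ?_⟩
    · have hbx : b • x = a • (μ : EuclideanSpace ℝ (Fin p)) := by
        rw [smul_neg, neg_add_eq_zero] at h0
        exact h0.symm
      have hn : b * ‖x‖ = a := by
        have := congrArg norm hbx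
        rwa [norm_smul, norm_smul, hμ, Real.norm_of_nonneg ha, Real.norm_of_nonneg hb,
          mul_one] at this
      have hi : b * inner ℝ x μ = a := by
        have := congrArg (fun y => inner ℝ y (μ : EuclideanSpace ℝ (Fin p))) hbx
        simpa only [inner_smul_left, hμμ, mul_one, conj_trivial] using this
      have hapos : 0 < a := by
        rcases ha.eq_or_lt with h | h
        · have hb1 : b = 1 := by linarith
          rw [hb1, ← h, one_mul] at hn
          exact absurd (norm_eq_zero.1 hn) hx0
        · exact h
      have := mul_le_mul_of_nonneg_left hx hb
      nlinarith
    · rw [inner_add_left, inner_smul_left, inner_neg_left, hμμ, inner_smul_left]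
      simp only [conj_trivial]
      have h1 : ‖a • -(μ : EuclideanSpace ℝ (Fin p))‖ = a := by
        rw [norm_smul, norm_neg, hμ, Real.norm_of_nonneg ha, mul_one]
      have h2 : ‖b • x‖ = b * ‖x‖ := by rw [norm_smul, Real.norm_of_nonneg hb]
      have h3 := norm_add_le (a • -(μ : EuclideanSpace ℝ (Fin p))) (b • x)
      have h4 := norm_le_add_norm_add (b • x) (a • -(μ : EuclideanSpace ℝ (Fin p)))
      rw [add_comm (b • x)] at h4
      rw [h1, h2] at h3 h4
      have h5 := mul_le_mul_of_nonneg_left hx hb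
      set N := ‖a • -(μ : EuclideanSpace ℝ (Fin p)) + b • x‖
      -- For `s ≥ 0` a lower bound on `N` and `s < 1` are needed, for `s ≤ 0` an upper bound and `-1
      -- ≤ s`; these are the two triangle inequalities above.
      rcases le_total 0 s with h | h <;> nlinarith
  rw [← augAcyclic_univ_iff] at hC ⊢
  let f : C({x : Sphere p | inner ℝ (x : EuclideanSpace ℝ (Fin p)) μ ≤ s}, C) :=
    ⟨fun x => ⟨x.1.1, by
      have hx : ‖(x.1.1 : EuclideanSpace ℝ (Fin p))‖ = 1 := by simp
      refine ⟨by rw [← norm_ne_zero_iff, hx]; exact one_ne_zero, ?_⟩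
      rw [hx, mul_one]
      exact x.2⟩, by fun_prop⟩
  let g : C(C, {x : Sphere p | inner ℝ (x : EuclideanSpace ℝ (Fin p)) μ ≤ s}) :=
    ⟨fun x => ⟨⟨‖x.1‖⁻¹ • x.1, by simp [norm_smul, x.2.1]⟩, by
      have hx : 0 < ‖x.1‖ := norm_pos_iff.2 x.2.1
      change inner ℝ (‖x.1‖⁻¹ • x.1) _ ≤ s
      rw [inner_smul_left, conj_trivial, inv_mul_le_iff₀ hx, mul_comm]
      exact x.2.2⟩, by
      refine Continuous.subtype_mk (Continuous.subtype_mk ?_ _) _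
      exact (continuous_subtype_val.norm.inv₀ fun x => norm_ne_zero_iff.2 x.2.1).smul
        continuous_subtype_val⟩
  refine hC.of_retract f g ?_
  have : g.comp f = ContinuousMap.id _ := by
    ext1 x
    refine Subtype.ext (Subtype.ext ?_)
    have hx : ‖(x.1.1 : EuclideanSpace ℝ (Fin p))‖ = 1 := by simp
    change ‖x.1.1‖⁻¹ • x.1.1 = x.1.1
    rw [hx, inv_one, one_smul]
  rw [this]

end Spheres

/-! ### Barcodes with at most one bar -/

section Barcodes

variable {F : Type*} [Field F] {X : Type*} [TopologicalSpace X]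

namespace Filtration

variable (𝓕 : Filtration F X) {k : ℕ}

theorem homologyClass_eq_zero_iff {r : EReal} {α : Chain F X k} (hα : α ∈ 𝓕.cyclesAt k r) :
    𝓕.homologyClass k r α hα = 0 ↔ α ∈ 𝓕.boundariesAt k r :=
  Submodule.Quotient.mk_eq_zero _

theorem mem_persistenceInterval_iff {r : EReal} {α : Chain F X k} :
    r ∈ 𝓕.persistenceInterval k α ↔ α ∈ 𝓕.cyclesAt k r ∧ α ∉ 𝓕.boundariesAt k r := by
  refine ⟨fun ⟨h, h'⟩ => ⟨h, fun hb => h' ((𝓕.homologyClass_eq_zero_iff h).2 hb)⟩,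
    fun ⟨h, h'⟩ => ⟨h, fun hb => h' ((𝓕.homologyClass_eq_zero_iff h).1 hb)⟩⟩

theorem cyclesAt_mono {r s : EReal} (h : r ≤ s) : 𝓕.cyclesAt k r ≤ 𝓕.cyclesAt k s :=
  inf_le_inf_right _ (𝓕.mono' h k)

theorem boundariesAt_mono {r s : EReal} (h : r ≤ s) : 𝓕.boundariesAt k r ≤ 𝓕.boundariesAt k s :=
  Submodule.map_mono (𝓕.mono' h (k + 1))

theorem subsingleton_homology {r : EReal} (h : 𝓕.cyclesAt k r ≤ 𝓕.boundariesAt k r) :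
    Subsingleton (𝓕.Homology k r) := by
  refine subsingleton_of_forall_eq 0 fun y => ?_
  induction y using Submodule.Quotient.induction_on with
  | H z => exact (𝓕.homologyClass_eq_zero_iff z.2).2 (h z.2)

theorem bettiBarcodeEq_empty (h : ∀ r, 𝓕.cyclesAt k r ≤ 𝓕.boundariesAt k r) :
    𝓕.BettiBarcodeEq k (fun i : Empty => i.elim) := by
  constructor
  · refine ⟨∅, fun _ => ∅, ⟨by simp, by simp, by simp, by simp, fun r => ?_⟩, by simp,
      Equiv.equivOfIsEmpty _ _, fun i => i.elim⟩
    have := 𝓕.subsingleton_homology (h r)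
    have : IsEmpty {α : Chain F X k // α ∈ (∅ : Set (Chain F X k)) ∧ r ∈ (∅ : Set EReal)} :=
      ⟨fun α => α.2.1⟩
    exact ⟨Module.Basis.empty _, fun α => isEmptyElim α⟩
  · intro S J hJ _
    have : IsEmpty S := ⟨fun ⟨α, hα⟩ => by
      obtain ⟨r, hr⟩ := hJ.nonempty α hα
      have := (𝓕.mem_persistenceInterval_iff).1 (hJ.subinterval α hα hr)
      exact this.2 (h r this.1)⟩
    exact ⟨Equiv.equivOfIsEmpty _ _, fun i => i.elim⟩

theorem exists_basis_unit {r : EReal} {α : Chain F X k} (hα : α ∈ 𝓕.cyclesAt k r)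
    (hα' : α ∉ 𝓕.boundariesAt k r)
    (h : ∀ z ∈ 𝓕.cyclesAt k r, ∃ a : F, z - a • α ∈ 𝓕.boundariesAt k r) :
    ∃ b : Module.Basis Unit F (𝓕.Homology k r), ∀ i, b i = 𝓕.homologyClass k r α hα := by
  let v : Unit → 𝓕.Homology k r := fun _ => 𝓕.homologyClass k r α hα
  have hli : LinearIndependent F v :=
    linearIndependent_unique_iff.2 fun h0 => hα' ((𝓕.homologyClass_eq_zero_iff hα).1 h0)
  have hsp : ⊤ ≤ Submodule.span F (range v) := by
    rintro y -
    induction y using Submodule.Quotient.induction_on with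
    | H z =>
      obtain ⟨a, ha⟩ := h z.1 z.2
      have h1 : 𝓕.homologyClass k r (z.1 - a • α)
          (sub_mem z.2 (Submodule.smul_mem _ a hα)) = 0 :=
        (𝓕.homologyClass_eq_zero_iff _).2 ha
      have h2 : 𝓕.homologyClass k r z.1 z.2 - a • 𝓕.homologyClass k r α hα = 0 := h1
      have h3 : Submodule.Quotient.mk z = a • v () := sub_eq_zero.1 h2
      rw [h3]
      exact Submodule.smul_mem _ _ (Submodule.subset_span ⟨(), rfl⟩)
  exact ⟨Module.Basis.mk hli hsp, fun i => by rw [Module.Basis.mk_apply]⟩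

/-- For uniqueness, every uncut bar reaches ⊤, where the homology is a line, so there is exactly one
bar; at each `r ≥ a` the homology is again a line, so this bar contains `r`. -/
theorem bettiBarcodeEq_unit {a : EReal} {α : Chain F X k}
    (h0 : ∀ r < a, 𝓕.cyclesAt k r ≤ 𝓕.boundariesAt k r)
    (h1 : ∀ r, a ≤ r → α ∈ 𝓕.cyclesAt k r ∧ α ∉ 𝓕.boundariesAt k r ∧
      ∀ z ∈ 𝓕.cyclesAt k r, ∃ c : F, z - c • α ∈ 𝓕.boundariesAt k r) :
    𝓕.BettiBarcodeEq k (fun _ : Unit => Ici a) := by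
  have hle : ∀ (r : EReal) (β : Chain F X k), r ∈ 𝓕.persistenceInterval k β → a ≤ r := by
    intro r β hr
    by_contra hlt
    rw [mem_persistenceInterval_iff] at hr
    exact hr.2 (h0 r (not_le.1 hlt) hr.1)
  have hI : 𝓕.persistenceInterval k α = Ici a := by
    ext r
    refine ⟨hle r α, fun hr => ?_⟩
    rw [mem_persistenceInterval_iff]
    exact ⟨(h1 r hr).1, (h1 r hr).2.1⟩
  constructor
  · refine ⟨{α}, fun _ => Ici a, ⟨?_, ?_, ?_, ?_, fun r => ?_⟩, ?_, Equiv.ofUnique _ _,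
      fun _ => rfl⟩
    · rintro _ rfl
      exact (h1 ⊤ le_top).1.2
    · exact fun _ _ => nonempty_Ici
    · exact fun _ _ => ordConnected_Ici
    · rintro _ rfl
      exact hI.ge
    · by_cases hr : a ≤ r
      · obtain ⟨hα, hα', h⟩ := h1 r hr
        obtain ⟨b, hb⟩ := 𝓕.exists_basis_unit hα hα' h
        let e : Unit ≃ {β : Chain F X k // β ∈ ({α} : Set (Chain F X k)) ∧ r ∈ Ici a} :=
          ⟨fun _ => ⟨α, rfl, hr⟩, fun _ => (), fun _ => rfl, fun β => Subtype.ext β.2.1.symm⟩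
        refine ⟨b.reindex e, fun ⟨β, hβ, hβr⟩ => ?_⟩
        obtain rfl : β = α := hβ
        exact ⟨hα, by rw [Module.Basis.reindex_apply, hb]⟩
      · have := 𝓕.subsingleton_homology (h0 r (not_le.1 hr))
        have : IsEmpty {β : Chain F X k // β ∈ ({α} : Set (Chain F X k)) ∧ r ∈ Ici a} :=
          ⟨fun β => hr β.2.2⟩
        exact ⟨Module.Basis.empty _, fun β => isEmptyElim β⟩
    · rintro _ rfl
      exact hI.symm
  · intro S J hJ hJI
    have htop : ∀ β ∈ S, ⊤ ∈ J β := by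
      intro β hβ
      obtain ⟨r, hr⟩ := hJ.nonempty β hβ
      rw [hJI β hβ] at hr ⊢
      obtain ⟨-, -, h⟩ := h1 r (hle r β hr)
      rw [mem_persistenceInterval_iff] at hr ⊢
      refine ⟨𝓕.cyclesAt_mono le_top hr.1, fun hb => hr.2 ?_⟩
      obtain ⟨c, hc⟩ := h β hr.1
      have h2 := sub_mem hb (𝓕.boundariesAt_mono le_top hc)
      rw [sub_sub_cancel] at h2
      -- If `c ≠ 0`, a bounding β would make the generator α bound at ⊤.
      by_cases hc0 : c = 0
      · simpa [hc0] using hc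
      · exact absurd ((Submodule.smul_mem_iff _ hc0).1 h2) (h1 ⊤ le_top).2.1
    have hequiv : ∀ r, a ≤ r → Nonempty (Unit ≃ {β : Chain F X k // β ∈ S ∧ r ∈ J β}) := by
      intro r hr
      obtain ⟨hα, hα', h⟩ := h1 r hr
      obtain ⟨b, -⟩ := 𝓕.exists_basis_unit hα hα' h
      obtain ⟨b', -⟩ := hJ.basis r
      exact ⟨b.indexEquiv b'⟩
    obtain ⟨e⟩ := hequiv ⊤ le_top
    let e' : {β : Chain F X k // β ∈ S ∧ ⊤ ∈ J β} ≃ S :=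
      ⟨fun β => ⟨β.1, β.2.1⟩, fun β => ⟨β.1, β.2, htop β.1 β.2⟩, fun _ => rfl, fun _ => rfl⟩
    refine ⟨e.trans e', fun i => ?_⟩
    ext r
    constructor
    · intro hr
      rw [hJI _ ((e.trans e') i).2] at hr
      exact hle r _ hr
    · intro hr
      obtain ⟨e2⟩ := hequiv r hr
      have : e' (e ()) = ⟨(e2 ()).1, (e2 ()).2.1⟩ := by
        rw [← e'.apply_symm_apply ⟨(e2 ()).1, (e2 ()).2.1⟩]
        congr 1
        exact e.symm.injective (Subsingleton.elim _ _)
      change r ∈ J (e' (e ())).1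
      rw [this]
      exact (e2 ()).2.2

end Filtration

/-! ### The Morse filtration -/

variable {f : X → ℝ≥0∞}

theorem morse_cyclesAt_zero (r : EReal) :
    (morseFiltration f F).cyclesAt 0 r = augOn F (sublevel f r) 1 := inf_top_eq _

/-- The class of a point lying in every nonempty sublevel set is the generator. The augmentation
shows that it does not bound and reads off the coefficient of any other 0-chain. -/
theorem morse_bettiBarcode_zero {a : EReal} {x : X} (h0 : ∀ r < a, sublevel f r = ∅)
    (hx : ∀ r, a ≤ r → x ∈ sublevel f r) (h1 : ∀ r, a ≤ r → AugAcyclic F (sublevel f r) 1) :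
    (morseFiltration f F).BettiBarcodeEq 0 (fun _ : Unit => Ici a) := by
  refine Filtration.bettiBarcodeEq_unit _ (α := Finsupp.single (ContinuousMap.const _ x) 1)
    (fun r hr => ?_) (fun r hr => ⟨?_, fun hb => ?_, fun z hz => ?_⟩)
  · rw [morse_cyclesAt_zero, h0 r hr, augOn_empty_succ]
    exact bot_le
  · rw [morse_cyclesAt_zero]
    exact Finsupp.single_mem_supported F 1 fun _ => hx r hr
  · obtain ⟨b, -, hb⟩ := hb
    have h := augBoundary_boundary 0 b
    rw [boundary_eq_augBoundary] at hb
    rw [hb, augBoundary_single_const] at h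
    simp at h
  · rw [morse_cyclesAt_zero] at hz
    obtain ⟨a, ha⟩ := exists_eq_single_of_zero (ContinuousMap.const _ x) (augBoundary F X 0 z)
    refine ⟨a, h1 r hr ⟨sub_mem hz (Submodule.smul_mem _ _
      (Finsupp.single_mem_supported F 1 fun _ => hx r hr)), ?_⟩⟩
    rw [SetLike.mem_coe, LinearMap.mem_ker, map_sub, map_smul, augBoundary_single_const, ha]
    simp

theorem morse_bettiBarcode_line {a : EReal} {k : ℕ} (hk : k ≠ 0)
    (h0 : ∀ r < a, AugAcyclic F (sublevel f r) (k + 1)) (h1 : ∀ r, a ≤ r → sublevel f r = univ)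
    (h : AugLine F (univ : Set X) (k + 1)) :
    (morseFiltration f F).BettiBarcodeEq k (fun _ : Unit => Ici a) := by
  -- In positive degrees cycles and augmented cycles agree by definition; only degree 0 sees the
  -- augmentation.
  obtain ⟨k, rfl⟩ := Nat.exists_eq_succ_of_ne_zero hk
  obtain ⟨g, hg, hg', h⟩ := h
  refine Filtration.bettiBarcodeEq_unit _ (α := g) h0 fun r hr => ?_
  have := (⟨hg, hg', h⟩ : _ ∧ _ ∧ _)
  rw [← h1 r hr] at this
  exact this

theorem morse_bettiBarcode_empty {k : ℕ} (hk : k ≠ 0)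
    (h : ∀ r, AugAcyclic F (sublevel f r) (k + 1)) :
    (morseFiltration f F).BettiBarcodeEq k (fun i : Empty => i.elim) := by
  obtain ⟨k, rfl⟩ := Nat.exists_eq_succ_of_ne_zero hk
  exact Filtration.bettiBarcodeEq_empty _ h

/-! ### The Čech filtration -/

/-- Replaces a simplex by the constant simplex at its first vertex, in one degree higher. -/
def constShift (F : Type*) [Field F] (X : Type*) [TopologicalSpace X] (j : ℕ) :
    AugChain F X (j + 1) →ₗ[F] AugChain F X (j + 2) :=
  Finsupp.lmapDomain F F fun φ => ContinuousMap.const _ (φ (stdSimplex.vertex 0))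

theorem constShift_mem_augOn {A : Set X} {j : ℕ} {c : AugChain F X (j + 1)}
    (hc : c ∈ augOn F A (j + 1)) : constShift F X j c ∈ augOn F A (j + 2) :=
  mapDomain_mem_supported (s := {φ : C(stdSimplex ℝ (Fin (j + 1)), X) | ∀ t, φ t ∈ A})
    (t := {φ : C(stdSimplex ℝ (Fin (j + 2)), X) | ∀ t, φ t ∈ A}) (fun _ hφ _ => hφ _) hc

theorem constShift_mem_constChains {k : ℕ} (c : AugChain F X (k + 1)) :
    constShift F X k c ∈ constChains F X (k + 1) :=
  mapDomain_mem_supported (s := univ)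
    (t := {φ : C(stdSimplex ℝ (Fin (k + 2)), X) | ∃ m, ∀ t, φ t = m}) (fun φ _ => ⟨_, fun _ => rfl⟩)
    (by simp [Finsupp.supported_univ])

theorem eq_const_of_forall {j : ℕ} {φ : C(stdSimplex ℝ (Fin j), X)} {m : X}
    (h : ∀ t, φ t = m) : φ = ContinuousMap.const _ m := by
  ext1 t
  exact h t

/-- For odd `k` a constant (k + 1)-simplex has an odd number k + 2 of equal faces, whose alternating
sum is one of them. -/
theorem augBoundary_constShift {k : ℕ} (hk : ¬ Even k) {c : AugChain F X (k + 1)}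
    (hc : c ∈ constChains F X k) : augBoundary F X (k + 1) (constShift F X k c) = c := by
  have h : (augBoundary F X (k + 1)).comp (constShift F X k) c - (LinearMap.id : _ →ₗ[F] _) c ∈
      (⊥ : Submodule F (AugChain F X (k + 1))) := by
    rw [← LinearMap.sub_apply]
    refine map_mem_of_mem_supported (fun φ hφ => ?_) hc
    obtain ⟨m, hm⟩ := hφ
    rw [eq_const_of_forall hm, Submodule.mem_bot, LinearMap.sub_apply, LinearMap.comp_apply,
      constShift, Finsupp.lmapDomain_apply, Finsupp.mapDomain_single, sub_eq_zero]
    refine (augBoundary_single_const m (k + 1) 1).trans ?_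
    rw [if_neg (by simpa [parity_simps] using hk)]
    rfl
  exact sub_eq_zero.1 ((Submodule.mem_bot F).1 h)

theorem constShift_augBoundary {k : ℕ} (hk : ¬ Even k) {c : AugChain F X (k + 2)}
    (hc : c ∈ constChains F X (k + 1)) : constShift F X k (augBoundary F X (k + 1) c) = c := by
  have h : (constShift F X k).comp (augBoundary F X (k + 1)) c - (LinearMap.id : _ →ₗ[F] _) c ∈
      (⊥ : Submodule F (AugChain F X (k + 2))) := by
    rw [← LinearMap.sub_apply]
    refine map_mem_of_mem_supported (fun φ hφ => ?_) hc
    obtain ⟨m, hm⟩ := hφ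
    rw [eq_const_of_forall hm, Submodule.mem_bot, LinearMap.sub_apply, LinearMap.comp_apply,
      augBoundary_single_const, if_neg (by simpa [parity_simps] using hk), constShift,
      Finsupp.lmapDomain_apply, Finsupp.mapDomain_single, sub_eq_zero]
    rfl
  exact sub_eq_zero.1 ((Submodule.mem_bot F).1 h)

theorem cech_sub_of_nonneg {r : EReal} (hr : 0 ≤ r) (k : ℕ) : (cechFiltration f F).sub r k =
    constChains F X k ⊔ chainsOn F (superlevel f (r.toENNReal)⁻¹) k :=
  if_neg (not_lt.2 hr)

theorem cech_cyclesAt_of_neg {r : EReal} (hr : r < 0) (k : ℕ) :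
    (cechFiltration f F).cyclesAt k r = ⊥ := by
  have : (cechFiltration f F).sub r k = ⊥ := if_pos hr
  rw [Filtration.cyclesAt, this, bot_inf_eq]

/-- In positive degrees, constant simplices do not contribute to the homology. -/
theorem cech_exists_sub_mem_boundariesAt {r : EReal} (hr : 0 ≤ r) {k : ℕ}
    {z : AugChain F X (k + 2)} (hz : z ∈ (cechFiltration f F).cyclesAt (k + 1) r) :
    ∃ b ∈ augCycles F (superlevel f (r.toENNReal)⁻¹) (k + 2),
      z - b ∈ (cechFiltration f F).boundariesAt (k + 1) r := by
  obtain ⟨hz, hz0⟩ := hz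
  rw [cech_sub_of_nonneg hr] at hz
  obtain ⟨a, ha, b, hb, rfl⟩ := Submodule.mem_sup.1 hz
  have hz0' : augBoundary F X (k + 1) (a + b) = 0 := hz0
  -- The degree is k + 1. If it is odd, the constant part a bounds a constant chain and can be
  -- dropped.
  by_cases hk : Even k
  · have hk' : ¬ Even (k + 1) := by simpa [parity_simps] using hk
    have h1 := augBoundary_constShift hk' ha
    refine ⟨b, ⟨hb, ?_⟩, constShift F X (k + 1) a, ?_, ?_⟩
    · rw [map_add, ← h1, augBoundary_boundary, zero_add] at hz0'
      exact hz0'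
    · rw [cech_sub_of_nonneg hr]
      exact Submodule.mem_sup_left (constShift_mem_constChains a)
    · rw [boundary_eq_augBoundary, h1, add_sub_cancel_right]
  -- If the degree is even, a is recovered from ∂a = −∂b, so its constants already lie in the
  -- superlevel set.
  · have h1 := constShift_augBoundary hk ha
    rw [map_add, add_eq_zero_iff_eq_neg] at hz0'
    have h2 : a ∈ augOn F (superlevel f (r.toENNReal)⁻¹) (k + 2) := by
      rw [← h1, hz0']
      exact constShift_mem_augOn (neg_mem (augBoundary_mem_augOn hb))
    refine ⟨a + b, ⟨add_mem h2 hb, hz0⟩, ?_⟩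
    rw [sub_self]
    exact zero_mem _

theorem augBoundaries_le_cech_boundariesAt {r : EReal} (hr : 0 ≤ r) (k : ℕ) :
    augBoundaries F (superlevel f (r.toENNReal)⁻¹) (k + 1) ≤
      (cechFiltration f F).boundariesAt k r := by
  refine Submodule.map_mono ?_
  rw [cech_sub_of_nonneg hr]
  exact le_sup_right

theorem cech_cyclesAt_le_boundariesAt {r : EReal} {k : ℕ} (hk : k ≠ 0)
    (h : 0 ≤ r → AugAcyclic F (superlevel f (r.toENNReal)⁻¹) (k + 1)) :
    (cechFiltration f F).cyclesAt k r ≤ (cechFiltration f F).boundariesAt k r := by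
  obtain ⟨k, rfl⟩ := Nat.exists_eq_succ_of_ne_zero hk
  rcases lt_or_ge r 0 with hr | hr
  · rw [cech_cyclesAt_of_neg hr]
    exact bot_le
  · intro z hz
    obtain ⟨b, hb, hzb⟩ := cech_exists_sub_mem_boundariesAt hr hz
    simpa using add_mem hzb (augBoundaries_le_cech_boundariesAt hr _ (h hr hb))

theorem cech_bettiBarcode_empty {k : ℕ} (hk : k ≠ 0)
    (h : ∀ r : EReal, 0 ≤ r → AugAcyclic F (superlevel f (r.toENNReal)⁻¹) (k + 1)) :
    (cechFiltration f F).BettiBarcodeEq k (fun i : Empty => i.elim) :=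
  Filtration.bettiBarcodeEq_empty _ fun r => cech_cyclesAt_le_boundariesAt hk (h r)

theorem cech_bettiBarcode_line {a : EReal} {k : ℕ} (hk : k ≠ 0) (ha : 0 ≤ a)
    (h0 : ∀ r < a, 0 ≤ r → AugAcyclic F (superlevel f (r.toENNReal)⁻¹) (k + 1))
    (h1 : ∀ r, a ≤ r → superlevel f (r.toENNReal)⁻¹ = univ)
    (h : AugLine F (univ : Set X) (k + 1)) :
    (cechFiltration f F).BettiBarcodeEq k (fun _ : Unit => Ici a) := by
  obtain ⟨g, hg, hg', h⟩ := h
  refine Filtration.bettiBarcodeEq_unit _ (α := g)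
    (fun r hr => cech_cyclesAt_le_boundariesAt hk (h0 r hr)) fun r hr => ?_
  have hsub (i : ℕ) : (cechFiltration f F).sub r i = ⊤ := by
    rw [cech_sub_of_nonneg (ha.trans hr), h1 r hr, chainsOn_eq_augOn, augOn_univ, sup_top_eq]
  have hb : (cechFiltration f F).boundariesAt k r = augBoundaries F univ (k + 1) := by
    rw [Filtration.boundariesAt, augBoundaries, hsub, augOn_univ]
    rfl
  have hc : (cechFiltration f F).cyclesAt k r = augCycles F univ (k + 1) := by
    obtain ⟨k, rfl⟩ := Nat.exists_eq_succ_of_ne_zero hk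
    rw [Filtration.cyclesAt, hsub, augCycles, augOn_univ]
    rfl
  rw [hb, hc]
  exact ⟨hg, hg', h⟩

end Barcodes

/-! ### Level sets of the von Mises-Fisher density -/

section LevelSets

variable {F : Type*} [Field F] {p : ℕ} {μ : Sphere p} {κ : ℝ}

theorem neg_one_le_inner_sphere (x μ : Sphere p) :
    -1 ≤ inner ℝ (x : EuclideanSpace ℝ (Fin p)) μ := by
  have := abs_real_inner_le_norm (x : EuclideanSpace ℝ (Fin p)) μ
  have hx : ‖(x : EuclideanSpace ℝ (Fin p))‖ = 1 := by simp
  have hμ : ‖(μ : EuclideanSpace ℝ (Fin p))‖ = 1 := by simp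
  rw [hx, hμ, mul_one] at this
  exact (abs_le.1 this).1

theorem inner_sphere_le_one (x μ : Sphere p) :
    inner ℝ (x : EuclideanSpace ℝ (Fin p)) μ ≤ 1 := by
  have := real_inner_le_norm (x : EuclideanSpace ℝ (Fin p)) μ
  have hx : ‖(x : EuclideanSpace ℝ (Fin p))‖ = 1 := by simp
  have hμ : ‖(μ : EuclideanSpace ℝ (Fin p))‖ = 1 := by simp
  rwa [hx, hμ, mul_one] at this

theorem exp_neg_le_exp_inner (hκ : 0 ≤ κ) (x μ : Sphere p) :
    Real.exp (-κ) ≤ Real.exp (κ * inner ℝ (x : EuclideanSpace ℝ (Fin p)) μ) :=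
  Real.exp_le_exp.2 (by nlinarith [neg_one_le_inner_sphere x μ])

theorem exp_inner_le_exp (hκ : 0 ≤ κ) (x μ : Sphere p) :
    Real.exp (κ * inner ℝ (x : EuclideanSpace ℝ (Fin p)) μ) ≤ Real.exp κ :=
  Real.exp_le_exp.2 (by nlinarith [inner_sphere_le_one x μ])

theorem mem_sublevel_vmfDensity_iff (hc : 0 < vmfConst μ κ) {r : EReal} {x : Sphere p} :
    x ∈ sublevel (vmfDensity μ κ) r ↔ ((vmfConst μ κ *
      Real.exp (κ * inner ℝ (x : EuclideanSpace ℝ (Fin p)) μ) : ℝ) : EReal) ≤ r := by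
  rw [sublevel, mem_ofPred_eq, vmfDensity, EReal.coe_ennreal_ofReal, max_eq_left]
  positivity

theorem sublevel_vmfDensity_eq_empty (hκ : 0 ≤ κ) (hc : 0 < vmfConst μ κ) {r : EReal}
    (hr : r < ((vmfConst μ κ * Real.exp (-κ) : ℝ) : EReal)) :
    sublevel (vmfDensity μ κ) r = ∅ := by
  refine eq_empty_of_forall_notMem fun x hx => ?_
  rw [mem_sublevel_vmfDensity_iff hc] at hx
  have := EReal.coe_lt_coe_iff.1 (hx.trans_lt hr)
  have := lt_of_mul_lt_mul_left this hc.le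
  exact absurd (exp_neg_le_exp_inner hκ x μ) (not_le.2 this)

theorem sublevel_vmfDensity_eq_univ (hκ : 0 ≤ κ) (hc : 0 < vmfConst μ κ) {r : EReal}
    (hr : ((vmfConst μ κ * Real.exp κ : ℝ) : EReal) ≤ r) :
    sublevel (vmfDensity μ κ) r = univ := by
  refine eq_univ_of_forall fun x => ?_
  rw [mem_sublevel_vmfDensity_iff hc]
  refine le_trans (EReal.coe_le_coe_iff.2 ?_) hr
  exact mul_le_mul_of_nonneg_left (exp_inner_le_exp hκ x μ) hc.le

theorem augAcyclic_sublevel_vmfDensity (hκ : 0 ≤ κ) (hc : 0 < vmfConst μ κ) {r : EReal}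
    (hr : r < ((vmfConst μ κ * Real.exp κ : ℝ) : EReal)) {j : ℕ} (hj : j ≠ 0) :
    AugAcyclic F (sublevel (vmfDensity μ κ) r) j := by
  rcases lt_or_ge r ((vmfConst μ κ * Real.exp (-κ) : ℝ) : EReal) with hr' | hr'
  · rw [sublevel_vmfDensity_eq_empty hκ hc hr']
    exact augAcyclic_empty hj
  · lift r to ℝ using ⟨(hr.trans_le le_top).ne, (lt_of_lt_of_le (EReal.bot_lt_coe _) hr').ne'⟩
    rw [EReal.coe_lt_coe_iff] at hr
    rw [EReal.coe_le_coe_iff] at hr'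
    -- For `κ = 0` the two bounds on `r` coincide, so the intermediate range is empty.
    have hκ' : 0 < κ := by
      refine lt_of_le_of_ne hκ fun h => ?_
      rw [← h, neg_zero] at hr'
      rw [← h] at hr
      linarith
    have hr0 : 0 < r := lt_of_lt_of_le (by positivity) hr'
    have h1 : -κ ≤ Real.log (r / vmfConst μ κ) := by
      rw [Real.le_log_iff_exp_le (by positivity), le_div_iff₀ hc, mul_comm]
      exact hr'
    have h2 : Real.log (r / vmfConst μ κ) < κ := by
      rw [Real.log_lt_iff_lt_exp (by positivity), div_lt_iff₀ hc, mul_comm]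
      exact hr
    have : sublevel (vmfDensity μ κ) r = {x : Sphere p |
        inner ℝ (x : EuclideanSpace ℝ (Fin p)) μ ≤ Real.log (r / vmfConst μ κ) / κ} := by
      ext x
      rw [mem_sublevel_vmfDensity_iff hc, EReal.coe_le_coe_iff, mem_ofPred_eq, le_div_iff₀ hκ',
        mul_comm _ κ, Real.le_log_iff_exp_le (by positivity), le_div_iff₀ hc, mul_comm]
    rw [this]
    refine augAcyclic_cap μ ?_ ?_ j
    · rw [le_div_iff₀ hκ']
      linarith
    · rwa [div_lt_one hκ']

theorem superlevel_vmfDensity_eq_univ (hκ : 0 ≤ κ) (hc : 0 < vmfConst μ κ) {t : ℝ≥0∞}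
    (ht : t ≤ ENNReal.ofReal (vmfConst μ κ * Real.exp (-κ))) :
    superlevel (vmfDensity μ κ) t = univ :=
  eq_univ_of_forall fun x => ht.trans <| ENNReal.ofReal_le_ofReal <|
    mul_le_mul_of_nonneg_left (exp_neg_le_exp_inner hκ x μ) hc.le

theorem superlevel_vmfDensity_eq_empty (hκ : 0 ≤ κ) (hc : 0 < vmfConst μ κ) {t : ℝ≥0∞}
    (ht : ENNReal.ofReal (vmfConst μ κ * Real.exp κ) < t) :
    superlevel (vmfDensity μ κ) t = ∅ := by
  refine eq_empty_of_forall_notMem fun x hx => ?_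
  refine absurd (ht.trans_le hx) (not_lt.2 (ENNReal.ofReal_le_ofReal ?_))
  exact mul_le_mul_of_nonneg_left (exp_inner_le_exp hκ x μ) hc.le

/-- A superlevel cap around μ is a sublevel cap for −μ; `t` strictly above the minimum makes it
proper. Index 0 is excluded since the set may be empty. -/
theorem augAcyclic_superlevel_vmfDensity (hκ : 0 ≤ κ) (hc : 0 < vmfConst μ κ) {t : ℝ≥0∞}
    (ht : ENNReal.ofReal (vmfConst μ κ * Real.exp (-κ)) < t) {j : ℕ} (hj : j ≠ 0) :
    AugAcyclic F (superlevel (vmfDensity μ κ) t) j := by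
  rcases lt_or_ge (ENNReal.ofReal (vmfConst μ κ * Real.exp κ)) t with ht' | ht'
  · rw [superlevel_vmfDensity_eq_empty hκ hc ht']
    exact augAcyclic_empty hj
  · obtain ⟨r, hr, rfl⟩ : ∃ r : ℝ, 0 ≤ r ∧ t = ENNReal.ofReal r :=
      ⟨t.toReal, ENNReal.toReal_nonneg,
        (ENNReal.ofReal_toReal (ht'.trans_lt ENNReal.ofReal_lt_top).ne).symm⟩
    rw [ENNReal.ofReal_lt_ofReal_iff_of_nonneg (by positivity)] at ht
    rw [ENNReal.ofReal_le_ofReal_iff (by positivity)] at ht'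
    have hκ' : 0 < κ := by
      refine lt_of_le_of_ne hκ fun h => ?_
      rw [← h, neg_zero] at ht
      rw [← h] at ht'
      linarith
    have hr0 : 0 < r := lt_of_le_of_lt (by positivity) ht
    have h1 : -κ < Real.log (r / vmfConst μ κ) := by
      rw [Real.lt_log_iff_exp_lt (by positivity), lt_div_iff₀ hc, mul_comm]
      exact ht
    have h2 : Real.log (r / vmfConst μ κ) ≤ κ := by
      rw [Real.log_le_iff_le_exp (by positivity), div_le_iff₀ hc, mul_comm]
      exact ht'
    have : superlevel (vmfDensity μ κ) (ENNReal.ofReal r) = {x : Sphere p |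
        inner ℝ (x : EuclideanSpace ℝ (Fin p)) (-μ : Sphere p) ≤
          -(Real.log (r / vmfConst μ κ) / κ)} := by
      ext x
      have hneg : ((-μ : Sphere p) : EuclideanSpace ℝ (Fin p)) = -μ := rfl
      rw [superlevel, mem_ofPred_eq, mem_ofPred_eq, vmfDensity,
        ENNReal.ofReal_le_ofReal_iff (by positivity), hneg, inner_neg_right, neg_le_neg_iff,
        div_le_iff₀ hκ', mul_comm _ κ, Real.log_le_iff_le_exp (by positivity), div_le_iff₀ hc,
        mul_comm]
    rw [this]
    refine augAcyclic_cap (-μ) ?_ ?_ j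
    · rw [neg_le_neg_iff, div_le_one hκ']
      exact h2
    · rw [neg_lt, lt_div_iff₀ hκ']
      linarith

theorem inv_toENNReal_le_iff (hc : 0 < vmfConst μ κ) {r : EReal} (hr : 0 ≤ r) :
    (r.toENNReal)⁻¹ ≤ ENNReal.ofReal (vmfConst μ κ * Real.exp (-κ)) ↔
      ((Real.exp κ / vmfConst μ κ : ℝ) : EReal) ≤ r := by
  have h : (vmfConst μ κ * Real.exp (-κ)) = (Real.exp κ / vmfConst μ κ)⁻¹ := by
    rw [Real.exp_neg, inv_div, div_eq_mul_inv]
  have hpos : 0 < Real.exp κ / vmfConst μ κ := by positivity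
  rw [h, ENNReal.ofReal_inv_of_pos hpos, ENNReal.inv_le_inv,
    ← EReal.coe_ennreal_le_coe_ennreal_iff, EReal.coe_toENNReal hr, EReal.coe_ennreal_ofReal,
    max_eq_left hpos.le]

/-- The barcodes of the Morse filtration of the von Mises-Fisher density. -/
theorem vmf_morse_barcodes (hp : 3 ≤ p) (hκ : 0 ≤ κ) (hc : 0 < vmfConst μ κ) :
    (morseFiltration (vmfDensity μ κ) F).BettiBarcodeEq 0
        (fun _ : Unit => Ici ((vmfConst μ κ * Real.exp (-κ) : ℝ) : EReal)) ∧
      (morseFiltration (vmfDensity μ κ) F).BettiBarcodeEq (p - 1)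
        (fun _ : Unit => Ici ((vmfConst μ κ * Real.exp κ : ℝ) : EReal)) ∧
      ∀ k : ℕ, k ≠ 0 → k ≠ p - 1 →
        (morseFiltration (vmfDensity μ κ) F).BettiBarcodeEq k (fun i : Empty => i.elim) := by
  have hacyc : ∀ (r : EReal) (j : ℕ), j ≠ 0 → j ≠ p →
      AugAcyclic F (sublevel (vmfDensity μ κ) r) j := by
    intro r j hj hj'
    rcases lt_or_ge r ((vmfConst μ κ * Real.exp κ : ℝ) : EReal) with hr | hr
    · exact augAcyclic_sublevel_vmfDensity hκ hc hr hj
    · rw [sublevel_vmfDensity_eq_univ hκ hc hr]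
      exact (hasSphereHomology_sphere p).1 j hj'
  have hp1 : p - 1 + 1 = p := by omega
  refine ⟨morse_bettiBarcode_zero (x := -μ) (fun r hr => sublevel_vmfDensity_eq_empty hκ hc hr)
    (fun r hr => ?_) (fun r _ => hacyc r 1 one_ne_zero (by omega)),
    morse_bettiBarcode_line (by omega)
      (fun r hr => augAcyclic_sublevel_vmfDensity hκ hc hr (Nat.succ_ne_zero _))
      (fun r hr => sublevel_vmfDensity_eq_univ hκ hc hr) ?_,
    fun k hk hk' => morse_bettiBarcode_empty hk fun r => hacyc r _ (Nat.succ_ne_zero _)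
      (by omega)⟩
  · rw [mem_sublevel_vmfDensity_iff hc]
    have hneg : ((-μ : Sphere p) : EuclideanSpace ℝ (Fin p)) = -μ := rfl
    have hμ : ‖(μ : EuclideanSpace ℝ (Fin p))‖ = 1 := by simp
    rw [hneg, inner_neg_left, real_inner_self_eq_norm_sq, hμ, one_pow, mul_neg, mul_one]
    exact hr
  · rw [hp1]
    exact (hasSphereHomology_sphere p).2

/-- The barcodes of the Čech filtration of the von Mises-Fisher density. -/
theorem vmf_cech_barcodes (hp : 3 ≤ p) (hκ : 0 ≤ κ) (hc : 0 < vmfConst μ κ) :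
    (cechFiltration (vmfDensity μ κ) F).BettiBarcodeEq (p - 1)
        (fun _ : Unit => Ici ((Real.exp κ / vmfConst μ κ : ℝ) : EReal)) ∧
      ∀ k : ℕ, 1 ≤ k → k ≠ p - 1 →
        (cechFiltration (vmfDensity μ κ) F).BettiBarcodeEq k (fun i : Empty => i.elim) := by
  have hp1 : p - 1 + 1 = p := by omega
  constructor
  · refine cech_bettiBarcode_line (by omega) ?_ (fun r hr hr0 => ?_) (fun r hr => ?_) ?_
    · exact_mod_cast (by positivity : 0 ≤ Real.exp κ / vmfConst μ κ)
    · refine augAcyclic_superlevel_vmfDensity hκ hc ?_ (Nat.succ_ne_zero _)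
      rw [← not_le, inv_toENNReal_le_iff hc hr0]
      exact not_le.2 hr
    · refine superlevel_vmfDensity_eq_univ hκ hc ((inv_toENNReal_le_iff hc ?_).2 hr)
      refine le_trans ?_ hr
      exact_mod_cast (by positivity : 0 ≤ Real.exp κ / vmfConst μ κ)
    · rw [hp1]
      exact (hasSphereHomology_sphere p).2
  · intro k hk hk'
    refine cech_bettiBarcode_empty (by omega) fun r hr => ?_
    rcases le_or_gt (r.toENNReal)⁻¹ (ENNReal.ofReal (vmfConst μ κ * Real.exp (-κ))) with h | h
    · rw [superlevel_vmfDensity_eq_univ hκ hc h]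
      exact (hasSphereHomology_sphere p).1 _ (by omega)
    · exact augAcyclic_superlevel_vmfDensity hκ hc h (Nat.succ_ne_zero _)

end LevelSets

/-! ### Integration over the sphere of functions of one coordinate -/

section Slices

/-- Integration in polar coordinates. -/
theorem lintegral_eq_lintegral_toSphere {E : Type*} [NormedAddCommGroup E] [NormedSpace ℝ E]
    [FiniteDimensional ℝ E] [Nontrivial E] [MeasurableSpace E] [BorelSpace E] (ν : Measure E)
    [ν.IsAddHaarMeasure] {Φ : E → ℝ≥0∞} (hΦ : Measurable Φ) :
    ∫⁻ x, Φ x ∂ν = ∫⁻ ω, (∫⁻ r in Ioi (0 : ℝ),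
      ENNReal.ofReal (r ^ (Module.finrank ℝ E - 1)) * Φ (r • (ω : E))) ∂ν.toSphere := by
  have hmp := (ν.measurePreserving_homeomorphUnitSphereProd).symm
    (homeomorphUnitSphereProd E).toMeasurableEquiv
  have h1 := hmp.lintegral_comp_emb
    ((homeomorphUnitSphereProd E).toMeasurableEquiv.symm.measurableEmbedding)
    (fun x : ({0}ᶜ : Set E) => Φ x)
  have hΦ' : Measurable fun q : Metric.sphere (0 : E) 1 × Ioi (0 : ℝ) => Φ (q.2.1 • q.1.1) :=
    hΦ.comp (by fun_prop)
  calc ∫⁻ x, Φ x ∂ν = ∫⁻ x in {0}ᶜ, Φ x ∂ν := by rw [restrict_compl_singleton]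
    _ = ∫⁻ x : ({0}ᶜ : Set E), Φ x ∂ν.comap (↑) :=
      (lintegral_subtype_comap (measurableSet_singleton _).compl _).symm
    _ = ∫⁻ q : Metric.sphere (0 : E) 1 × Ioi (0 : ℝ), Φ (q.2.1 • q.1.1)
        ∂(ν.toSphere.prod (Measure.volumeIoiPow (Module.finrank ℝ E - 1))) := by
      rw [← h1]
      rfl
    _ = _ := by
      rw [lintegral_prod _ hΦ'.aemeasurable]
      refine lintegral_congr fun ω => ?_
      have hm : Measurable fun r : Ioi (0 : ℝ) => Φ (r.1 • (ω : E)) := hΦ.comp (by fun_prop)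
      rw [Measure.volumeIoiPow]
      refine (lintegral_withDensity_eq_lintegral_mul _ (by fun_prop) hm).trans ?_
      exact lintegral_subtype_comap measurableSet_Ioi
        (fun r : ℝ => ENNReal.ofReal (r ^ (Module.finrank ℝ E - 1)) * Φ (r • (ω : E)))

theorem lintegral_fun_norm {E : Type*} [NormedAddCommGroup E] [NormedSpace ℝ E]
    [FiniteDimensional ℝ E] [Nontrivial E] [MeasurableSpace E] [BorelSpace E] (ν : Measure E)
    [ν.IsAddHaarMeasure] {Φ : ℝ → ℝ≥0∞} (hΦ : Measurable Φ) :
    ∫⁻ x, Φ ‖x‖ ∂ν = ν.toSphere univ * ∫⁻ r in Ioi (0 : ℝ),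
      ENNReal.ofReal (r ^ (Module.finrank ℝ E - 1)) * Φ r := by
  rw [lintegral_eq_lintegral_toSphere ν (Φ := fun x => Φ ‖x‖) (hΦ.comp measurable_norm)]
  have h (ω : Metric.sphere (0 : E) 1) : ∫⁻ r in Ioi (0 : ℝ),
      ENNReal.ofReal (r ^ (Module.finrank ℝ E - 1)) * Φ ‖r • (ω : E)‖ =
      ∫⁻ r in Ioi (0 : ℝ), ENNReal.ofReal (r ^ (Module.finrank ℝ E - 1)) * Φ r := by
    refine setLIntegral_congr_fun measurableSet_Ioi fun r hr => ?_
    have hω : ‖(ω : E)‖ = 1 := by simp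
    simp only [norm_smul, hω, mul_one, Real.norm_of_nonneg (le_of_lt (mem_Ioi.1 hr))]
  simp only [h, lintegral_const]
  rw [mul_comm]

/-- Euclidean space splits as the product of a line and a Euclidean space of lower dimension. -/
theorem exists_linearIsometryEquiv_prod (n : ℕ) {v : EuclideanSpace ℝ (Fin (n + 1))}
    (hv : ‖v‖ = 1) :
    ∃ e : EuclideanSpace ℝ (Fin (n + 1)) ≃ₗᵢ[ℝ] WithLp 2 (ℝ × EuclideanSpace ℝ (Fin n)),
      ∀ x, inner ℝ x v = (e x).fst := by
  -- Completing a unit vector to an orthonormal basis on both sides gives an isometry taking v to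
  -- the unit vector of the line.
  have hext {G : Type} [NormedAddCommGroup G] [InnerProductSpace ℝ G] [FiniteDimensional ℝ G]
      (hG : Module.finrank ℝ G = n + 1) {w : G} (hw : ‖w‖ = 1) :
      ∃ b : OrthonormalBasis (Fin (n + 1)) ℝ G, b 0 = w := by
    obtain ⟨b, hb⟩ := Orthonormal.exists_orthonormalBasis_extension_of_card_eq (𝕜 := ℝ)
      (v := fun _ : Fin (n + 1) => w) (s := {0}) (by simp [hG])
      ⟨fun _ => hw, fun i j hij => absurd (Subsingleton.elim i j) hij⟩
    exact ⟨b, hb 0 rfl⟩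
  let w : WithLp 2 (ℝ × EuclideanSpace ℝ (Fin n)) := WithLp.toLp 2 (1, 0)
  have hw : ‖w‖ = 1 := by simp [w]
  obtain ⟨b, hb⟩ := hext (by simp) hv
  obtain ⟨b', hb'⟩ := hext (G := WithLp 2 (ℝ × EuclideanSpace ℝ (Fin n)))
    (by
      rw [(WithLp.linearEquiv 2 ℝ (ℝ × EuclideanSpace ℝ (Fin n))).finrank_eq]
      simp [add_comm]) hw
  let e := b.equiv b' (Equiv.refl _)
  have he : e v = w := by rw [← hb, ← hb', OrthonormalBasis.equiv_apply_basis]; rfl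
  refine ⟨e, fun x => ?_⟩
  rw [← e.inner_map_map, he, WithLp.prod_inner_apply]
  simp [w]

/-- Integration of a function of one coordinate and of the norm. -/
theorem lintegral_inner_norm (n : ℕ) {v : EuclideanSpace ℝ (Fin (n + 2))} (hv : ‖v‖ = 1)
    {H : ℝ × ℝ → ℝ≥0∞} (hH : Measurable H) :
    ∫⁻ x : EuclideanSpace ℝ (Fin (n + 2)), H (inner ℝ x v, ‖x‖) =
      (volume : Measure (EuclideanSpace ℝ (Fin (n + 1)))).toSphere univ *
        ∫⁻ r in Ioi (0 : ℝ), ∫⁻ θ in Ioo 0 Real.pi,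
          ENNReal.ofReal (r ^ (n + 1)) * ENNReal.ofReal (Real.sin θ ^ n) *
            H (r * Real.cos θ, r) := by
  obtain ⟨e, he⟩ := exists_linearIsometryEquiv_prod (n + 1) hv
  let S := (volume : Measure (EuclideanSpace ℝ (Fin (n + 1)))).toSphere univ
  have h1 : ∫⁻ x : EuclideanSpace ℝ (Fin (n + 2)), H (inner ℝ x v, ‖x‖) =
      ∫⁻ q : ℝ × EuclideanSpace ℝ (Fin (n + 1)), H (q.1, Real.sqrt (q.1 ^ 2 + ‖q.2‖ ^ 2)) := by
    have hmp := (WithLp.volume_preserving_ofLp ℝ (EuclideanSpace ℝ (Fin (n + 1)))).comp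
      e.measurePreserving
    have hm : Measurable fun q : ℝ × EuclideanSpace ℝ (Fin (n + 1)) =>
        H (q.1, Real.sqrt (q.1 ^ 2 + ‖q.2‖ ^ 2)) := hH.comp (by fun_prop)
    rw [← hmp.lintegral_comp hm]
    refine lintegral_congr fun x => ?_
    rw [he, ← e.norm_map, WithLp.prod_norm_eq_of_L2]
    simp [WithLp.ofLp_fst, WithLp.ofLp_snd]
  have h2 : ∫⁻ q : ℝ × EuclideanSpace ℝ (Fin (n + 1)), H (q.1, Real.sqrt (q.1 ^ 2 + ‖q.2‖ ^ 2)) =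
      ∫⁻ t : ℝ, S * ∫⁻ ρ in Ioi (0 : ℝ),
        ENNReal.ofReal (ρ ^ n) * H (t, Real.sqrt (t ^ 2 + ρ ^ 2)) := by
    have hm : Measurable fun q : ℝ × EuclideanSpace ℝ (Fin (n + 1)) =>
        H (q.1, Real.sqrt (q.1 ^ 2 + ‖q.2‖ ^ 2)) := hH.comp (by fun_prop)
    rw [Measure.volume_eq_prod, lintegral_prod _ hm.aemeasurable]
    refine lintegral_congr fun t => ?_
    have := lintegral_fun_norm (volume : Measure (EuclideanSpace ℝ (Fin (n + 1))))
      (Φ := fun ρ => H (t, Real.sqrt (t ^ 2 + ρ ^ 2))) (hH.comp (by fun_prop))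
    rw [this]
    simp [S]
  -- The pair (height, distance from the axis) ranges over the upper half plane; planar polar
  -- coordinates then run over θ in (0, π), with the Jacobian r and ρⁿ combining to rⁿ⁺¹ sinⁿ θ.
  let K : ℝ × ℝ → ℝ≥0∞ := (univ ×ˢ Ioi (0 : ℝ)).indicator fun q =>
    ENNReal.ofReal (q.2 ^ n) * H (q.1, Real.sqrt (q.1 ^ 2 + q.2 ^ 2))
  have hK0 : Measurable fun q : ℝ × ℝ =>
      ENNReal.ofReal (q.2 ^ n) * H (q.1, Real.sqrt (q.1 ^ 2 + q.2 ^ 2)) :=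
    Measurable.mul (by fun_prop) (hH.comp (by fun_prop))
  have hK : Measurable K := hK0.indicator (MeasurableSet.univ.prod measurableSet_Ioi)
  have h3 : ∫⁻ t : ℝ, S * ∫⁻ ρ in Ioi (0 : ℝ),
        ENNReal.ofReal (ρ ^ n) * H (t, Real.sqrt (t ^ 2 + ρ ^ 2)) = S * ∫⁻ q, K q := by
    rw [lintegral_const_mul' _ _ (measure_ne_top _ _), Measure.volume_eq_prod,
      lintegral_prod _ hK.aemeasurable]
    congr 1
    refine lintegral_congr fun t => ?_
    rw [← lintegral_indicator measurableSet_Ioi]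
    refine lintegral_congr fun ρ => ?_
    simp [K, indicator]
  have h4 : ∫⁻ q, K q = ∫⁻ r in Ioi (0 : ℝ), ∫⁻ θ in Ioo 0 Real.pi,
      ENNReal.ofReal (r ^ (n + 1)) * ENNReal.ofReal (Real.sin θ ^ n) *
        H (r * Real.cos θ, r) := by
    rw [← lintegral_comp_polarCoord_symm]
    have hm : Measurable fun q : ℝ × ℝ => ENNReal.ofReal q.1 • K (polarCoord.symm q) := by
      simp only [polarCoord_symm_apply, smul_eq_mul]
      exact Measurable.mul (by fun_prop) (hK.comp (by fun_prop))
    rw [polarCoord_target, Measure.volume_eq_prod, ← Measure.prod_restrict,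
      lintegral_prod _ hm.aemeasurable]
    refine setLIntegral_congr_fun measurableSet_Ioi fun r hr => ?_
    have hr : 0 < r := hr
    have hsub : Ioo 0 Real.pi ⊆ Ioo (-Real.pi) Real.pi :=
      Ioo_subset_Ioo_left (by linarith [Real.pi_pos])
    rw [← inter_eq_left.2 hsub, ← setLIntegral_indicator measurableSet_Ioo]
    refine setLIntegral_congr_fun measurableSet_Ioo fun θ hθ => ?_
    simp only [polarCoord_symm_apply, K]
    by_cases h0 : 0 < θ
    · have hmem : θ ∈ Ioo 0 Real.pi := ⟨h0, hθ.2⟩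
      have hs : 0 < Real.sin θ := Real.sin_pos_of_mem_Ioo hmem
      rw [indicator_of_mem hmem, indicator_of_mem (by simp [mul_pos hr hs])]
      have hsq : Real.sqrt ((r * Real.cos θ) ^ 2 + (r * Real.sin θ) ^ 2) = r := by
        rw [mul_pow, mul_pow, ← mul_add, Real.cos_sq_add_sin_sq, mul_one, Real.sqrt_sq hr.le]
      simp only [hsq, smul_eq_mul]
      rw [← mul_assoc, ← ENNReal.ofReal_mul hr.le, ← ENNReal.ofReal_mul (by positivity)]
      congr 2
      ring
    · rw [indicator_of_notMem (s := univ ×ˢ Ioi (0 : ℝ)),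
        indicator_of_notMem (s := Ioo 0 Real.pi) (fun h => h0 h.1), smul_zero]
      simp only [mem_prod, mem_univ, mem_Ioi, true_and, not_lt]
      exact mul_nonpos_of_nonneg_of_nonpos hr.le
        (Real.sin_nonpos_of_nonpos_of_neg_pi_le (not_lt.1 h0) hθ.1.le)
  rw [h1, h2, h3, h4]

/-- One integral over Euclidean space is computed twice, by spherical polar coordinates and by
`lintegral_inner_norm`; the spherical integral is found by comparison. -/
theorem lintegral_toSphere_inner (n : ℕ) {v : EuclideanSpace ℝ (Fin (n + 2))} (hv : ‖v‖ = 1)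
    {h : ℝ → ℝ≥0∞} (hh : Measurable h) :
    ∫⁻ ω, h (inner ℝ (ω : EuclideanSpace ℝ (Fin (n + 2))) v)
        ∂(volume : Measure (EuclideanSpace ℝ (Fin (n + 2)))).toSphere =
      (volume : Measure (EuclideanSpace ℝ (Fin (n + 1)))).toSphere univ *
        ∫⁻ θ in Ioo 0 Real.pi, ENNReal.ofReal (Real.sin θ ^ n) * h (Real.cos θ) := by
  let W : ℝ≥0∞ := ∫⁻ r in Ioi (0 : ℝ), ENNReal.ofReal (r ^ (n + 1)) * (Iio 1).indicator 1 r
  have hW : W = ENNReal.ofReal (1 / (n + 2)) := by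
    have h1 : W = ∫⁻ r in Ioc (0 : ℝ) 1, ENNReal.ofReal (r ^ (n + 1)) := by
      rw [← restrict_Ioo_eq_restrict_Ioc, ← Iio_inter_Ioi,
        ← setLIntegral_indicator measurableSet_Iio]
      refine lintegral_congr fun r => ?_
      by_cases hr : r ∈ Iio (1 : ℝ) <;> simp [hr]
    rw [h1, ← ofReal_integral_eq_lintegral_ofReal
      (intervalIntegral.intervalIntegrable_pow (n + 1)).1, ← intervalIntegral.integral_of_le
      zero_le_one]
    · rw [integral_pow]
      congr 1
      push_cast
      norm_num
      ring
    · filter_upwards [ae_restrict_mem measurableSet_Ioc] with y hy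
      exact pow_nonneg hy.1.le _
  have hW0 : W ≠ 0 := by
    rw [hW]
    exact (ENNReal.ofReal_pos.2 (by positivity)).ne'
  have hWt : W ≠ ⊤ := by
    rw [hW]
    exact ENNReal.ofReal_ne_top
  have hind : Measurable ((Iio (1 : ℝ)).indicator (1 : ℝ → ℝ≥0∞)) :=
    measurable_one.indicator measurableSet_Iio
  -- Extending h to be constant on rays and cutting off at the unit ball makes both radial integrals
  -- equal to `W`, which is finite and nonzero and cancels.
  let H : ℝ × ℝ → ℝ≥0∞ := fun q => h (q.1 / q.2) * (Iio (1 : ℝ)).indicator 1 q.2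
  have hH : Measurable H :=
    (hh.comp (measurable_fst.div measurable_snd)).mul (hind.comp measurable_snd)
  have hmeas : Measurable fun ω : Sphere (n + 2) =>
      h (inner ℝ (ω : EuclideanSpace ℝ (Fin (n + 2))) v) := hh.comp (by fun_prop)
  have hmeas' : Measurable fun θ : ℝ => ENNReal.ofReal (Real.sin θ ^ n) * h (Real.cos θ) :=
    Measurable.mul (by fun_prop) (hh.comp (by fun_prop))
  have h1 := lintegral_inner_norm n hv hH
  have h2 := lintegral_eq_lintegral_toSphere (volume : Measure (EuclideanSpace ℝ (Fin (n + 2))))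
    (Φ := fun x => H (inner ℝ x v, ‖x‖)) (hH.comp (by fun_prop))
  rw [h2] at h1
  have h3 : ∀ ω : Sphere (n + 2), ∫⁻ r in Ioi (0 : ℝ), ENNReal.ofReal
      (r ^ (Module.finrank ℝ (EuclideanSpace ℝ (Fin (n + 2))) - 1)) *
      H (inner ℝ (r • (ω : EuclideanSpace ℝ (Fin (n + 2)))) v,
        ‖r • (ω : EuclideanSpace ℝ (Fin (n + 2)))‖) =
      h (inner ℝ (ω : EuclideanSpace ℝ (Fin (n + 2))) v) * W := by
    intro ω
    rw [← lintegral_const_mul _ (by fun_prop)]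
    refine setLIntegral_congr_fun measurableSet_Ioi fun r hr => ?_
    have hr : 0 < r := hr
    have hω : ‖(ω : EuclideanSpace ℝ (Fin (n + 2)))‖ = 1 := by simp
    simp only [H, norm_smul, hω, mul_one, Real.norm_of_nonneg hr.le, inner_smul_left, conj_trivial,
      mul_div_cancel_left₀ _ hr.ne', finrank_euclideanSpace_fin]
    rw [Nat.add_sub_assoc (by norm_num), mul_left_comm]
  have h4 : ∫⁻ r in Ioi (0 : ℝ), ∫⁻ θ in Ioo 0 Real.pi,
      ENNReal.ofReal (r ^ (n + 1)) * ENNReal.ofReal (Real.sin θ ^ n) * H (r * Real.cos θ, r) =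
      (∫⁻ θ in Ioo 0 Real.pi, ENNReal.ofReal (Real.sin θ ^ n) * h (Real.cos θ)) * W := by
    rw [← lintegral_const_mul _ (by fun_prop)]
    refine setLIntegral_congr_fun measurableSet_Ioi fun r hr => ?_
    have hr : 0 < r := hr
    rw [← lintegral_mul_const _ hmeas']
    refine lintegral_congr fun θ => ?_
    simp only [H, mul_div_cancel_left₀ _ hr.ne']
    ring
  simp only [h3] at h1
  rw [h4, lintegral_mul_const _ hmeas, ← mul_assoc] at h1
  exact (ENNReal.mul_left_inj hW0 hWt).1 h1

/-! ### Sphere areas and the uniform measure. -/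

theorem toSphere_univ_eq (n : ℕ) :
    (volume : Measure (EuclideanSpace ℝ (Fin (n + 1)))).toSphere univ =
      ENNReal.ofReal (sphereArea n) := by
  rw [Measure.toSphere_apply_univ, EuclideanSpace.volume_ball, finrank_euclideanSpace_fin,
    Fintype.card_fin, ENNReal.ofReal_one, one_pow, one_mul, ← ENNReal.ofReal_natCast,
    ← ENNReal.ofReal_mul (by positivity), sphereArea]
  congr 1
  have hn : ((n : ℝ) + 1) / 2 ≠ 0 := by positivity
  have hΓ : Real.Gamma (((n : ℝ) + 1) / 2) ≠ 0 := (Real.Gamma_pos_of_pos (by positivity)).ne'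
  have hpi : Real.sqrt Real.pi ^ (n + 1) = Real.pi ^ (((n : ℝ) + 1) / 2) := by
    rw [Real.sqrt_eq_rpow, ← Real.rpow_natCast, ← Real.rpow_mul Real.pi_pos.le]
    congr 1
    push_cast
    ring
  push_cast
  rw [Real.Gamma_add_one hn, hpi]
  field_simp

theorem sphereArea_pos (n : ℕ) : 0 < sphereArea n := by
  have := Real.Gamma_pos_of_pos (s := ((n : ℝ) + 1) / 2) (by positivity)
  have := Real.pi_pos
  rw [sphereArea]
  positivity

instance isProbabilityMeasure_uniformMeasure (n : ℕ) :
    IsProbabilityMeasure (uniformMeasure (n + 1)) := by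
  constructor
  rw [uniformMeasure, Measure.smul_apply, smul_eq_mul, ENNReal.inv_mul_cancel]
  · rw [toSphere_univ_eq]
    exact (ENNReal.ofReal_pos.2 (sphereArea_pos n)).ne'
  · exact measure_ne_top _ _

/-- The distribution of one coordinate under the uniform measure of the sphere. -/
theorem lintegral_uniformMeasure_inner (n : ℕ) (μ : Sphere (n + 2)) {h : ℝ → ℝ≥0∞}
    (hh : Measurable h) :
    ∫⁻ x, h (inner ℝ (x : EuclideanSpace ℝ (Fin (n + 2))) μ) ∂uniformMeasure (n + 2) =
      ENNReal.ofReal (sphereArea n / sphereArea (n + 1)) *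
        ∫⁻ θ in Ioo 0 Real.pi, ENNReal.ofReal (Real.sin θ ^ n) * h (Real.cos θ) := by
  rw [uniformMeasure, lintegral_smul_measure, lintegral_toSphere_inner n (by simp) hh,
    toSphere_univ_eq, toSphere_univ_eq, smul_eq_mul, ← mul_assoc,
    ENNReal.ofReal_div_of_pos (sphereArea_pos _), ENNReal.div_eq_inv_mul]

end Slices

/-! ### The mass of superlevel sets -/

section Mass

variable {n : ℕ} {μ : Sphere (n + 2)} {κ : ℝ}

/-- The integral `∫_0^t e^{κ cos θ} sin^n θ dθ`. -/
def capIntegral (n : ℕ) (κ t : ℝ) : ℝ :=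
  ∫ θ in (0 : ℝ)..t, Real.exp (κ * Real.cos θ) * Real.sin θ ^ n

theorem capMass_eq (μ : Sphere (n + 2)) (κ t : ℝ) : capMass μ κ t =
    vmfConst μ κ * (sphereArea n / sphereArea (n + 1)) * capIntegral n κ t := rfl

theorem continuous_capIntegrand (n : ℕ) (κ : ℝ) :
    Continuous fun θ => Real.exp (κ * Real.cos θ) * Real.sin θ ^ n := by fun_prop

theorem continuous_capIntegral (n : ℕ) (κ : ℝ) : Continuous (capIntegral n κ) :=
  intervalIntegral.continuous_primitive
    (fun a b => (continuous_capIntegrand n κ).intervalIntegrable a b) 0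

theorem strictMonoOn_capIntegral (n : ℕ) (κ : ℝ) :
    StrictMonoOn (capIntegral n κ) (Icc 0 Real.pi) := by
  intro a ha b hb hab
  have hi (a b : ℝ) := (continuous_capIntegrand n κ).intervalIntegrable (μ := volume) a b
  have h := intervalIntegral.integral_add_adjacent_intervals (hi 0 a) (hi a b)
  have hpos : 0 < ∫ θ in a..b, Real.exp (κ * Real.cos θ) * Real.sin θ ^ n := by
    refine intervalIntegral.intervalIntegral_pos_of_pos_on (hi a b) (fun θ hθ => ?_) hab
    have := Real.sin_pos_of_pos_of_lt_pi (ha.1.trans_lt hθ.1) (hθ.2.trans_le hb.2)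
    positivity
  rw [capIntegral, capIntegral, ← h]
  linarith

theorem capIntegral_zero (n : ℕ) (κ : ℝ) : capIntegral n κ 0 = 0 :=
  intervalIntegral.integral_same

theorem capIntegral_pi_pos (n : ℕ) (κ : ℝ) : 0 < capIntegral n κ Real.pi := by
  rw [← capIntegral_zero n κ]
  exact strictMonoOn_capIntegral n κ ⟨le_rfl, Real.pi_pos.le⟩ ⟨Real.pi_pos.le, le_rfl⟩ Real.pi_pos

theorem lintegral_Ioc_capIntegrand {t : ℝ} (ht : t ∈ Icc 0 Real.pi) :
    ∫⁻ θ in Ioc 0 t, ENNReal.ofReal (Real.sin θ ^ n) * ENNReal.ofReal (Real.exp (κ * Real.cos θ)) =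
      ENNReal.ofReal (capIntegral n κ t) := by
  rw [capIntegral, intervalIntegral.integral_of_le ht.1, ofReal_integral_eq_lintegral_ofReal]
  · refine setLIntegral_congr_fun measurableSet_Ioc fun θ _ => ?_
    rw [ENNReal.ofReal_mul (Real.exp_pos _).le, mul_comm]
  · exact ((continuous_capIntegrand n κ).intervalIntegrable 0 t).1
  · filter_upwards [ae_restrict_mem measurableSet_Ioc] with θ hθ
    have := Real.sin_nonneg_of_nonneg_of_le_pi hθ.1.le (hθ.2.trans ht.2)
    change 0 ≤ Real.exp (κ * Real.cos θ) * Real.sin θ ^ n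
    positivity

theorem inv_vmfConst (μ : Sphere (n + 2)) (κ : ℝ) : (vmfConst μ κ)⁻¹ =
    sphereArea n / sphereArea (n + 1) * capIntegral n κ Real.pi := by
  have hpos : 0 ≤ sphereArea n / sphereArea (n + 1) :=
    (div_pos (sphereArea_pos _) (sphereArea_pos _)).le
  have h := lintegral_uniformMeasure_inner n μ (h := fun a => ENNReal.ofReal (Real.exp (κ * a)))
    (by fun_prop)
  rw [vmfConst, inv_inv, integral_eq_lintegral_of_nonneg_ae
    (Filter.Eventually.of_forall fun x => (Real.exp_pos _).le)
    (Continuous.aestronglyMeasurable (by fun_prop)), h, restrict_Ioo_eq_restrict_Ioc,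
    lintegral_Ioc_capIntegrand ⟨Real.pi_pos.le, le_rfl⟩, ← ENNReal.ofReal_mul hpos,
    ENNReal.toReal_ofReal (mul_nonneg hpos (capIntegral_pi_pos n κ).le)]

theorem vmfConst_pos (μ : Sphere (n + 2)) (κ : ℝ) : 0 < vmfConst μ κ := by
  rw [← inv_pos, inv_vmfConst]
  exact mul_pos (div_pos (sphereArea_pos _) (sphereArea_pos _)) (capIntegral_pi_pos n κ)

theorem capMass_zero (μ : Sphere (n + 2)) (κ : ℝ) : capMass μ κ 0 = 0 := by
  rw [capMass_eq, capIntegral_zero, mul_zero]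

theorem capMass_pi (μ : Sphere (n + 2)) (κ : ℝ) : capMass μ κ Real.pi = 1 := by
  rw [capMass_eq, mul_assoc, ← inv_vmfConst, mul_inv_cancel₀ (vmfConst_pos μ κ).ne']

theorem continuous_capMass (μ : Sphere (n + 2)) (κ : ℝ) : Continuous (capMass μ κ) :=
  (continuous_capIntegral n κ).const_mul _

theorem strictMonoOn_capMass (μ : Sphere (n + 2)) (κ : ℝ) :
    StrictMonoOn (capMass μ κ) (Icc 0 Real.pi) := fun _ ha _ hb hab =>
  mul_lt_mul_of_pos_left (strictMonoOn_capIntegral n κ ha hb hab)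
    (mul_pos (vmfConst_pos μ κ) (div_pos (sphereArea_pos _) (sphereArea_pos _)))

theorem capMass_mem_Icc (μ : Sphere (n + 2)) (κ : ℝ) {t : ℝ} (ht : t ∈ Icc 0 Real.pi) :
    capMass μ κ t ∈ Icc 0 1 := by
  rw [← capMass_zero μ κ, ← capMass_pi μ κ]
  have h := (strictMonoOn_capMass μ κ).monotoneOn
  exact ⟨h ⟨le_rfl, Real.pi_pos.le⟩ ht ht.1, h ht ⟨Real.pi_pos.le, le_rfl⟩ ht.2⟩

/-- The mass of a spherical cap. -/
theorem lintegral_cap_vmfDensity (μ : Sphere (n + 2)) (κ : ℝ) {t : ℝ} (ht : t ∈ Icc 0 Real.pi) :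
    ∫⁻ x in {x : Sphere (n + 2) |
        Real.cos t ≤ inner ℝ (x : EuclideanSpace ℝ (Fin (n + 2))) μ},
      vmfDensity μ κ x ∂uniformMeasure (n + 2) = ENNReal.ofReal (capMass μ κ t) := by
  have hc := vmfConst_pos μ κ
  have hpos : 0 ≤ sphereArea n / sphereArea (n + 1) :=
    (div_pos (sphereArea_pos _) (sphereArea_pos _)).le
  let h : ℝ → ℝ≥0∞ := (Ici (Real.cos t)).indicator fun a =>
    ENNReal.ofReal (vmfConst μ κ * Real.exp (κ * a))
  have hh : Measurable h := Measurable.indicator (by fun_prop) measurableSet_Ici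
  have hS : MeasurableSet {x : Sphere (n + 2) |
      Real.cos t ≤ inner ℝ (x : EuclideanSpace ℝ (Fin (n + 2))) μ} :=
    measurableSet_le measurable_const (by fun_prop)
  rw [← lintegral_indicator hS]
  have h1 : ∀ x, {x : Sphere (n + 2) |
      Real.cos t ≤ inner ℝ (x : EuclideanSpace ℝ (Fin (n + 2))) μ}.indicator (vmfDensity μ κ) x =
      h (inner ℝ (x : EuclideanSpace ℝ (Fin (n + 2))) μ) := fun x => by
    simp only [h, indicator, mem_ofPred_eq, mem_Ici]
    rfl
  rw [lintegral_congr h1, lintegral_uniformMeasure_inner n μ hh, restrict_Ioo_eq_restrict_Ioc]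
  have h2 : ∫⁻ θ in Ioc 0 Real.pi, ENNReal.ofReal (Real.sin θ ^ n) * h (Real.cos θ) =
      ∫⁻ θ in Ioc 0 t, ENNReal.ofReal (vmfConst μ κ) * (ENNReal.ofReal (Real.sin θ ^ n) *
        ENNReal.ofReal (Real.exp (κ * Real.cos θ))) := by
    have hinter : Iic t ∩ Ioc 0 Real.pi = Ioc 0 t := by
      ext θ
      simp only [mem_inter_iff, mem_Iic, mem_Ioc]
      exact ⟨fun h => ⟨h.2.1, h.1⟩, fun h => ⟨h.2, h.1, h.2.trans ht.2⟩⟩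
    rw [← hinter, ← setLIntegral_indicator measurableSet_Iic]
    refine setLIntegral_congr_fun measurableSet_Ioc fun θ hθ => ?_
    -- The cosine decreases on [0, π], so the height condition is an angle condition.
    have hiff : Real.cos t ≤ Real.cos θ ↔ θ ≤ t :=
      Real.strictAntiOn_cos.le_iff_ge ht ⟨hθ.1.le, hθ.2⟩
    simp only [h, indicator, mem_Ici, mem_Iic, hiff]
    split_ifs
    · rw [ENNReal.ofReal_mul hc.le]
      ring
    · rw [mul_zero]
  rw [h2, lintegral_const_mul _ (by fun_prop), lintegral_Ioc_capIntegrand ht,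
    ← ENNReal.ofReal_mul hc.le, ← ENNReal.ofReal_mul hpos, capMass_eq]
  congr 1
  ring

theorem lintegral_vmfDensity (μ : Sphere (n + 2)) (κ : ℝ) :
    ∫⁻ x, vmfDensity μ κ x ∂uniformMeasure (n + 2) = 1 := by
  have h := lintegral_cap_vmfDensity μ κ (t := Real.pi) ⟨Real.pi_pos.le, le_rfl⟩
  have huniv : {x : Sphere (n + 2) |
      Real.cos Real.pi ≤ inner ℝ (x : EuclideanSpace ℝ (Fin (n + 2))) μ} = univ := by
    refine eq_univ_of_forall fun x => ?_
    rw [mem_ofPred_eq, Real.cos_pi]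
    exact neg_one_le_inner_sphere x μ
  rwa [huniv, Measure.restrict_univ, capMass_pi, ENNReal.ofReal_one] at h

theorem vmfConst_zero (μ : Sphere (n + 2)) : vmfConst μ 0 = 1 := by
  simp [vmfConst]

/-- Substitute t = cos θ, with one factor sin θ absorbed by dt. For `1 ≤ n` the exponent is
nonnegative, which makes the new integrand continuous up to ±1. -/
theorem capIntegral_pi_eq (hn : 1 ≤ n) (κ : ℝ) : capIntegral n κ Real.pi =
    ∫ t in (-1 : ℝ)..1, Real.exp (κ * t) * (1 - t ^ 2) ^ (((n : ℝ) - 1) / 2) := by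
  have he : (0 : ℝ) ≤ ((n : ℝ) - 1) / 2 := by
    have : (1 : ℝ) ≤ n := by exact_mod_cast hn
    linarith
  have hg : Continuous fun t : ℝ => Real.exp (κ * t) * (1 - t ^ 2) ^ (((n : ℝ) - 1) / 2) :=
    Continuous.mul (by fun_prop) (Continuous.rpow_const (by fun_prop) fun _ => Or.inr he)
  have h := intervalIntegral.integral_comp_mul_deriv (a := 0) (b := Real.pi)
    (f := Real.cos) (f' := fun θ => -Real.sin θ) (fun θ _ => Real.hasDerivAt_cos θ)
    (by fun_prop) hg
  rw [Real.cos_zero, Real.cos_pi, intervalIntegral.integral_symm (-1) 1] at h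
  rw [← neg_neg (∫ t in (-1 : ℝ)..1, _), ← h, ← intervalIntegral.integral_neg, capIntegral]
  refine intervalIntegral.integral_congr fun θ hθ => ?_
  rw [uIcc_of_le Real.pi_pos.le] at hθ
  have hs := Real.sin_nonneg_of_nonneg_of_le_pi hθ.1 hθ.2
  have h1 : (1 - Real.cos θ ^ 2) ^ (((n : ℝ) - 1) / 2) = Real.sin θ ^ (n - 1) := by
    rw [← Real.sin_sq, ← Real.rpow_natCast, ← Real.rpow_mul hs, ← Real.rpow_natCast]
    congr 1
    push_cast [Nat.cast_sub hn]
    ring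
  obtain ⟨m, rfl⟩ : ∃ m, n = m + 1 := ⟨n - 1, by omega⟩
  simp only [Function.comp_apply, h1, Nat.add_sub_cancel]
  ring

/-- The normalizing constant in terms of the modified Bessel function. -/
theorem vmfConst_eq_besselI (hn : 1 ≤ n) (μ : Sphere (n + 2)) (hκ : 0 < κ) :
    vmfConst μ κ = (κ / 2) ^ (((n + 2 : ℕ) : ℝ) / 2 - 1) *
      (1 / (Real.Gamma (((n + 2 : ℕ) : ℝ) / 2) * besselI (((n + 2 : ℕ) : ℝ) / 2 - 1) κ)) := by
  have h1 : ((n + 2 : ℕ) : ℝ) / 2 - 1 + 1 / 2 = ((n : ℝ) + 1) / 2 := by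
    push_cast
    ring
  have h2 : ((n + 2 : ℕ) : ℝ) / 2 - 1 - 1 / 2 = ((n : ℝ) - 1) / 2 := by
    push_cast
    ring
  have h3 : (((n + 1 : ℕ) : ℝ) + 1) / 2 = ((n + 2 : ℕ) : ℝ) / 2 := by
    push_cast
    ring
  have h4 : Real.pi ^ (((n + 2 : ℕ) : ℝ) / 2) =
      Real.pi ^ (((n : ℝ) + 1) / 2) * Real.sqrt Real.pi := by
    rw [Real.sqrt_eq_rpow, ← Real.rpow_add Real.pi_pos]
    congr 1
    push_cast
    ring
  have hΓ1 := Real.Gamma_pos_of_pos (s := ((n + 2 : ℕ) : ℝ) / 2) (by positivity)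
  have hΓ2 := Real.Gamma_pos_of_pos (s := ((n : ℝ) + 1) / 2) (by positivity)
  have hpi := Real.rpow_pos_of_pos Real.pi_pos (((n : ℝ) + 1) / 2)
  have hsq := Real.sqrt_pos.2 Real.pi_pos
  have hκ2 := Real.rpow_pos_of_pos (half_pos hκ) (((n + 2 : ℕ) : ℝ) / 2 - 1)
  have hJ := capIntegral_pi_pos n κ
  -- Since Γ(1/2) = √π, the ratio of sphere areas is Γ((n+2)/2) times the Gamma factor in Poisson's
  -- integral.
  rw [← inv_inv (vmfConst μ κ), inv_vmfConst, besselI, h1, h2, ← capIntegral_pi_eq hn,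
    sphereArea, sphereArea, h3, h4, Real.Gamma_one_half_eq]
  field_simp

/-! ### The function g_κ, its inverse and the Betti-0 function. -/

theorem vmfG_of_lt (hκ : 0 ≤ κ) {r : ℝ≥0∞}
    (hr : r < ENNReal.ofReal (Real.exp (-κ) / vmfConst μ κ)) : vmfG μ κ r = 0 := by
  have hc := vmfConst_pos μ κ
  have h : ENNReal.ofReal (vmfConst μ κ * Real.exp κ) < r⁻¹ := by
    have h1 : vmfConst μ κ * Real.exp κ = (Real.exp (-κ) / vmfConst μ κ)⁻¹ := by
      rw [Real.exp_neg, inv_div, div_inv_eq_mul]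
    rw [h1, ENNReal.ofReal_inv_of_pos (by positivity)]
    exact ENNReal.inv_lt_inv.2 hr
  rw [vmfG, excessMass, superlevel_vmfDensity_eq_empty hκ hc h, Measure.restrict_empty,
    lintegral_zero_measure]

theorem vmfG_of_ge (hκ : 0 ≤ κ) {r : ℝ≥0∞}
    (hr : ENNReal.ofReal (Real.exp κ / vmfConst μ κ) ≤ r) : vmfG μ κ r = 1 := by
  have hc := vmfConst_pos μ κ
  have h : r⁻¹ ≤ ENNReal.ofReal (vmfConst μ κ * Real.exp (-κ)) := by
    have h1 : vmfConst μ κ * Real.exp (-κ) = (Real.exp κ / vmfConst μ κ)⁻¹ := by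
      rw [Real.exp_neg, inv_div, div_eq_mul_inv]
    rw [h1, ENNReal.ofReal_inv_of_pos (by positivity)]
    exact ENNReal.inv_le_inv.2 hr
  rw [vmfG, excessMass, superlevel_vmfDensity_eq_univ hκ hc h, Measure.restrict_univ,
    lintegral_vmfDensity]

/-- The radius at which the superlevel set is the spherical cap of angle `t`. -/
def capRadius (μ : Sphere (n + 2)) (κ t : ℝ) : ℝ := Real.exp (-κ * Real.cos t) / vmfConst μ κ

theorem capRadius_pos (μ : Sphere (n + 2)) (κ t : ℝ) : 0 < capRadius μ κ t :=
  div_pos (Real.exp_pos _) (vmfConst_pos μ κ)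

theorem capRadius_zero : capRadius μ κ 0 = Real.exp (-κ) / vmfConst μ κ := by
  simp [capRadius]

theorem capRadius_pi : capRadius μ κ Real.pi = Real.exp κ / vmfConst μ κ := by
  simp [capRadius]

theorem strictMonoOn_capRadius (hκ : 0 < κ) : StrictMonoOn (capRadius μ κ) (Icc 0 Real.pi) := by
  intro a ha b hb hab
  refine div_lt_div_of_pos_right (Real.exp_lt_exp.2 ?_) (vmfConst_pos μ κ)
  have := Real.strictAntiOn_cos ha hb hab
  nlinarith

theorem capRadius_arccos (hκ : 0 < κ) {r : ℝ}
    (hr : r ∈ Icc (Real.exp (-κ) / vmfConst μ κ) (Real.exp κ / vmfConst μ κ)) :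
    capRadius μ κ (Real.arccos (-(Real.log (r * vmfConst μ κ) / κ))) = r := by
  have hc := vmfConst_pos μ κ
  have hr1 := (div_le_iff₀ hc).1 hr.1
  have hr2 := (le_div_iff₀ hc).1 hr.2
  have hpos : 0 < r * vmfConst μ κ := (Real.exp_pos _).trans_le hr1
  have h1 : -κ ≤ Real.log (r * vmfConst μ κ) := (Real.le_log_iff_exp_le hpos).2 hr1
  have h2 : Real.log (r * vmfConst μ κ) ≤ κ := (Real.log_le_iff_le_exp hpos).2 hr2
  have h3 : Real.log (r * vmfConst μ κ) / κ ≤ 1 := (div_le_one hκ).2 h2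
  have h4 : -1 ≤ Real.log (r * vmfConst μ κ) / κ := by
    rw [le_div_iff₀ hκ]
    linarith
  rw [capRadius, Real.cos_arccos (by linarith) (by linarith), neg_mul_neg,
    mul_div_cancel₀ _ hκ.ne', Real.exp_log hpos, mul_div_cancel_right₀ _ hc.ne']

/-- The reciprocal of the radius is the value of the density at angle t, so the superlevel set is
the cap of that angle. -/
theorem vmfG_capRadius (hκ : 0 < κ) {t : ℝ} (ht : t ∈ Icc 0 Real.pi) :
    vmfG μ κ (ENNReal.ofReal (capRadius μ κ t)) = ENNReal.ofReal (capMass μ κ t) := by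
  have hc := vmfConst_pos μ κ
  rw [← lintegral_cap_vmfDensity μ κ ht, vmfG, excessMass]
  congr 2
  ext x
  have h1 : (capRadius μ κ t)⁻¹ = vmfConst μ κ * Real.exp (κ * Real.cos t) := by
    rw [capRadius, neg_mul, Real.exp_neg, inv_div, div_inv_eq_mul]
  rw [superlevel, mem_ofPred_eq, mem_ofPred_eq, vmfDensity,
    ← ENNReal.ofReal_inv_of_pos (capRadius_pos μ κ t), h1,
    ENNReal.ofReal_le_ofReal_iff (by positivity), mul_le_mul_iff_right₀ hc, Real.exp_le_exp,
    mul_le_mul_iff_right₀ hκ]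

theorem capRadius_mem_vmfRange (hκ : 0 < κ) {t : ℝ} (ht : t ∈ Icc 0 Real.pi) :
    ENNReal.ofReal (capRadius μ κ t) ∈ vmfRange μ κ := by
  rw [vmfRange, ← capRadius_zero, ← capRadius_pi]
  have h := (strictMonoOn_capRadius (μ := μ) hκ).monotoneOn
  exact ⟨ENNReal.ofReal_le_ofReal (h ⟨le_rfl, Real.pi_pos.le⟩ ht ht.1),
    ENNReal.ofReal_le_ofReal (h ht ⟨Real.pi_pos.le, le_rfl⟩ ht.2)⟩

theorem toReal_mem_Icc_of_mem_vmfRange {r : ℝ≥0∞} (hr : r ∈ vmfRange μ κ) :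
    r.toReal ∈ Icc (Real.exp (-κ) / vmfConst μ κ) (Real.exp κ / vmfConst μ κ) := by
  have hc := vmfConst_pos μ κ
  have htop : r ≠ ⊤ := (hr.2.trans_lt ENNReal.ofReal_lt_top).ne
  exact ⟨(ENNReal.ofReal_le_iff_le_toReal htop).1 hr.1,
    ENNReal.toReal_le_of_le_ofReal (by positivity) hr.2⟩

theorem exists_capRadius_eq (hκ : 0 < κ) {r : ℝ≥0∞} (hr : r ∈ vmfRange μ κ) :
    ∃ t ∈ Icc 0 Real.pi, ENNReal.ofReal (capRadius μ κ t) = r := by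
  have htop : r ≠ ⊤ := (hr.2.trans_lt ENNReal.ofReal_lt_top).ne
  refine ⟨Real.arccos (-(Real.log (r.toReal * vmfConst μ κ) / κ)),
    ⟨Real.arccos_nonneg _, Real.arccos_le_pi _⟩, ?_⟩
  rw [capRadius_arccos hκ (toReal_mem_Icc_of_mem_vmfRange hr), ENNReal.ofReal_toReal htop]

theorem vmfG_eq_capMass (hκ : 0 < κ) {r : ℝ}
    (hr : r ∈ Icc (Real.exp (-κ) / vmfConst μ κ) (Real.exp κ / vmfConst μ κ)) :
    vmfG μ κ (ENNReal.ofReal r) = ENNReal.ofReal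
      (capMass μ κ (Real.arccos (-(Real.log (r * vmfConst μ κ) / κ)))) := by
  rw [← vmfG_capRadius hκ ⟨Real.arccos_nonneg _, Real.arccos_le_pi _⟩, capRadius_arccos hκ hr]

theorem strictMonoOn_vmfG (hκ : 0 < κ) : StrictMonoOn (vmfG μ κ) (vmfRange μ κ) := by
  intro r hr s hs hrs
  obtain ⟨t, ht, rfl⟩ := exists_capRadius_eq hκ hr
  obtain ⟨u, hu, rfl⟩ := exists_capRadius_eq hκ hs
  rw [ENNReal.ofReal_lt_ofReal_iff_of_nonneg (capRadius_pos μ κ t).le,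
    (strictMonoOn_capRadius hκ).lt_iff_lt ht hu] at hrs
  rw [vmfG_capRadius hκ ht, vmfG_capRadius hκ hu,
    ENNReal.ofReal_lt_ofReal_iff_of_nonneg (capMass_mem_Icc μ κ ht).1]
  exact strictMonoOn_capMass μ κ ht hu hrs

theorem bijOn_vmfG (hκ : 0 < κ) : BijOn (vmfG μ κ) (vmfRange μ κ) (Icc 0 1) := by
  refine ⟨fun r hr => ?_, (strictMonoOn_vmfG hκ).injOn, fun x hx => ?_⟩
  · obtain ⟨t, ht, rfl⟩ := exists_capRadius_eq hκ hr
    rw [vmfG_capRadius hκ ht]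
    exact ⟨zero_le, ENNReal.ofReal_le_one.2 (capMass_mem_Icc μ κ ht).2⟩
  · have htop : x ≠ ⊤ := (hx.2.trans_lt ENNReal.one_lt_top).ne
    have hx' : x.toReal ∈ Icc (capMass μ κ 0) (capMass μ κ Real.pi) := by
      rw [capMass_zero, capMass_pi]
      exact ⟨ENNReal.toReal_nonneg, ENNReal.toReal_le_of_le_ofReal zero_le_one (by simpa using hx.2)⟩
    obtain ⟨t, ht, htx⟩ := intermediate_value_Icc Real.pi_pos.le
      (continuous_capMass μ κ).continuousOn hx'
    refine ⟨_, capRadius_mem_vmfRange hκ ht, ?_⟩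
    rw [vmfG_capRadius hκ ht, htx, ENNReal.ofReal_toReal htop]

theorem ofReal_exp_neg_le_ofReal_exp (hκ : 0 ≤ κ) :
    ENNReal.ofReal (Real.exp (-κ) / vmfConst μ κ) ≤ ENNReal.ofReal (Real.exp κ / vmfConst μ κ) :=
  ENNReal.ofReal_le_ofReal (div_le_div_of_nonneg_right (Real.exp_le_exp.2 (by linarith))
    (vmfConst_pos μ κ).le)

/-- Since g_κ is constant on either side of the critical interval, the explicit formula, evaluated
at r clamped to that interval, holds on all of [0, ∞] and is visibly continuous. -/
theorem continuous_vmfG (hκ : 0 < κ) : Continuous (vmfG μ κ) := by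
  have hc := vmfConst_pos μ κ
  set lo := ENNReal.ofReal (Real.exp (-κ) / vmfConst μ κ) with hlo
  set hi := ENNReal.ofReal (Real.exp κ / vmfConst μ κ) with hhi
  have hlohi : lo ≤ hi := ofReal_exp_neg_le_ofReal_exp hκ.le
  let clamp : ℝ≥0∞ → ℝ≥0∞ := fun r => max lo (min r hi)
  have hclamp : ∀ r, clamp r ∈ vmfRange μ κ := fun r =>
    ⟨le_max_left _ _, max_le hlohi (min_le_right _ _)⟩
  have hcont : Continuous fun r => (clamp r).toReal :=
    ENNReal.continuousOn_toReal.comp_continuous (by fun_prop) fun r =>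
      ((hclamp r).2.trans_lt ENNReal.ofReal_lt_top).ne
  have hpos : ∀ r, 0 < (clamp r).toReal := fun r =>
    lt_of_lt_of_le (by positivity) (toReal_mem_Icc_of_mem_vmfRange (hclamp r)).1
  have heq : vmfG μ κ = fun r => ENNReal.ofReal (capMass μ κ
      (Real.arccos (-(Real.log ((clamp r).toReal * vmfConst μ κ) / κ)))) := by
    funext r
    rw [← vmfG_eq_capMass hκ (toReal_mem_Icc_of_mem_vmfRange (hclamp r)),
      ENNReal.ofReal_toReal ((hclamp r).2.trans_lt ENNReal.ofReal_lt_top).ne]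
    rcases lt_or_ge r lo with h | h
    · have h1 : clamp r = lo := max_eq_left ((min_le_left _ _).trans h.le)
      rw [vmfG_of_lt hκ.le h, h1, hlo, ← capRadius_zero,
        vmfG_capRadius hκ ⟨le_rfl, Real.pi_pos.le⟩, capMass_zero, ENNReal.ofReal_zero]
    · rcases le_or_gt r hi with h' | h'
      · have h1 : clamp r = r := by simp only [clamp, min_eq_left h', max_eq_right h]
        rw [h1]
      · rw [vmfG_of_ge hκ.le h'.le, vmfG_of_ge hκ.le]
        simp only [clamp, min_eq_right h'.le]
        exact le_max_right _ _
  rw [heq]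
  refine ENNReal.continuous_ofReal.comp ((continuous_capMass μ κ).comp
    (Real.continuous_arccos.comp ((Continuous.log (hcont.mul_const _) fun r => ?_).div_const
      κ).neg))
  exact (mul_pos (hpos r) hc).ne'

/-- Strict monotonicity, and g_κ = 0 below the interval, make `r` the least radius of its mass.
Positivity matters: for mass 0 the infimum would be 0 and not the left endpoint. -/
theorem vmfBettiZero_vmfG (hκ : 0 < κ) {r : ℝ≥0∞} (hr : r ∈ vmfRange μ κ)
    (h0 : 0 < vmfG μ κ r) : vmfBettiZero μ κ (vmfG μ κ r) = r := by
  refine IsLeast.csInf_eq ⟨le_refl (vmfG μ κ r), fun s hs => ?_⟩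
  by_contra hlt
  have hlt := not_le.1 hlt
  refine absurd (show vmfG μ κ r ≤ vmfG μ κ s from hs) (not_le.2 ?_)
  rcases lt_or_ge s (ENNReal.ofReal (Real.exp (-κ) / vmfConst μ κ)) with h | h
  · rwa [vmfG_of_lt hκ.le h]
  · exact strictMonoOn_vmfG hκ ⟨h, hlt.le.trans hr.2⟩ hr hlt

theorem image_vmfG_eq_image_capMass (hκ : 0 < κ) :
    (fun r => (vmfG μ κ r, r)) '' vmfRange μ κ =
      (fun t : ℝ => (ENNReal.ofReal (capMass μ κ t),
        ENNReal.ofReal (Real.exp (-κ * Real.cos t) / vmfConst μ κ))) '' Icc 0 Real.pi := by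
  ext q
  constructor
  · rintro ⟨r, hr, rfl⟩
    obtain ⟨t, ht, rfl⟩ := exists_capRadius_eq hκ hr
    exact ⟨t, ht, Prod.ext (vmfG_capRadius hκ ht).symm rfl⟩
  · rintro ⟨t, ht, rfl⟩
    exact ⟨_, capRadius_mem_vmfRange hκ ht, Prod.ext (vmfG_capRadius hκ ht) rfl⟩

end Mass

end DensityPersistence

end

/-! ### Assembly of the main theorem. -/

theorem mainTheorem3 {F : Type*} [Field F] (p : ℕ) (hp : 3 ≤ p) (μ : Sphere p)
    (κ : ℝ) (hκ : 0 ≤ κ) :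
    -- `f` is a probability density on the sphere; the value of its normalizing constant
    (IsProbabilityMeasure (uniformMeasure p) ∧ 0 < vmfConst μ κ ∧
      ∫⁻ x, vmfDensity μ κ x ∂uniformMeasure p = 1 ∧
      (κ = 0 → vmfConst μ κ = 1) ∧
      (0 < κ → vmfConst μ κ = (κ / 2) ^ ((p : ℝ) / 2 - 1) *
        (1 / (Real.Gamma ((p : ℝ) / 2) * besselI ((p : ℝ) / 2 - 1) κ)))) ∧
    -- the barcodes of the Morse filtration
    ((morseFiltration (vmfDensity μ κ) F).BettiBarcodeEq 0
        (fun _ : Unit => Ici ((vmfConst μ κ * Real.exp (-κ) : ℝ) : EReal)) ∧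
      (morseFiltration (vmfDensity μ κ) F).BettiBarcodeEq (p - 1)
        (fun _ : Unit => Ici ((vmfConst μ κ * Real.exp κ : ℝ) : EReal)) ∧
      ∀ k : ℕ, k ≠ 0 → k ≠ p - 1 →
        (morseFiltration (vmfDensity μ κ) F).BettiBarcodeEq k (fun i : Empty => i.elim)) ∧
    -- the barcodes of the Čech filtration in positive degrees
    ((cechFiltration (vmfDensity μ κ) F).BettiBarcodeEq (p - 1)
        (fun _ : Unit => Ici ((Real.exp κ / vmfConst μ κ : ℝ) : EReal)) ∧
      ∀ k : ℕ, 1 ≤ k → k ≠ p - 1 →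
        (cechFiltration (vmfDensity μ κ) F).BettiBarcodeEq k (fun i : Empty => i.elim)) ∧
    -- the Betti-0 function for `κ = 0`
    (κ = 0 →
      (∀ r < ENNReal.ofReal (1 / vmfConst μ κ), vmfG μ κ r = 0) ∧
      (∀ r ≥ ENNReal.ofReal (1 / vmfConst μ κ), vmfG μ κ r = 1) ∧
      ∀ x ∈ Ioc (0 : ℝ≥0∞) 1, vmfBettiZero μ κ x = ENNReal.ofReal (1 / vmfConst μ κ)) ∧
    -- the Betti-0 function for `κ > 0`: it is the inverse of `g`
    (0 < κ →
      (∀ r < ENNReal.ofReal (Real.exp (-κ) / vmfConst μ κ), vmfG μ κ r = 0) ∧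
      (∀ r > ENNReal.ofReal (Real.exp κ / vmfConst μ κ), vmfG μ κ r = 1) ∧
      (∀ r ∈ Icc (Real.exp (-κ) / vmfConst μ κ) (Real.exp κ / vmfConst μ κ),
        vmfG μ κ (ENNReal.ofReal r) = ENNReal.ofReal
          (capMass μ κ (Real.arccos (-(Real.log (r * vmfConst μ κ) / κ))))) ∧
      Continuous (vmfG μ κ) ∧ StrictMonoOn (vmfG μ κ) (vmfRange μ κ) ∧
      BijOn (vmfG μ κ) (vmfRange μ κ) (Icc 0 1) ∧
      (∀ x ∈ Ioc (0 : ℝ≥0∞) 1,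
        vmfBettiZero μ κ x ∈ vmfRange μ κ ∧ vmfG μ κ (vmfBettiZero μ κ x) = x) ∧
      (fun r => (vmfG μ κ r, r)) '' vmfRange μ κ =
        (fun t : ℝ => (ENNReal.ofReal (capMass μ κ t),
          ENNReal.ofReal (Real.exp (-κ * Real.cos t) / vmfConst μ κ))) '' Icc 0 Real.pi) := by
  -- With n = p − 2, the exponent of the sine, the truncated subtractions in `capMass` reduce
  -- definitionally.
  obtain ⟨n, rfl⟩ : ∃ n, p = n + 2 := ⟨p - 2, by omega⟩
  have hn : 1 ≤ n := by omega
  have hc := vmfConst_pos μ κ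
  refine ⟨⟨isProbabilityMeasure_uniformMeasure (n + 1), hc, lintegral_vmfDensity μ κ, ?_,
    vmfConst_eq_besselI hn μ⟩, vmf_morse_barcodes hp hκ hc, vmf_cech_barcodes hp hκ hc, ?_, ?_⟩
  · rintro rfl
    exact vmfConst_zero μ
  · rintro rfl
    have hlt : ∀ r < ENNReal.ofReal (1 / vmfConst μ 0), vmfG μ 0 r = 0 := fun r hr =>
      vmfG_of_lt le_rfl (by rwa [neg_zero, Real.exp_zero])
    have hge : ∀ r ≥ ENNReal.ofReal (1 / vmfConst μ 0), vmfG μ 0 r = 1 := fun r hr =>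
      vmfG_of_ge le_rfl (by rwa [Real.exp_zero])
    refine ⟨hlt, hge, fun x hx => IsLeast.csInf_eq ⟨hx.2.trans (hge _ le_rfl).ge, fun r hr => ?_⟩⟩
    by_contra h
    exact hx.1.not_ge ((show x ≤ vmfG μ 0 r from hr).trans (hlt r (not_le.1 h)).le)
  · intro hκ'
    refine ⟨fun r => vmfG_of_lt hκ, fun r hr => vmfG_of_ge hκ hr.le,
      fun r => vmfG_eq_capMass hκ', continuous_vmfG hκ', strictMonoOn_vmfG hκ', bijOn_vmfG hκ',
      fun x hx => ?_, image_vmfG_eq_image_capMass hκ'⟩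
    obtain ⟨r, hr, rfl⟩ := (bijOn_vmfG (μ := μ) hκ').surjOn (Ioc_subset_Icc_self hx)
    rw [vmfBettiZero_vmfG hκ' hr hx.1]
    exact ⟨hr, rfl⟩
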